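/- **Setting.** Let $\mathscr I=\mathbb R\times\mathbb S^2$ with coordinates $(u,p)$ (future null infinity in a Bondi frame), with the measure $du\,d\mathbb S^2$, where $d\mathbb S^2$ is the standard surface measure of the unit sphere. Let $S^*\to\mathscr I$ be the pull-back of $T^*\mathbb S^2$ along $(u,p)\mapsto p$, let $(\cdot,\cdot)$ be the pairing of covectors given by the inverse round metric (extended complex bilinearly), and put $\langle f,h\rangle=\int (f,h)\,du\,d\mathbb S^2$. Let $\mathcal S(\mathscr I)$ be the real vector space of smooth sections $f$ of $S^*$ with $\langle f,f\rangle<\infty$ and $\langle\partial_uf,\partial_uf\rangle<\infty$, with the symplectic form $\varsigma(f,h)=\langle f,\partial_uh\rangle-\langle\partial_uf,h\rangle$ and the norm $\|f\|^2=\langle f,f\rangle+\langle\partial_uf,\partial_uf\rangle$. Let $\mathcal A(\mathscr I)$ be the quotient of the free unital $*$-algebra $\mathbb C\oplus\bigoplus_{n\ge1}\mathcal S(\mathscr I)^{\otimes n}\otimes\mathbb C$ by the $*$-ideal generated by the elements $f\otimes h-h\otimes f-i\varsigma(f,h)1$, where $(f_1\otimes\cdots\otimes f_n\otimes z)^*=f_n\otimes\cdots\otimes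 f_1\otimes\bar z$. Let $\alpha_t$, $t\in\mathbb R$, be the action on $\mathcal A(\mathscr I)$ induced by $(\alpha_tf)(u,p)=f(u-t,p)$. A *state* is a linear functional $\omega:\mathcal A(\mathscr I)\to\mathbb C$ with $\omega(1)=1$ and $\omega(a^*a)\ge0$ for all $a$ that is continuous, in the sense that for each $n$ there is a constant $C_n$ with $|\omega(f_1\cdots f_n)|\le C_n\|f_1\|\cdots\|f_n\|$ for all $f_1,\dots,f_n\in\mathcal S(\mathscr I)$. It is *quasi-free with two-point function* $\omega_2$ if $\omega(f_1\cdots f_n)=0$ for odd $n$, and for even $n$ $$\omega(f_1\cdots f_n)=\sum_{\pi}\prod_{i=1}^{n/2}\omega_2(f_{\pi(2i-1)}\otimes f_{\pi(2i)}),$$ the sum being over the permutations $\pi$ of $\{1,\dots,n\}$ with $\pi(2i-1)<\pi(2i)$ for $1\le i\le n/2$ and $\pi(2i-1)<\pi(2i+1)$ for $1\le i<n/2$. It is *KMS at inverse temperature $\beta>0$* with respect to $\alpha$ if for all $a,b\in\mathcal A(\mathscr I)$ there is a bounded continuous function $F$ on the strip $0\le\operatorname{Im}z\le\beta$, holomorphic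 in its interior, with $F(t)=\omega(a\,\alpha_t(b))$ and $F(t+i\beta)=\omega(\alpha_t(b)\,a)$ for all $t\in\mathbb R$. Let $\widehat f(k,p)=\int e^{-iku}f(u,p)\,du$ (in the $L^2$ sense, for almost every $p$), and for $T>0$ let $$\omega^{\mathscr I}_{2,T}(f\otimes h)=\frac1\pi\int_{\mathbb R\times\mathbb S^2}\frac{k}{1-e^{-k/T}}\,\big(\widehat f(k,p),\widehat h(-k,p)\big)\,dk\,d\mathbb S^2(p),$$ where for $T=0$ the Bose factor is replaced by its limit $k\,\Theta(k)$, with $\Theta$ the Heaviside function. Let $$\omega^{\mathscr I}_2(f\otimes h)=\lim_{\epsilon\to0^+}-\frac1\pi\int_{\mathbb R^2\times\mathbb S^2}\frac{\big(f(u,p),h(u',p)\big)}{(u-u'-i\epsilon)^2}\,du\,du'\,d\mathbb S^2(p).$$ **Proposition.** For all $f,h\in\mathcal S(\mathscr I)$ the integrals above converge absolutely (for all $\epsilon>0$ and all $T\ge0$) and the limit exists. There is exactly one quasi-free state $\omega^{\mathscr I}$ with two-point function $\omega^{\mathscr I}_2$, and for each $T\ge0$ exactly one quasi-free state $\omega^{\mathscr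 I}_T$ with two-point function $\omega^{\mathscr I}_{2,T}$; moreover $\omega^{\mathscr I}_0=\omega^{\mathscr I}$. For each $T>0$ the state $\omega^{\mathscr I}_T$ is KMS at inverse temperature $1/T$ with respect to the $u$-translations $\alpha_t$. As $T\to0^+$, $\omega^{\mathscr I}_T(a)\to\omega^{\mathscr I}(a)$ for every $a\in\mathcal A(\mathscr I)$. -/

import Mathlib

open MeasureTheory Filter Topology
open scoped TensorProduct

noncomputable section

namespace NullInfinity

section Geometry

open scoped ContDiff Manifold

/-! ### Null infinity in a Bondi frame -/

/-- Euclidean three-space. -/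
abbrev E3 : Type := EuclideanSpace ℝ (Fin 3)

/-- Complexified Euclidean three-space. -/
abbrev E3C : Type := EuclideanSpace ℂ (Fin 3)

/-- The unit two-sphere. -/
abbrev S2 : Type := Metric.sphere (0 : E3) 1

/-- Future null infinity in a Bondi frame `(u, p)`, with `u` the affine parameter. -/
abbrev Scri : Type := ℝ × S2

/-- The standard surface measure on the unit two-sphere (of total mass `4π`). -/
def sphereMeasure : Measure S2 := (volume : Measure E3).toSphere

/-- The measure `du dS²` on null infinity. -/
def scriMeasure : Measure Scri := (volume : Measure ℝ).prod sphereMeasure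

/-- The derivative `∂_u f` of a field along the null generators. -/
def partialU (f : Scri → E3) : Scri → E3 :=
  fun x => deriv (fun u : ℝ => f (u, x.2)) x.1

/-- Smooth fields on null infinity, as maps of manifolds. -/
def IsSmoothField (f : Scri → E3) : Prop :=
  ContMDiff ((𝓘(ℝ, ℝ)).prod (𝓡 2)) 𝓘(ℝ, E3) ∞ f

theorem IsSmoothField.differentiable_line {f : Scri → E3} (hf : IsSmoothField f) (p : S2) :
    Differentiable ℝ (fun u : ℝ => f (u, p)) := by
  have h1 : ContMDiff 𝓘(ℝ, ℝ) ((𝓘(ℝ, ℝ)).prod (𝓡 2)) ∞ (fun u : ℝ => ((u, p) : Scri)) :=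
    contMDiff_id.prodMk contMDiff_const
  exact ((hf.comp h1).contDiff).differentiable (by simp)

theorem partialU_add {f h : Scri → E3} (hf : IsSmoothField f) (hh : IsSmoothField h) :
    partialU (f + h) = partialU f + partialU h := by
  funext x
  exact deriv_add (hf.differentiable_line x.2 x.1) (hh.differentiable_line x.2 x.1)

theorem partialU_smul (c : ℝ) {f : Scri → E3} (hf : IsSmoothField f) :
    partialU (c • f) = c • partialU f := by
  funext x
  exact deriv_const_smul c (hf.differentiable_line x.2 x.1)

/-- The real vector space `𝒮(𝓘)` of smooth sections `f` of `S^*`, the pull-back to `ℝ × S²` of the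
cotangent bundle of the unit sphere, such that `f` and `∂_u f` are square integrable.

A covector at `p` is represented by its dual with respect to the round metric `g_S`, that is, by a
vector of `ℝ³` orthogonal to `p` (the tangent space at `p` of the sphere in `ℝ³`). Under this
identification the inverse metric `g_S⁻¹` on covectors is the scalar product of `ℝ³`, and
smoothness of sections is smoothness of maps to `ℝ³`. -/
def fieldSpace : Submodule ℝ (Scri → E3) where
  carrier := {f | IsSmoothField f ∧ (∀ x : Scri, inner ℝ (x.2 : E3) (f x) = 0) ∧
    MemLp f 2 scriMeasure ∧ MemLp (partialU f) 2 scriMeasure}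
  zero_mem' := by
    refine ⟨contMDiff_const, fun x => by simp, MemLp.zero, ?_⟩
    have : partialU (0 : Scri → E3) = 0 := by
      funext x
      simp [partialU]
    rw [this]
    exact MemLp.zero
  add_mem' := by
    rintro f h ⟨f1, f2, f3, f4⟩ ⟨h1, h2, h3, h4⟩
    refine ⟨f1.add h1, fun x => ?_, f3.add h3, ?_⟩
    · rw [Pi.add_apply, inner_add_right, f2 x, h2 x, add_zero]
    · rw [partialU_add f1 h1]
      exact f4.add h4
  smul_mem' := by
    rintro c f ⟨f1, f2, f3, f4⟩
    refine ⟨(ContinuousLinearMap.contMDiff (c • ContinuousLinearMap.id ℝ E3)).comp f1, fun x => ?_, f3.const_smul c, ?_⟩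
    · rw [Pi.smul_apply, inner_smul_right, f2 x, mul_zero]
    · rw [partialU_smul c f1]
      exact f4.const_smul c

/-- The elements of `𝒮(𝓘)`. -/
abbrev Field : Type := fieldSpace

/-- The pairing `⟨f, h⟩ = ∫ g_S⁻¹(f, h) du dS²`. -/
def pairing (f h : Scri → E3) : ℝ := ∫ x, inner ℝ (f x) (h x) ∂scriMeasure

/-- The symplectic form `ς(f, h) = ⟨f, ∂_u h⟩ - ⟨∂_u f, h⟩`. -/
def symplecticForm (f h : Field) : ℝ :=
  pairing f.1 (partialU h.1) - pairing (partialU f.1) h.1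

theorem symplecticForm_swap (f h : Field) : symplecticForm h f = -symplecticForm f h := by
  have h1 : ∀ a b : Scri → E3, pairing a b = pairing b a := fun a b => by
    simp only [pairing, real_inner_comm]
  unfold symplecticForm
  rw [h1 h.1, h1 (partialU h.1)]
  ring

/-- The norm of `𝒮(𝓘)`: `‖f‖² = ⟨f, f⟩ + ⟨∂_u f, ∂_u f⟩`. -/
def fieldNorm (f : Field) : ℝ :=
  Real.sqrt (pairing f.1 f.1 + pairing (partialU f.1) (partialU f.1))

/-! ### Translations along `u` -/

/-- The translation `x = (u, p) ↦ (u - t, p)` of null infinity. -/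
def shift (t : ℝ) (x : Scri) : Scri := (x.1 - t, x.2)

theorem measurePreserving_shift (t : ℝ) :
    MeasurePreserving (shift t) scriMeasure scriMeasure := by
  have : IsFiniteMeasure sphereMeasure := by unfold sphereMeasure; infer_instance
  exact (measurePreserving_sub_right (volume : Measure ℝ) t).prod (MeasurePreserving.id _)

theorem partialU_shift (t : ℝ) (f : Scri → E3) :
    partialU (fun x => f (shift t x)) = fun x => partialU f (shift t x) := by
  funext x
  exact deriv_comp_sub_const (f := fun u : ℝ => f (u, x.2)) t x.1

/-- The action `(α_t f)(u, p) = f(u - t, p)` of `u`-translations on `𝒮(𝓘)`. -/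
def translate (t : ℝ) : Field →ₗ[ℝ] Field where
  toFun f := ⟨fun x => f.1 (shift t x), by
    obtain ⟨f1, f2, f3, f4⟩ := f.2
    refine ⟨?_, fun x => f2 (shift t x), f3.comp_measurePreserving (measurePreserving_shift t), ?_⟩
    · have h1 : ContMDiff ((𝓘(ℝ, ℝ)).prod (𝓡 2)) 𝓘(ℝ, ℝ) ∞ (fun x : Scri => x.1 - t) :=
        contMDiff_fst.sub contMDiff_const
      exact ContMDiff.comp f1 (h1.prodMk contMDiff_snd)
    · rw [partialU_shift]
      exact f4.comp_measurePreserving (measurePreserving_shift t)⟩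
  map_add' _ _ := rfl
  map_smul' _ _ := rfl

theorem pairing_shift (t : ℝ) (f h : Scri → E3) :
    pairing (fun x => f (shift t x)) (fun x => h (shift t x)) = pairing f h := by
  have hs : MeasurableEmbedding (shift t) :=
    (MeasurableEquiv.prodCongr (MeasurableEquiv.subRight t)
      (MeasurableEquiv.refl S2)).measurableEmbedding
  exact (measurePreserving_shift t).integral_comp hs (fun x => inner ℝ (f x) (h x))

theorem symplecticForm_translate (t : ℝ) (f h : Field) :
    symplecticForm (translate t f) (translate t h) = symplecticForm f h := by
  change pairing (fun x => f.1 (shift t x)) (partialU (fun x => h.1 (shift t x))) -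
    pairing (partialU (fun x => f.1 (shift t x))) (fun x => h.1 (shift t x)) = _
  rw [partialU_shift, partialU_shift, pairing_shift, pairing_shift]
  rfl

end Geometry

/-! ### The boundary algebra -/

/-- The reversal anti-automorphism of the real tensor algebra over `𝒮(𝓘)`. -/
def tensorReverse : TensorAlgebra ℝ Field →ₐ[ℝ] (TensorAlgebra ℝ Field)ᵐᵒᵖ :=
  TensorAlgebra.lift ℝ ((MulOpposite.opLinearEquiv ℝ).toLinearMap ∘ₗ TensorAlgebra.ι ℝ)

theorem tensorReverse_involutive (x : TensorAlgebra ℝ Field) :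
    (tensorReverse (tensorReverse x).unop).unop = x := by
  induction x using TensorAlgebra.induction with
  | algebraMap r => simp
  | ι f => simp [tensorReverse]
  | mul a b ha hb => simp [ha, hb]
  | add a b ha hb => simp [ha, hb]

/-- Real tensors carry the `*`-operation that reverses the order of the factors. -/
instance tensorStarRing : StarRing (TensorAlgebra ℝ Field) where
  star x := (tensorReverse x).unop
  star_involutive := tensorReverse_involutive
  star_mul x y := by simp
  star_add x y := by simp

theorem star_tensor_ι (f : Field) :
    star (TensorAlgebra.ι ℝ f : TensorAlgebra ℝ Field) = TensorAlgebra.ι ℝ f := by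
  change (tensorReverse _).unop = _
  simp [tensorReverse]

instance tensorStarModule : StarModule ℝ (TensorAlgebra ℝ Field) where
  star_smul r x := by
    change (tensorReverse _).unop = r • (tensorReverse _).unop
    simp

/-- The free unital `*`-algebra `ℂ ⊕ ⨁ₙ 𝒮(𝓘)^{⊗ n} ⊗ ℂ`, with the `*`-operation
`(z ⊗ (f₁ ⊗ ⋯ ⊗ fₙ))* = z̄ ⊗ (fₙ ⊗ ⋯ ⊗ f₁)`. -/
abbrev FreeBoundaryAlgebra : Type := ℂ ⊗[ℝ] TensorAlgebra ℝ Field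

/-- The generator `f` of the free algebra. -/
def freeField (f : Field) : FreeBoundaryAlgebra := (1 : ℂ) ⊗ₜ[ℝ] TensorAlgebra.ι ℝ f

theorem star_freeField (f : Field) : star (freeField f) = freeField f := by
  simp [freeField, star_tensor_ι]

/-- The canonical commutation relations `f ⊗ h - h ⊗ f = i ς(f, h)`. -/
inductive CCR : FreeBoundaryAlgebra → FreeBoundaryAlgebra → Prop
  | comm (f h : Field) : CCR (freeField f * freeField h)
      (freeField h * freeField f +
        algebraMap ℂ FreeBoundaryAlgebra (Complex.I * (symplecticForm f h : ℂ)))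

theorem CCR.star_rel (a b : FreeBoundaryAlgebra) (hab : CCR a b) : CCR (star a) (star b) := by
  obtain ⟨f, h⟩ := hab
  have h1 := CCR.comm h f
  have h2 : star (algebraMap ℂ FreeBoundaryAlgebra (Complex.I * (symplecticForm f h : ℂ))) =
      algebraMap ℂ FreeBoundaryAlgebra (Complex.I * (symplecticForm h f : ℂ)) := by
    rw [symplecticForm_swap f h, Algebra.TensorProduct.algebraMap_apply,
      Algebra.TensorProduct.algebraMap_apply, TensorProduct.star_tmul, star_one]
    simp
  rw [star_add, star_mul, star_mul, star_freeField, star_freeField, h2]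
  exact h1

/-- The boundary algebra `𝒜(𝓘)`: the quotient of the free unital `*`-algebra by the
(two-sided `*`-)ideal generated by the canonical commutation relations. -/
abbrev BoundaryAlgebra : Type := RingQuot CCR

instance boundaryStarRing : StarRing BoundaryAlgebra := RingQuot.starRing CCR CCR.star_rel

/-- The image in `𝒜(𝓘)` of the generator `f`. -/
def field (f : Field) : BoundaryAlgebra := RingQuot.mkAlgHom ℂ CCR (freeField f)

/-- The algebra homomorphism of free algebras induced by a `u`-translation. -/
def freeTranslation (t : ℝ) : FreeBoundaryAlgebra →ₐ[ℂ] FreeBoundaryAlgebra :=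
  Algebra.TensorProduct.map (AlgHom.id ℂ ℂ) (TensorAlgebra.lift ℝ (TensorAlgebra.ι ℝ ∘ₗ translate t))

theorem freeTranslation_freeField (t : ℝ) (f : Field) :
    freeTranslation t (freeField f) = freeField (translate t f) := by
  simp [freeTranslation, freeField]

/-- The action `α_t` of `u`-translations on the boundary algebra. -/
def translation (t : ℝ) : BoundaryAlgebra →ₐ[ℂ] BoundaryAlgebra :=
  RingQuot.liftAlgHom ℂ ⟨(RingQuot.mkAlgHom ℂ CCR).comp (freeTranslation t), by
    rintro _ _ ⟨f, h⟩
    have h1 := RingQuot.mkAlgHom_rel ℂ (CCR.comm (translate t f) (translate t h))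
    rw [symplecticForm_translate] at h1
    simpa only [AlgHom.comp_apply, map_mul, map_add, AlgHom.commutes,
      freeTranslation_freeField] using h1⟩

theorem translation_field (t : ℝ) (f : Field) :
    translation t (field f) = field (translate t f) := by
  simp [translation, field, freeTranslation_freeField]

/-! ### States -/

open scoped ComplexOrder in
/-- States on the boundary algebra. Continuity refers to the topology that `𝒜(𝓘)` inherits, as a
quotient of a direct sum of (projective) tensor powers, from the norm of `𝒮(𝓘)`: the linear
functional is continuous if and only if each of its `n`-point functions is a bounded `n`-linear
form. -/
structure IsState (ω : BoundaryAlgebra →ₗ[ℂ] ℂ) : Prop where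
  normalized : ω 1 = 1
  nonneg : ∀ a : BoundaryAlgebra, 0 ≤ ω (star a * a)
  continuous : ∀ n : ℕ, ∃ C : ℝ, ∀ f : Fin n → Field,
    ‖ω (List.ofFn fun i => field (f i)).prod‖ ≤ C * ∏ i, fieldNorm (f i)

/-- The position `2i` in a list of `2m` elements. -/
def evenIdx {m : ℕ} (i : Fin m) : Fin (2 * m) := ⟨2 * i.1, by omega⟩

/-- The position `2i + 1` in a list of `2m` elements. -/
def oddIdx {m : ℕ} (i : Fin m) : Fin (2 * m) := ⟨2 * i.1 + 1, by omega⟩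

/-- The ordered permutations of `2m` elements, which enumerate the decompositions into pairs. -/
def orderedPerms (m : ℕ) : Finset (Equiv.Perm (Fin (2 * m))) :=
  Finset.univ.filter fun σ =>
    (∀ i : Fin m, σ (evenIdx i) < σ (oddIdx i)) ∧
    (∀ i j : Fin m, i < j → σ (evenIdx i) < σ (evenIdx j))

/-- `ω` is quasi-free with two-point function `ω₂`: the odd `n`-point functions vanish and the even
ones are sums over pairings of products of two-point functions. -/
def IsQuasiFree (ω₂ : Field → Field → ℂ) (ω : BoundaryAlgebra →ₗ[ℂ] ℂ) : Prop :=
  (∀ (m : ℕ) (f : Fin (2 * m + 1) → Field), ω (List.ofFn fun i => field (f i)).prod = 0) ∧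
  (∀ (m : ℕ) (f : Fin (2 * m) → Field), ω (List.ofFn fun i => field (f i)).prod =
    ∑ σ ∈ orderedPerms m, ∏ i : Fin m, ω₂ (f (σ (evenIdx i))) (f (σ (oddIdx i))))

/-- `ω` is a quasi-free state with two-point function `ω₂`. -/
def IsQuasiFreeState (ω₂ : Field → Field → ℂ) (ω : BoundaryAlgebra →ₗ[ℂ] ℂ) : Prop :=
  IsState ω ∧ IsQuasiFree ω₂ ω

/-- The KMS condition at inverse temperature `β > 0` with respect to the `u`-translations: for all
`a`, `b` the function `t ↦ ω(a α_t(b))` extends to a bounded continuous function on the strip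
`0 ≤ Im z ≤ β`, holomorphic in the interior, whose value at `t + iβ` is `ω(α_t(b) a)`. -/
def IsKMS (β : ℝ) (ω : BoundaryAlgebra →ₗ[ℂ] ℂ) : Prop :=
  ∀ a b : BoundaryAlgebra, ∃ F : ℂ → ℂ,
    ContinuousOn F {z : ℂ | 0 ≤ z.im ∧ z.im ≤ β} ∧
    DifferentiableOn ℂ F {z : ℂ | 0 < z.im ∧ z.im < β} ∧
    (∃ C : ℝ, ∀ z : ℂ, 0 ≤ z.im → z.im ≤ β → ‖F z‖ ≤ C) ∧
    ∀ t : ℝ, F (t : ℂ) = ω (a * translation t b) ∧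
      F ((t : ℂ) + (β : ℂ) * Complex.I) = ω (translation t b * a)

/-! ### Two-point functions -/

/-- The integrand of the vacuum two-point function, with regulator `ε`, at `((u, u'), p)`. -/
def vacuumIntegrand (ε : ℝ) (f h : Field) (x : (ℝ × ℝ) × S2) : ℂ :=
  ((inner ℝ (f.1 (x.1.1, x.2)) (h.1 (x.1.2, x.2)) : ℝ) : ℂ) /
    ((x.1.1 : ℂ) - (x.1.2 : ℂ) - Complex.I * (ε : ℂ)) ^ 2

/-- The measure `du du' dS²`. -/
def doubleMeasure : Measure ((ℝ × ℝ) × S2) :=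
  ((volume : Measure ℝ).prod (volume : Measure ℝ)).prod sphereMeasure

/-- The regularised vacuum two-point function. -/
def vacuumRegularised (ε : ℝ) (f h : Field) : ℂ :=
  -(1 / (Real.pi : ℂ)) * ∫ x, vacuumIntegrand ε f h x ∂doubleMeasure

/-- The vacuum two-point function, the limit `ε → 0⁺` of the regularised ones. -/
def vacuumTwoPoint (f h : Field) : ℂ :=
  limUnder (𝓝[>] (0 : ℝ)) fun ε => vacuumRegularised ε f h

/-- The restriction of a field to the null generator through `p`, with complex components. -/
def fieldLine (f : Field) (p : S2) : ℝ → E3C :=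
  fun u => WithLp.toLp 2 fun i => ((f.1 (u, p) i : ℝ) : ℂ)

open Classical in
/-- The Fourier transform in `u` along the null generator through `p`, in the convention
`f̂(k, p) = ∫ e^{-iku} f(u, p) du`, understood in the sense of `L²(ℝ, du)`. Almost every generator
carries a square integrable restriction of `f`; the value `0` is used on the others. -/
def fourierU (f : Field) (p : S2) : ℝ → E3C :=
  if hf : MemLp (fieldLine f p) 2 (volume : Measure ℝ) then
    fun k => (FourierTransform.fourier (hf.toLp (fieldLine f p)) :
      Lp E3C 2 (volume : Measure ℝ)) (k / (2 * Real.pi))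
  else 0

/-- The Bose factor `k / (1 - e^{-k/T})` for `T > 0`; its limit `k Θ(k)` for `T = 0`. -/
def boseFactor (T k : ℝ) : ℝ :=
  if T = 0 then max k 0 else k / (1 - Real.exp (-k / T))

/-- The integrand `k / (1 - e^{-k/T}) (f̂(k, p), ĥ(-k, p))` of the thermal two-point function, with
the complex bilinear extension of `g_S⁻¹`. -/
def modeIntegrand (T : ℝ) (f h : Field) (p : S2) (k : ℝ) : ℂ :=
  (boseFactor T k : ℂ) * ∑ i : Fin 3, fourierU f p k i * fourierU h p (-k) i

/-- Absolute convergence of the integral over `ℝ × S²` that defines the thermal two-point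
function, as an iterated integral. -/
def ModesConverge (T : ℝ) (f h : Field) : Prop :=
  (∀ᵐ p ∂sphereMeasure, Integrable (modeIntegrand T f h p) (volume : Measure ℝ)) ∧
  Integrable (fun p => ∫ k : ℝ, modeIntegrand T f h p k) sphereMeasure ∧
  Integrable (fun p => ∫ k : ℝ, ‖modeIntegrand T f h p k‖) sphereMeasure

/-- The two-point function at temperature `T`. -/
def thermalTwoPoint (T : ℝ) (f h : Field) : ℂ :=
  (1 / (Real.pi : ℂ)) * ∫ p, (∫ k : ℝ, modeIntegrand T f h p k) ∂sphereMeasure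

end NullInfinity

end

/-!
The two-point functions are diagonalised by the Fourier transform along the null generators, and
quasi-free functionals are determined by their two-point function; everything is reduced to facts
about one real function of the frequency `k`.

*Algebra.* Let `W` be a bilinear form on fields with `W f h - W h f = iς(f, h)`. On the polynomial
algebra generated by the fields, multiplication by `f` and the derivation `h ↦ W f h` give operators
that satisfy the canonical commutation relations, so that the vacuum matrix element defines a
functional `quasiFree W` on the boundary algebra. Wick's theorem (`vacuum_prod_fieldOp`,
`quasiFree_word`) shows that it is quasi-free with two-point function `W`; the sums over ordered
permutations are identified with the recursive pairing sums in `wick_eq_sum_orderedPerms`. It is the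
only such functional because the words span. It is positive if every finite matrix `W(fᵢ, fⱼ)` is
positive semidefinite: a Gram factorisation of this matrix turns the finitely many fields at hand into
sums of creation and annihilation operators of finitely many modes, which act on polynomials in these
modes as adjoints of each other for the Fischer inner product (`wickList_nonneg`). The KMS condition
passes from the two-point function to all words, since the `n`-point functions are polynomials in the
two-point function (`IsQuasiFree.isKMS`), and for the same reason pointwise convergence of the two-point
functions implies weak convergence (`tendsto_isQuasiFree`).

*Analysis.* `fieldModes f` is a jointly measurable version of the Fourier transforms of `f` along
almost all generators. A multiplier `m` of at most linear growth gives the form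
`modeForm m f h = ∫ m(k) (f̂(k, p), ĥ(-k, p))`, which converges absolutely and is bounded by the
norms of `f` and `h` by Plancherel, since `k f̂` is the transform of `∂_u f` up to a factor. The forms
in question are all of this type. For the Bose factor `b` at temperature `T`,

* `b(k) - b(-k) = k` gives the commutation relations (`modeForm_id`, `modeForm_swap`),
* `b ≥ 0` gives positivity (`posSemidef_modeForm`),
* `b(-k) = b(k) e^{-k/T}` gives the KMS condition, by continuation of `b(k) e^{ikz}` in `z`,
* `b(k) → k Θ(k)` as `T → 0⁺`, dominated by a multiple of `1 + |k|`, gives the convergence of the states.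

The regularised vacuum kernel `-(u - u' - iε)⁻²` is the Fourier transform of `k Θ(k) e^{-εk}`
(`integral_vacuumKernel`), so that dominated convergence also identifies the vacuum two-point function
with the one at temperature zero (`vacuumTwoPoint_eq`).
-/

noncomputable section

namespace NullInfinity

/-! ### Sums over pairings -/

section Wick

variable {I J : Type*}

/-- The sum over all pairings of `f 0, …, f (n - 1)` of the products of the entries `A (f i) (f j)`,
`i < j`, defined by recursion on the partner of the first entry. -/
def wick (A : I → I → ℂ) : (n : ℕ) → (Fin n → I) → ℂ
  | 0, _ => 1
  | 1, _ => 0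
  | n + 2, f => ∑ j : Fin (n + 1), A (f 0) (f j.succ) * wick A n fun i => f (j.succAbove i).succ

/-- Only the entries with ordered arguments enter the sum over pairings. -/
theorem wick_congr {A : I → I → ℂ} {B : J → J → ℂ} :
    ∀ (n : ℕ) (f : Fin n → I) (g : Fin n → J),
      (∀ i j, i < j → A (f i) (f j) = B (g i) (g j)) → wick A n f = wick B n g
  | 0, _, _, _ => rfl
  | 1, _, _, _ => rfl
  | n + 2, f, g, h => by
    refine Finset.sum_congr rfl fun j _ => ?_
    rw [h 0 j.succ (Fin.succ_pos j), wick_congr n _ (fun i => g (j.succAbove i).succ)]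
    intro i k hik
    exact h _ _ (Fin.succ_lt_succ_iff.2 (j.strictMono_succAbove hik))

theorem wick_odd (A : I → I → ℂ) : ∀ (m : ℕ) (f : Fin (2 * m + 1) → I), wick A (2 * m + 1) f = 0
  | 0, _ => rfl
  | m + 1, f => by
    change ∑ j : Fin (2 * m + 2), _ = _
    refine Finset.sum_eq_zero fun j _ => ?_
    change A (f 0) (f j.succ) * wick A (2 * m + 1) _ = 0
    rw [wick_odd A m, mul_zero]

/-- Bounds on a kernel give bounds on the `n`-point sums, with a constant that depends only on `n`. -/
theorem norm_wick_le {A : I → I → ℂ} {N : I → ℝ} {C : ℝ} (hC : 0 ≤ C) (hN : ∀ i, 0 ≤ N i)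
    (hA : ∀ i j, ‖A i j‖ ≤ C * (N i * N j)) :
    ∀ n : ℕ, ∃ K : ℝ, 0 ≤ K ∧ ∀ f : Fin n → I, ‖wick A n f‖ ≤ K * ∏ i, N (f i)
  | 0 => ⟨1, zero_le_one, fun f => by simp [wick]⟩
  | 1 => ⟨0, le_rfl, fun f => by simp [wick]⟩
  | n + 2 => by
    obtain ⟨K, hK, h⟩ := norm_wick_le hC hN hA n
    refine ⟨(n + 1) * (C * K), by positivity, fun f => ?_⟩
    have hj : ∀ j : Fin (n + 1),
        ‖A (f 0) (f j.succ) * wick A n fun i => f (j.succAbove i).succ‖ ≤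
          C * K * ∏ i, N (f i) := fun j => by
      rw [norm_mul, Fin.prod_univ_succ, Fin.prod_univ_succAbove _ j]
      calc _ ≤ (C * (N (f 0) * N (f j.succ))) * (K * ∏ i, N (f (j.succAbove i).succ)) :=
            mul_le_mul (hA _ _) (h _) (norm_nonneg _)
              (mul_nonneg hC (mul_nonneg (hN _) (hN _)))
        _ = _ := by ring
    calc ‖wick A (n + 2) f‖ ≤ ∑ j : Fin (n + 1), C * K * ∏ i, N (f i) :=
          (norm_sum_le _ _).trans (Finset.sum_le_sum fun j _ => hj j)
      _ = _ := by simp; ring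

theorem tendsto_wick {α : Type*} {l : Filter α} {A : α → I → I → ℂ} {B : I → I → ℂ}
    (h : ∀ i j, Tendsto (fun t => A t i j) l (𝓝 (B i j))) :
    ∀ (n : ℕ) (f : Fin n → I), Tendsto (fun t => wick (A t) n f) l (𝓝 (wick B n f))
  | 0, _ => tendsto_const_nhds
  | 1, _ => tendsto_const_nhds
  | n + 2, f => tendsto_finsetSum _ fun j _ =>
    (h _ _).mul (tendsto_wick h n fun i => f (j.succAbove i).succ)

/-! ### Ordered permutations -/

/-- The permutation of `Fin (n + 2)` that keeps `0` in place, sends `1` to `j + 1` and acts on the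
remaining entries as `σ`, in the order-preserving numbering. -/
def insertPair {n : ℕ} (j : Fin (n + 1)) (σ : Equiv.Perm (Fin n)) : Equiv.Perm (Fin (n + 2)) :=
  Equiv.ofBijective
    (Fin.cons 0 (Fin.cons j.succ fun i => (j.succAbove (σ i)).succ) : Fin (n + 2) → Fin (n + 2))
    (Finite.injective_iff_bijective.1 (by
      rw [Fin.cons_injective_iff, Fin.cons_injective_iff]
      refine ⟨?_, ?_, ?_⟩
      · rintro ⟨i, hi⟩
        refine Fin.cases (fun h => ?_) (fun k h => ?_) i hi
        · exact Fin.succ_ne_zero _ h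
        · exact Fin.succ_ne_zero _ h
      · rintro ⟨i, hi⟩
        exact Fin.succAbove_ne _ _ (Fin.succ_injective _ hi)
      · exact (Fin.succ_injective _).comp (Fin.succAbove_right_injective.comp σ.injective)))

theorem insertPair_succ_succ {n : ℕ} (j : Fin (n + 1)) (σ : Equiv.Perm (Fin n))
    (i : Fin n) : insertPair j σ i.succ.succ = (j.succAbove (σ i)).succ := rfl

theorem evenIdx_succ {m : ℕ} (i : Fin m) :
    (evenIdx i.succ : Fin (2 * m + 2)) = (evenIdx i).succ.succ := by
  ext; simp [evenIdx]; ring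

theorem oddIdx_succ {m : ℕ} (i : Fin m) :
    (oddIdx i.succ : Fin (2 * m + 2)) = (oddIdx i).succ.succ := by
  ext; simp [oddIdx]; ring

theorem evenIdx_or_oddIdx {m : ℕ} (k : Fin (2 * m)) :
    (∃ i : Fin m, k = evenIdx i) ∨ ∃ i : Fin m, k = oddIdx i := by
  rcases Nat.even_or_odd' k.1 with ⟨c, hc | hc⟩
  · exact Or.inl ⟨⟨c, by omega⟩, Fin.ext hc⟩
  · exact Or.inr ⟨⟨c, by omega⟩, Fin.ext hc⟩

theorem insertPair_mem {m : ℕ} (j : Fin (2 * m + 1)) (σ : Equiv.Perm (Fin (2 * m)))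
    (hσ : σ ∈ orderedPerms m) : insertPair j σ ∈ orderedPerms (m + 1) := by
  simp only [orderedPerms, Finset.mem_filter, Finset.mem_univ, true_and] at hσ ⊢
  obtain ⟨h1, h2⟩ := hσ
  constructor
  · intro i
    refine Fin.cases ?_ (fun i => ?_) i
    · exact Fin.succ_pos j
    · erw [evenIdx_succ, oddIdx_succ, insertPair_succ_succ, insertPair_succ_succ]
      exact Fin.succ_lt_succ_iff.2 (j.strictMono_succAbove (h1 i))
  · intro i k
    refine Fin.cases (fun hk => ?_) (fun i hik => ?_) i
    · obtain ⟨k, rfl⟩ := Fin.exists_succ_eq.2 hk.ne'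
      erw [evenIdx_succ, insertPair_succ_succ]
      exact Fin.succ_pos _
    · obtain ⟨k, rfl⟩ := Fin.exists_succ_eq.2 ((Fin.zero_le _).trans_lt hik).ne'
      erw [evenIdx_succ, evenIdx_succ, insertPair_succ_succ, insertPair_succ_succ]
      exact Fin.succ_lt_succ_iff.2 (j.strictMono_succAbove (h2 i k (Fin.succ_lt_succ_iff.1 hik)))

theorem insertPair_injective {n : ℕ} {j j' : Fin (n + 1)} {σ σ' : Equiv.Perm (Fin n)}
    (h : insertPair j σ = insertPair j' σ') : j = j' ∧ σ = σ' := by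
  have hj : j = j' := by
    have := congrArg (fun π : Equiv.Perm (Fin (n + 2)) => π (Fin.succ 0)) h
    exact Fin.succ_injective _ this
  subst hj
  refine ⟨rfl, Equiv.ext fun i => ?_⟩
  have := congrArg (fun π : Equiv.Perm (Fin (n + 2)) => π i.succ.succ) h
  exact Fin.succAbove_right_injective (Fin.succ_injective _ this)

/-- Every ordered permutation arises by inserting a first pair: the first entry of the first pair has
to be the least element, its partner is arbitrary. -/
theorem exists_insertPair {m : ℕ} (π : Equiv.Perm (Fin (2 * m + 2)))
    (hπ : π ∈ orderedPerms (m + 1)) :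
    ∃ j : Fin (2 * m + 1), ∃ σ ∈ orderedPerms m, insertPair j σ = π := by
  simp only [orderedPerms, Finset.mem_filter, Finset.mem_univ, true_and] at hπ
  obtain ⟨h1, h2⟩ := hπ
  -- the least element of the first pair is the least element of all
  have h0 : π 0 = 0 := by
    obtain ⟨k, hk⟩ := π.surjective 0
    have h3 : ∀ i : Fin (m + 1), π 0 ≤ π (evenIdx i) := by
      intro i
      rcases eq_or_ne i 0 with rfl | hi
      · exact le_rfl
      · exact (h2 0 i (Fin.pos_iff_ne_zero.2 hi)).le
    rcases evenIdx_or_oddIdx (m := m + 1) k with ⟨i, hi⟩ | ⟨i, hi⟩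
    · exact le_antisymm ((h3 i).trans (le_of_eq (by rw [← hi]; exact hk))) (Fin.zero_le _)
    · exact le_antisymm (((h3 i).trans (h1 i).le).trans (le_of_eq (by rw [← hi]; exact hk)))
        (Fin.zero_le _)
  have hne : ∀ k : Fin (2 * m + 1), π k.succ ≠ 0 := fun k hk =>
    Fin.succ_ne_zero k (π.injective (hk.trans h0.symm))
  obtain ⟨j, hj⟩ := Fin.exists_succ_eq.2 (hne 0)
  have hex : ∀ i : Fin (2 * m), ∃ k : Fin (2 * m), (j.succAbove k).succ = π i.succ.succ := by
    intro i
    obtain ⟨l, hl⟩ := Fin.exists_succ_eq.2 (hne i.succ)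
    have hlj : l ≠ j := by
      rintro rfl
      have := π.injective (hl.symm.trans hj)
      exact Fin.succ_ne_zero i (Fin.succ_injective _ this)
    obtain ⟨k, hk⟩ := Fin.exists_succAbove_eq hlj
    exact ⟨k, by rw [hk, hl]⟩
  choose s hs using hex
  have hsi : Function.Injective s := fun a b hab => by
    have := hs a
    rw [hab, hs b] at this
    exact (Fin.succ_injective _ (Fin.succ_injective _ (π.injective this))).symm
  let σ : Equiv.Perm (Fin (2 * m)) := Equiv.ofBijective s (Finite.injective_iff_bijective.1 hsi)
  have hσ : ∀ i, (j.succAbove (σ i)).succ = π i.succ.succ := hs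
  refine ⟨j, σ, ?_, ?_⟩
  · simp only [orderedPerms, Finset.mem_filter, Finset.mem_univ, true_and]
    constructor
    · intro i
      have := h1 i.succ
      erw [evenIdx_succ, oddIdx_succ, ← hσ, ← hσ] at this
      exact (j.strictMono_succAbove.lt_iff_lt).1 (Fin.succ_lt_succ_iff.1 this)
    · intro i k hik
      have := h2 i.succ k.succ (Fin.succ_lt_succ_iff.2 hik)
      erw [evenIdx_succ, evenIdx_succ, ← hσ, ← hσ] at this
      exact (j.strictMono_succAbove.lt_iff_lt).1 (Fin.succ_lt_succ_iff.1 this)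
  · refine Equiv.ext fun i => ?_
    refine Fin.cases h0.symm (fun i => ?_) i
    refine Fin.cases hj (fun i => ?_) i
    exact hσ i

/-- The recursive and the explicit form of the sum over pairings agree. -/
theorem wick_eq_sum_orderedPerms (A : I → I → ℂ) : ∀ (m : ℕ) (f : Fin (2 * m) → I),
    wick A (2 * m) f =
      ∑ σ ∈ orderedPerms m, ∏ i : Fin m, A (f (σ (evenIdx i))) (f (σ (oddIdx i)))
  | 0, f => by
    have h : orderedPerms 0 = Finset.univ := by
      refine Finset.filter_true_of_mem fun σ _ => ⟨fun i => i.elim0, fun i => i.elim0⟩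
    rw [h]
    simp only [Finset.univ_eq_empty, Finset.prod_empty, Finset.sum_const, Finset.card_univ]
    erw [Fintype.card_perm, Fintype.card_fin]
    simp [wick]
  | m + 1, f => by
    change ∑ j : Fin (2 * m + 1), A (f 0) (f j.succ) * wick A (2 * m) _ = _
    simp_rw [wick_eq_sum_orderedPerms A m, Finset.mul_sum]
    rw [← Finset.sum_product' (f := fun (j : Fin (2 * m + 1)) (σ : Equiv.Perm (Fin (2 * m))) =>
      A (f 0) (f j.succ) * ∏ i : Fin m, A (f (j.succAbove (σ (evenIdx i))).succ)
        (f (j.succAbove (σ (oddIdx i))).succ))]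
    refine Finset.sum_bij (fun p _ => insertPair p.1 p.2) ?_ ?_ ?_ ?_
    · rintro ⟨j, σ⟩ h
      exact insertPair_mem j σ (Finset.mem_product.1 h).2
    · rintro ⟨j, σ⟩ - ⟨j', σ'⟩ - h
      obtain ⟨h1, h2⟩ := insertPair_injective h
      exact Prod.ext h1 h2
    · intro π hπ
      obtain ⟨j, σ, hσ, h⟩ := exists_insertPair π hπ
      exact ⟨(j, σ), Finset.mem_product.2 ⟨Finset.mem_univ _, hσ⟩, h⟩
    · rintro ⟨j, σ⟩ -
      rw [Fin.prod_univ_succ]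
      congr 1

/-! ### Creation and annihilation operators -/

variable {M : Type*} [CommRing M] [Algebra ℂ M]

/-- The field operator: the sum of the creation operator, which multiplies by `x`, and of the
annihilation operator, which is a derivation `D`. -/
def fieldOp (x : M) (D : Derivation ℂ M M) : Module.End ℂ M :=
  LinearMap.mulLeft ℂ x + (D : M →ₗ[ℂ] M)

theorem fieldOp_apply (x : M) (D : Derivation ℂ M M) (p : M) : fieldOp x D p = x * p + D p := rfl

theorem derivation_fieldOp {D E : Derivation ℂ M M} {x : M} {c : ℂ}
    (h : D x = algebraMap ℂ M c) (hDE : ∀ p, D (E p) = E (D p)) (p : M) :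
    D (fieldOp x E p) = c • p + fieldOp x E (D p) := by
  rw [fieldOp_apply, fieldOp_apply, map_add, Derivation.leibniz, hDE, h, smul_eq_mul, smul_eq_mul,
    Algebra.smul_def]
  ring

/-- Moving an annihilation operator to the right through a product of field operators. -/
theorem derivation_prod_fieldOp {x : I → M} {D : I → Derivation ℂ M M} {A : I → I → ℂ}
    (hD : ∀ i j, D i (x j) = algebraMap ℂ M (A i j)) (hc : ∀ i j p, D i (D j p) = D j (D i p))
    (i : I) : ∀ (n : ℕ) (f : Fin (n + 1) → I),
      D i ((List.ofFn fun k => fieldOp (x (f k)) (D (f k))).prod 1) =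
        ∑ j : Fin (n + 1), A i (f j) •
          (List.ofFn fun k => fieldOp (x (f (j.succAbove k))) (D (f (j.succAbove k)))).prod 1
  | 0, f => by
    simp [fieldOp_apply, hD, Algebra.smul_def]
  | n + 1, f => by
    rw [List.ofFn_succ, List.prod_cons, Module.End.mul_apply,
      derivation_fieldOp (hD i (f 0)) (hc i (f 0)),
      derivation_prod_fieldOp hD hc i n (fun k => f k.succ), map_sum]
    conv_rhs => rw [Fin.sum_univ_succ]
    congr 1
    refine Finset.sum_congr rfl fun j _ => ?_
    rw [map_smul, List.ofFn_succ, List.prod_cons, Module.End.mul_apply]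
    simp

/-- Wick's theorem: the vacuum expectation value of a product of field operators is the sum over
pairings of the products of the commutators of annihilation and creation operators. -/
theorem vacuum_prod_fieldOp {x : I → M} {D : I → Derivation ℂ M M} {A : I → I → ℂ}
    (hD : ∀ i j, D i (x j) = algebraMap ℂ M (A i j)) (hc : ∀ i j p, D i (D j p) = D j (D i p))
    (ε : M →ₐ[ℂ] ℂ) (hε : ∀ i, ε (x i) = 0) : ∀ (n : ℕ) (f : Fin n → I),
      ε ((List.ofFn fun k => fieldOp (x (f k)) (D (f k))).prod 1) = wick A n f
  | 0, f => by simp [wick]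
  | 1, f => by simp [wick, fieldOp_apply, hε]
  | n + 2, f => by
    rw [List.ofFn_succ, List.prod_cons, Module.End.mul_apply, fieldOp_apply, map_add, map_mul, hε,
      zero_mul, zero_add, derivation_prod_fieldOp hD hc, map_sum]
    refine Finset.sum_congr rfl fun j _ => ?_
    rw [map_smul, smul_eq_mul, ← vacuum_prod_fieldOp hD hc ε hε n]

/-- Sums over pairings for lists. -/
def wickList (A : I → I → ℂ) (l : List I) : ℂ := wick A l.length l.get

theorem vacuum_prod_map_fieldOp {x : I → M} {D : I → Derivation ℂ M M} {A : I → I → ℂ}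
    (hD : ∀ i j, D i (x j) = algebraMap ℂ M (A i j)) (hc : ∀ i j p, D i (D j p) = D j (D i p))
    (ε : M →ₐ[ℂ] ℂ) (hε : ∀ i, ε (x i) = 0) (l : List I) :
    ε ((l.map fun i => fieldOp (x i) (D i)).prod 1) = wickList A l := by
  rw [wickList, ← vacuum_prod_fieldOp hD hc ε hε]
  congr 3
  conv_lhs => rw [← List.ofFn_get l]
  rw [List.map_ofFn]
  rfl

theorem wick_eq_wickList (A : I → I → ℂ) (n : ℕ) (f : Fin n → I) :
    wick A n f = wickList A (List.ofFn f) := by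
  have h : ∀ (l : List I) (e : l.length = n), (∀ i, l.get (i.cast e.symm) = f i) →
      wick A n f = wickList A l := by
    rintro l rfl h
    exact congrArg _ (funext fun i => (h i).symm)
  exact h _ (by simp) (by simp)

theorem wickList_map_congr {A : I → I → ℂ} {B : J → J → ℂ} {K : Type*} (a : K → I) (b : K → J)
    (l : List K) (h : l.Pairwise fun i j => A (a i) (a j) = B (b i) (b j)) :
    wickList A (l.map a) = wickList B (l.map b) := by
  have h1 : l.map a = List.ofFn fun i => a (l.get i) := by
    conv_lhs => rw [← List.ofFn_get l]
    rw [List.map_ofFn]; rfl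
  have h2 : l.map b = List.ofFn fun i => b (l.get i) := by
    conv_lhs => rw [← List.ofFn_get l]
    rw [List.map_ofFn]; rfl
  rw [h1, h2, ← wick_eq_wickList, ← wick_eq_wickList]
  refine wick_congr _ _ _ fun i j hij => ?_
  exact List.pairwise_iff_get.1 h i j hij

theorem commute_fieldOp {x y : M} {D E : Derivation ℂ M M} (hc : ∀ p, D (E p) = E (D p))
    (h : D y = E x) : Commute (fieldOp x D) (fieldOp y E) := by
  refine LinearMap.ext fun p => ?_
  simp only [Module.End.mul_apply, fieldOp_apply, map_add, Derivation.leibniz, smul_eq_mul, h, hc]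
  ring

/-- Annihilation operators commute: derivations with constant coefficients do. -/
theorem mkDerivation_comm {σ : Type*} (a b : σ → ℂ) (p : MvPolynomial σ ℂ) :
    MvPolynomial.mkDerivation ℂ (fun j => (MvPolynomial.C (a j) : MvPolynomial σ ℂ))
      (MvPolynomial.mkDerivation ℂ (fun j => (MvPolynomial.C (b j) : MvPolynomial σ ℂ)) p) =
    MvPolynomial.mkDerivation ℂ (fun j => (MvPolynomial.C (b j) : MvPolynomial σ ℂ))
      (MvPolynomial.mkDerivation ℂ (fun j => (MvPolynomial.C (a j) : MvPolynomial σ ℂ)) p) := by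
  have h : ⁅MvPolynomial.mkDerivation ℂ (fun j => (MvPolynomial.C (a j) : MvPolynomial σ ℂ)),
      MvPolynomial.mkDerivation ℂ (fun j => (MvPolynomial.C (b j) : MvPolynomial σ ℂ))⁆ = 0 :=
    MvPolynomial.derivation_ext fun k => by
      rw [Derivation.commutator_apply, MvPolynomial.mkDerivation_X, MvPolynomial.mkDerivation_X,
        MvPolynomial.derivation_C, MvPolynomial.derivation_C, sub_zero, Derivation.zero_apply]
  have h' := congrArg (fun E : Derivation ℂ (MvPolynomial σ ℂ) (MvPolynomial σ ℂ) => E p) h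
  rwa [Derivation.commutator_apply, Derivation.zero_apply, sub_eq_zero] at h'

/-- For a symmetric kernel the field operators commute, so that the order of the factors does not
matter. -/
theorem wickList_perm {A : I → I → ℂ} (hA : ∀ i j, A i j = A j i) {l l' : List I} (h : l.Perm l') :
    wickList A l = wickList A l' := by
  -- a realisation of the kernel with one variable for each index
  have hD : ∀ i j, MvPolynomial.mkDerivation ℂ
      (fun j => (MvPolynomial.C (A i j) : MvPolynomial I ℂ)) (MvPolynomial.X j) =
      algebraMap ℂ _ (A i j) := fun i j => MvPolynomial.mkDerivation_X _ _ _
  have hc := fun i j p => mkDerivation_comm (A i) (A j) p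
  have hε : ∀ i, MvPolynomial.aeval (fun _ : I => (0 : ℂ)) (MvPolynomial.X i : MvPolynomial I ℂ) = 0 :=
    fun i => MvPolynomial.aeval_X _ _
  rw [← vacuum_prod_map_fieldOp hD hc _ hε l, ← vacuum_prod_map_fieldOp hD hc _ hε l']
  congr 2
  refine (h.map _).prod_eq' (List.pairwise_map.2 (List.pairwise_of_forall_mem_list fun a _ b _ => ?_))
  exact commute_fieldOp (hc a b) (by rw [hD, hD, hA])

end Wick

/-! ### Positivity of sums over pairings -/

section Fischer

open scoped ComplexConjugate
open MvPolynomial (X C coeff monomial pderiv)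

variable {σ I : Type*}

/-- The multifactorial `α! = ∏ α_i !`. -/
def multiFactorial (α : σ →₀ ℕ) : ℕ := α.prod fun _ n => n.factorial

theorem multiFactorial_add_single (α : σ →₀ ℕ) (i : σ) :
    multiFactorial (α + Finsupp.single i 1) = multiFactorial α * (α i + 1) := by
  classical
  have h : ∀ β : σ →₀ ℕ, multiFactorial β = (β i).factorial * (β.erase i).prod fun _ n => n.factorial :=
    fun β => (Finsupp.mul_prod_erase' β i (fun _ n => n.factorial) fun _ => rfl).symm
  rw [h, h α, Finsupp.erase_add, Finsupp.erase_single, add_zero, Finsupp.add_apply,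
    Finsupp.single_eq_same, Nat.factorial_succ]
  ring

/-- The Fischer product on polynomials, for which the monomials are orthogonal and `X^α` has square
norm `α!`; it is conjugate linear in the first argument. -/
def fischer (p q : MvPolynomial σ ℂ) : ℂ :=
  ∑ α ∈ p.support, conj (coeff α p) * multiFactorial α * coeff α q

theorem fischer_eq_sum {s : Finset (σ →₀ ℕ)} {p : MvPolynomial σ ℂ} (hs : p.support ⊆ s)
    (q : MvPolynomial σ ℂ) :
    fischer p q = ∑ α ∈ s, conj (coeff α p) * multiFactorial α * coeff α q :=
  Finset.sum_subset hs fun α _ hα => by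
    rw [MvPolynomial.notMem_support_iff.1 hα, map_zero, zero_mul, zero_mul]

theorem fischer_conj (p q : MvPolynomial σ ℂ) : conj (fischer p q) = fischer q p := by
  classical
  rw [fischer_eq_sum Finset.subset_union_left, fischer_eq_sum (s := p.support ∪ q.support)
    Finset.subset_union_right, map_sum]
  refine Finset.sum_congr rfl fun α _ => ?_
  simp
  ring

theorem fischer_add_right (p q q' : MvPolynomial σ ℂ) :
    fischer p (q + q') = fischer p q + fischer p q' := by
  simp only [fischer, MvPolynomial.coeff_add, mul_add, Finset.sum_add_distrib]

theorem fischer_smul_right (c : ℂ) (p q : MvPolynomial σ ℂ) :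
    fischer p (c • q) = c * fischer p q := by
  simp only [fischer, MvPolynomial.coeff_smul, smul_eq_mul, Finset.mul_sum]
  exact Finset.sum_congr rfl fun α _ => by ring

theorem fischer_add_left (p p' q : MvPolynomial σ ℂ) :
    fischer (p + p') q = fischer p q + fischer p' q := by
  rw [← fischer_conj, fischer_add_right, map_add, fischer_conj, fischer_conj]

theorem fischer_smul_left (c : ℂ) (p q : MvPolynomial σ ℂ) :
    fischer (c • p) q = conj c * fischer p q := by
  rw [← fischer_conj, fischer_smul_right, map_mul, fischer_conj]

theorem fischer_sum_left {ι : Type*} (s : Finset ι) (p : ι → MvPolynomial σ ℂ)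
    (q : MvPolynomial σ ℂ) : fischer (∑ i ∈ s, p i) q = ∑ i ∈ s, fischer (p i) q := by
  classical
  induction s using Finset.induction_on with
  | empty => simp [fischer]
  | insert a s ha ih => rw [Finset.sum_insert ha, Finset.sum_insert ha, fischer_add_left, ih]

theorem fischer_sum_right {ι : Type*} (s : Finset ι) (p : MvPolynomial σ ℂ)
    (q : ι → MvPolynomial σ ℂ) : fischer p (∑ i ∈ s, q i) = ∑ i ∈ s, fischer p (q i) := by
  rw [← fischer_conj, fischer_sum_left, map_sum]
  exact Finset.sum_congr rfl fun i _ => fischer_conj _ _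

open scoped ComplexOrder in
theorem fischer_self_nonneg (p : MvPolynomial σ ℂ) : 0 ≤ fischer p p := by
  refine Finset.sum_nonneg fun α _ => ?_
  rw [mul_right_comm, mul_comm (conj _), Complex.mul_conj, ← Complex.ofReal_natCast,
    ← Complex.ofReal_mul]
  exact Complex.zero_le_real.2 (mul_nonneg (Complex.normSq_nonneg _) (Nat.cast_nonneg _))

theorem fischer_monomial (α : σ →₀ ℕ) (a : ℂ) (q : MvPolynomial σ ℂ) :
    fischer (monomial α a) q = conj a * multiFactorial α * coeff α q := by
  classical
  rw [fischer_eq_sum (MvPolynomial.support_monomial_subset), Finset.sum_singleton]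
  simp

theorem fischer_one (q : MvPolynomial σ ℂ) :
    fischer 1 q = MvPolynomial.aeval (fun _ => (0 : ℂ)) q := by
  rw [← MvPolynomial.C_1, ← MvPolynomial.monomial_zero', fischer_monomial, map_one, one_mul,
    MvPolynomial.aeval_zero']
  simp [multiFactorial, MvPolynomial.constantCoeff_eq]

/-- Multiplication by a variable and differentiation are adjoint for the Fischer product. -/
theorem fischer_X_mul (i : σ) (p q : MvPolynomial σ ℂ) :
    fischer (X i * p) q = fischer p (pderiv i q) := by
  induction p using MvPolynomial.induction_on' with
  | add p p' hp hp' => rw [mul_add, fischer_add_left, fischer_add_left, hp, hp']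
  | monomial α a =>
    rw [MvPolynomial.X, MvPolynomial.monomial_mul, one_mul, fischer_monomial, fischer_monomial,
      MvPolynomial.coeff_pderiv, add_comm, multiFactorial_add_single]
    push_cast
    ring

theorem fischer_pderiv (i : σ) (p q : MvPolynomial σ ℂ) :
    fischer (pderiv i p) q = fischer p (X i * q) := by
  rw [← fischer_conj, ← fischer_X_mul, fischer_conj]

theorem mkDerivation_eq_sum_pderiv [Fintype σ] (a : σ → ℂ) (p : MvPolynomial σ ℂ) :
    MvPolynomial.mkDerivation ℂ (fun m => (C (a m) : MvPolynomial σ ℂ)) p =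
      ∑ m, a m • pderiv m p := by
  classical
  induction p using MvPolynomial.induction_on with
  | C c => simp
  | add p q hp hq => simp only [map_add, hp, hq, smul_add, Finset.sum_add_distrib]
  | mul_X p n hp =>
    simp only [Derivation.leibniz, MvPolynomial.mkDerivation_X, MvPolynomial.pderiv_X, hp,
      smul_add, Finset.sum_add_distrib, smul_eq_mul, Finset.mul_sum, mul_smul_comm]
    congr 1
    simp [Pi.single_apply, MvPolynomial.smul_eq_C_mul, mul_comm]

/-- The field operator on polynomials in finitely many variables with amplitudes `v`. -/
def modeOp [Fintype σ] (v : σ → ℂ) : Module.End ℂ (MvPolynomial σ ℂ) :=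
  fieldOp (∑ m, v m • X m) (MvPolynomial.mkDerivation ℂ fun m => C (conj (v m)))

theorem fischer_modeOp [Fintype σ] (v : σ → ℂ) (p q : MvPolynomial σ ℂ) :
    fischer (modeOp v p) q = fischer p (modeOp v q) := by
  simp only [modeOp, fieldOp_apply, Finset.sum_mul, fischer_add_left, fischer_add_right,
    fischer_sum_left, fischer_sum_right, mkDerivation_eq_sum_pderiv,
    smul_mul_assoc, fischer_smul_left, fischer_smul_right, fischer_X_mul,
    fischer_pderiv, Complex.conj_conj]
  rw [add_comm]

theorem fischer_prod_modeOp [Fintype σ] (v : I → σ → ℂ) (l : List I) :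
    ∀ p q : MvPolynomial σ ℂ, fischer ((l.map fun i => modeOp (v i)).prod p) q =
      fischer p ((l.reverse.map fun i => modeOp (v i)).prod q) := by
  induction l with
  | nil => intro p q; rfl
  | cons i l ih =>
    intro p q
    rw [List.map_cons, List.prod_cons, Module.End.mul_apply, fischer_modeOp, ih,
      List.reverse_cons, List.map_append, List.prod_append, Module.End.mul_apply]
    simp

/-- Sums over pairings with a Gram kernel are matrix elements of products of field operators, which
are symmetric for the Fischer product. -/
theorem wickList_gram [Fintype σ] (v : I → σ → ℂ) (l l' : List I) :
    wickList (fun i j => ∑ m, conj (v i m) * v j m) (l.reverse ++ l') =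
      fischer ((l.map fun i => modeOp (v i)).prod 1) ((l'.map fun i => modeOp (v i)).prod 1) := by
  classical
  rw [fischer_prod_modeOp, fischer_one, ← Module.End.mul_apply, ← List.prod_append,
    ← List.map_append]
  refine (vacuum_prod_map_fieldOp (fun i j => ?_) (fun i j p => ?_) _ (fun i => ?_) _).symm
  · simp [MvPolynomial.algebraMap_eq, MvPolynomial.smul_eq_C_mul, mul_comm]
  · exact mkDerivation_comm _ _ p
  · simp

open scoped ComplexOrder MatrixOrder in
/-- For a positive semidefinite kernel the sums over pairings define a positive functional on
words. -/
theorem wickList_nonneg {A : I → I → ℂ}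
    (hA : ∀ (s : Finset I), Matrix.PosSemidef (Matrix.of fun i j : s => A i j))
    (S : Finset (List I)) (c : List I → ℂ) :
    0 ≤ ∑ l ∈ S, ∑ l' ∈ S, conj (c l) * c l' * wickList A (l.reverse ++ l') := by
  classical
  let s : Finset I := S.biUnion List.toFinset
  -- a Gram factorisation of the kernel on the finitely many indices that occur; the columns of `B`
  -- are the mode amplitudes, extended by zero to the other indices
  obtain ⟨B, hB⟩ := CStarAlgebra.nonneg_iff_eq_star_mul_self.1 (hA s).nonneg
  let v : I → s → ℂ := fun i m => if h : i ∈ s then B m ⟨i, h⟩ else 0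
  have hv : ∀ i ∈ s, ∀ j ∈ s, A i j = ∑ m, conj (v i m) * v j m := by
    intro i hi j hj
    have := congrFun (congrFun hB ⟨i, hi⟩) ⟨j, hj⟩
    simpa [v, hi, hj, Matrix.mul_apply] using this
  have hw : ∀ l ∈ S, ∀ l' ∈ S, wickList A (l.reverse ++ l') =
      fischer ((l.map fun i => modeOp (v i)).prod 1)
        ((l'.map fun i => modeOp (v i)).prod 1) := by
    intro l hl l' hl'
    rw [← wickList_gram]
    have hs : ∀ i ∈ l.reverse ++ l', i ∈ s := by
      intro i hi
      rw [List.mem_append, List.mem_reverse] at hi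
      rcases hi with hi | hi
      · exact Finset.mem_biUnion.2 ⟨l, hl, List.mem_toFinset.2 hi⟩
      · exact Finset.mem_biUnion.2 ⟨l', hl', List.mem_toFinset.2 hi⟩
    have := wickList_map_congr (A := A) (B := fun i j => ∑ m, conj (v i m) * v j m) id id
      (l.reverse ++ l') ((List.pairwise_of_forall_mem_list fun i hi j hj =>
        hv i (hs i hi) j (hs j hj)))
    rwa [List.map_id] at this
  -- the sum is the Fischer square of the vector created from the vacuum
  have hp := fischer_self_nonneg (∑ l ∈ S, c l • (l.map fun i => modeOp (v i)).prod 1)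
  rw [fischer_sum_left] at hp
  refine hp.trans_eq (Finset.sum_congr rfl fun l hl => ?_)
  rw [fischer_sum_right]
  refine Finset.sum_congr rfl fun l' hl' => ?_
  rw [hw l hl l' hl', fischer_smul_left, fischer_smul_right]
  ring

end Fischer

/-! ### Words in the boundary algebra -/

section Words

/-- The product of the generators in a list of fields. -/
def word (l : List Field) : BoundaryAlgebra := (l.map field).prod

theorem word_append (l l' : List Field) : word (l ++ l') = word l * word l' := by
  simp [word]

theorem ofFn_field_prod (n : ℕ) (f : Fin n → Field) :
    (List.ofFn fun i => field (f i)).prod = word (List.ofFn f) := by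
  rw [word, List.map_ofFn]; rfl

theorem translation_word (t : ℝ) (l : List Field) :
    translation t (word l) = word (l.map (translate t)) := by
  simp only [word, map_list_prod, List.map_map]
  congr 2
  funext f
  exact translation_field t f

/-- The `*`-operation of the boundary algebra is the one induced from the free algebra. -/
theorem star_mkAlgHom (a : FreeBoundaryAlgebra) :
    star (RingQuot.mkAlgHom ℂ CCR a) = RingQuot.mkAlgHom ℂ CCR (star a) := by
  simp only [RingQuot.mkAlgHom, RingQuot.mkRingHom]
  rfl

theorem star_field (f : Field) : star (field f) = field f := by
  rw [field, star_mkAlgHom, star_freeField]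

theorem star_word (l : List Field) : star (word l) = word l.reverse := by
  induction l with
  | nil => simp [word]
  | cons f l ih =>
    rw [List.reverse_cons, word_append, ← ih]
    simp [word, star_field]

theorem star_smul_boundary (c : ℂ) (a : BoundaryAlgebra) :
    star (c • a) = (starRingEnd ℂ c) • star a := by
  obtain ⟨x, rfl⟩ := RingQuot.mkAlgHom_surjective ℂ CCR a
  rw [← map_smul, star_mkAlgHom, star_mkAlgHom, ← map_smul]
  congr 1
  induction x using TensorProduct.induction_on with
  | zero => simp
  | tmul z y =>
    rw [TensorProduct.smul_tmul', TensorProduct.star_tmul, TensorProduct.star_tmul,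
      TensorProduct.smul_tmul', star_smul, starRingEnd_apply]
  | add a b ha hb => rw [smul_add, star_add, star_add, smul_add, ha, hb]

/-- The words span the boundary algebra. -/
theorem span_words : Submodule.span ℂ (Set.range word) = ⊤ := by
  rw [eq_top_iff]
  rintro a -
  obtain ⟨x, rfl⟩ := RingQuot.mkAlgHom_surjective ℂ CCR a
  have hmul : ∀ a b : BoundaryAlgebra, a ∈ Submodule.span ℂ (Set.range word) →
      b ∈ Submodule.span ℂ (Set.range word) → a * b ∈ Submodule.span ℂ (Set.range word) := by
    intro a b ha hb
    have := Submodule.mul_mem_mul ha hb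
    rw [Submodule.span_mul_span] at this
    refine Submodule.span_mono ?_ this
    rintro _ ⟨_, ⟨l, rfl⟩, _, ⟨l', rfl⟩, rfl⟩
    exact ⟨l ++ l', word_append l l'⟩
  have h1 : (1 : BoundaryAlgebra) ∈ Submodule.span ℂ (Set.range word) :=
    Submodule.subset_span ⟨[], rfl⟩
  have key : ∀ y : TensorAlgebra ℝ Field, RingQuot.mkAlgHom ℂ CCR ((1 : ℂ) ⊗ₜ[ℝ] y) ∈
      Submodule.span ℂ (Set.range word) := by
    intro y
    induction y using TensorAlgebra.induction with
    | algebraMap r =>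
      have : (1 : ℂ) ⊗ₜ[ℝ] algebraMap ℝ (TensorAlgebra ℝ Field) r =
          (r : ℂ) • (1 : FreeBoundaryAlgebra) := by
        rw [Algebra.algebraMap_eq_smul_one, TensorProduct.tmul_smul,
          Algebra.TensorProduct.one_def, TensorProduct.smul_tmul', TensorProduct.smul_tmul']
        simp
      rw [this, map_smul, map_one]
      exact Submodule.smul_mem _ _ h1
    | ι f => exact Submodule.subset_span ⟨[f], by simp [word, field, freeField]⟩
    | mul a b ha hb =>
      have : (1 : ℂ) ⊗ₜ[ℝ] (a * b) = ((1 : ℂ) ⊗ₜ[ℝ] a) * ((1 : ℂ) ⊗ₜ[ℝ] b) := by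
        rw [Algebra.TensorProduct.tmul_mul_tmul, one_mul]
      rw [this, map_mul]
      exact hmul _ _ ha hb
    | add a b ha hb =>
      rw [TensorProduct.tmul_add, map_add]
      exact Submodule.add_mem _ ha hb
  induction x using TensorProduct.induction_on with
  | zero => rw [map_zero]; exact Submodule.zero_mem _
  | tmul z y =>
    have : z ⊗ₜ[ℝ] y = z • ((1 : ℂ) ⊗ₜ[ℝ] y) := by
      rw [TensorProduct.smul_tmul', smul_eq_mul, mul_one]
    rw [this, map_smul]
    exact Submodule.smul_mem _ _ (key y)
  | add a b ha hb =>
    rw [map_add]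
    exact Submodule.add_mem _ ha hb

theorem linearMap_ext_word {ω ω' : BoundaryAlgebra →ₗ[ℂ] ℂ}
    (h : ∀ l, ω (word l) = ω' (word l)) : ω = ω' :=
  LinearMap.ext_on_range span_words h

theorem exists_sum_words (a : BoundaryAlgebra) :
    ∃ (S : Finset (List Field)) (c : List Field → ℂ), a = ∑ l ∈ S, c l • word l := by
  have ha : a ∈ Submodule.span ℂ (Set.range word) := by rw [span_words]; trivial
  obtain ⟨c, rfl⟩ := Finsupp.mem_span_range_iff_exists_finsupp.1 ha
  exact ⟨c.support, c, rfl⟩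

/-- Quasi-freeness in terms of words, with odd and even lengths treated together. -/
theorem isQuasiFree_iff {ω₂ : Field → Field → ℂ} {ω : BoundaryAlgebra →ₗ[ℂ] ℂ} :
    IsQuasiFree ω₂ ω ↔ ∀ l, ω (word l) = wickList ω₂ l := by
  constructor
  · rintro ⟨h1, h2⟩ l
    have hl : ∀ n, l.length = n → ω (word l) = wickList ω₂ l := by
      intro n hn
      obtain ⟨f, rfl⟩ : ∃ f : Fin n → Field, l = List.ofFn f :=
        ⟨fun i => l.get (i.cast hn.symm), by subst hn; simp⟩
      rw [← ofFn_field_prod, ← wick_eq_wickList]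
      rcases Nat.even_or_odd' n with ⟨m, rfl | rfl⟩
      · rw [h2, wick_eq_sum_orderedPerms]
      · rw [h1, wick_odd]
    exact hl _ rfl
  · intro h
    refine ⟨fun m f => ?_, fun m f => ?_⟩
    · rw [ofFn_field_prod, h, ← wick_eq_wickList, wick_odd]
    · rw [ofFn_field_prod, h, ← wick_eq_wickList, wick_eq_sum_orderedPerms]

end Words

/-! ### Quasi-free functionals -/

section QuasiFree

/-- The index set of a basis of the space of fields. -/
abbrev FieldIndex : Type := Module.Free.ChooseBasisIndex ℝ Field

/-- The polynomials in the fields, on which the boundary algebra is represented. -/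
abbrev FockPolynomial : Type := MvPolynomial FieldIndex ℂ

/-- The creation amplitude of a field: the corresponding linear polynomial, its coefficients being the
coordinates with respect to a chosen basis. -/
def creation : Field →ₗ[ℝ] FockPolynomial :=
  (Module.Free.chooseBasis ℝ Field).constr ℝ fun i => MvPolynomial.X i

/-- The annihilation operator of a field: the derivation with `D_f h = ω₂(f, h)`. -/
def annihilation (W : Field →ₗ[ℝ] Field →ₗ[ℝ] ℂ) (f : Field) :
    Derivation ℂ FockPolynomial FockPolynomial :=
  MvPolynomial.mkDerivation ℂ fun i =>
    MvPolynomial.C (W f (Module.Free.chooseBasis ℝ Field i))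

theorem annihilation_creation (W : Field →ₗ[ℝ] Field →ₗ[ℝ] ℂ) (f h : Field) :
    annihilation W f (creation h) = algebraMap ℂ FockPolynomial (W f h) := by
  have h1 : ((annihilation W f : FockPolynomial →ₗ[ℂ] FockPolynomial).restrictScalars ℝ) ∘ₗ creation =
      ((Algebra.linearMap ℂ FockPolynomial).restrictScalars ℝ) ∘ₗ W f := by
    refine (Module.Free.chooseBasis ℝ Field).ext fun i => ?_
    simp only [LinearMap.comp_apply, creation, Module.Basis.constr_basis]
    exact MvPolynomial.mkDerivation_X _ _ _
  exact LinearMap.congr_fun h1 h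

theorem aeval_creation (f : Field) :
    MvPolynomial.aeval (fun _ : FieldIndex => (0 : ℂ)) (creation f) = 0 := by
  have h1 : ((MvPolynomial.aeval (fun _ : FieldIndex => (0 : ℂ))).toLinearMap.restrictScalars ℝ)
      ∘ₗ creation = 0 := by
    refine (Module.Free.chooseBasis ℝ Field).ext fun i => ?_
    simp only [LinearMap.comp_apply, creation, Module.Basis.constr_basis]
    exact MvPolynomial.aeval_X _ _
  exact LinearMap.congr_fun h1 f

/-- The field operators, as a real linear map. -/
def fockField (W : Field →ₗ[ℝ] Field →ₗ[ℝ] ℂ) : Field →ₗ[ℝ] Module.End ℂ FockPolynomial where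
  toFun f := fieldOp (creation f) (annihilation W f)
  map_add' f h := by
    have : annihilation W (f + h) = annihilation W f + annihilation W h :=
      MvPolynomial.derivation_ext fun i => by simp [annihilation]
    refine LinearMap.ext fun p => ?_
    rw [LinearMap.add_apply, fieldOp_apply, fieldOp_apply, fieldOp_apply, this, map_add,
      Derivation.add_apply]
    ring
  map_smul' r f := by
    have : annihilation W (r • f) = (r : ℂ) • annihilation W f :=
      MvPolynomial.derivation_ext fun i => by
        simp [annihilation, MvPolynomial.smul_eq_C_mul]
    refine LinearMap.ext fun p => ?_
    rw [RingHom.id_apply, LinearMap.smul_apply, fieldOp_apply, fieldOp_apply, this, map_smul,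
      Derivation.smul_apply, smul_add, smul_mul_assoc]
    rfl

/-- The representation of the free algebra by field operators. -/
def freeFock (W : Field →ₗ[ℝ] Field →ₗ[ℝ] ℂ) :
    FreeBoundaryAlgebra →ₐ[ℂ] Module.End ℂ FockPolynomial :=
  Algebra.TensorProduct.lift (Algebra.ofId ℂ _) (TensorAlgebra.lift ℝ (fockField W))
    fun z _ => by rw [Algebra.ofId_apply]; exact Algebra.commute_algebraMap_left z _

theorem freeFock_freeField (W : Field →ₗ[ℝ] Field →ₗ[ℝ] ℂ) (f : Field) :
    freeFock W (freeField f) = fieldOp (creation f) (annihilation W f) := by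
  rw [freeFock, freeField, Algebra.TensorProduct.lift_tmul, map_one, one_mul,
    TensorAlgebra.lift_ι_apply]
  rfl

theorem annihilation_comm (W : Field →ₗ[ℝ] Field →ₗ[ℝ] ℂ) (f h : Field) (p : FockPolynomial) :
    annihilation W f (annihilation W h p) = annihilation W h (annihilation W f p) :=
  mkDerivation_comm _ _ p

/-- The representation of the boundary algebra by field operators, for a two-point function whose
antisymmetric part is given by the symplectic form. -/
def fock (W : Field →ₗ[ℝ] Field →ₗ[ℝ] ℂ)
    (hW : ∀ f h, W f h = W h f + Complex.I * (symplecticForm f h : ℂ)) :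
    BoundaryAlgebra →ₐ[ℂ] Module.End ℂ FockPolynomial :=
  RingQuot.liftAlgHom ℂ ⟨freeFock W, by
    rintro _ _ ⟨f, h⟩
    rw [map_add, map_mul, map_mul, AlgHom.commutes, freeFock_freeField, freeFock_freeField]
    refine LinearMap.ext fun p => ?_
    have h1 := annihilation_creation W f h
    rw [hW, map_add, ← annihilation_creation W h f] at h1
    simp only [LinearMap.add_apply, Module.End.mul_apply, fieldOp_apply, map_add,
      Derivation.leibniz, smul_eq_mul, annihilation_comm W f h, h1, Module.algebraMap_end_apply,
      Algebra.smul_def]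
    ring⟩

/-- The quasi-free functional: the vacuum expectation value in the representation by field
operators. -/
def quasiFree (W : Field →ₗ[ℝ] Field →ₗ[ℝ] ℂ)
    (hW : ∀ f h, W f h = W h f + Complex.I * (symplecticForm f h : ℂ)) :
    BoundaryAlgebra →ₗ[ℂ] ℂ :=
  (MvPolynomial.aeval (fun _ : FieldIndex => (0 : ℂ))).toLinearMap ∘ₗ
    LinearMap.applyₗ (1 : FockPolynomial) ∘ₗ (fock W hW).toLinearMap

theorem quasiFree_word (W : Field →ₗ[ℝ] Field →ₗ[ℝ] ℂ)
    (hW : ∀ f h, W f h = W h f + Complex.I * (symplecticForm f h : ℂ)) (l : List Field) :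
    quasiFree W hW (word l) = wickList (fun f h => W f h) l := by
  rw [← vacuum_prod_map_fieldOp (annihilation_creation W) (annihilation_comm W) _ aeval_creation]
  have h1 : fock W hW (word l) =
      (l.map fun f => fieldOp (creation f) (annihilation W f)).prod := by
    rw [word, map_list_prod, List.map_map]
    congr 2
    funext f
    simp [fock, field, freeFock_freeField]
  rw [← h1]
  rfl

theorem isQuasiFree_unique {ω₂ : Field → Field → ℂ} {ω ω' : BoundaryAlgebra →ₗ[ℂ] ℂ}
    (h : IsQuasiFree ω₂ ω) (h' : IsQuasiFree ω₂ ω') : ω = ω' :=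
  linearMap_ext_word fun l => by rw [isQuasiFree_iff.1 h, isQuasiFree_iff.1 h']

open scoped ComplexOrder in
/-- A quasi-free functional whose two-point function is bounded and positive semidefinite is a
state. -/
theorem IsQuasiFree.isState {ω₂ : Field → Field → ℂ} {ω : BoundaryAlgebra →ₗ[ℂ] ℂ}
    (h : IsQuasiFree ω₂ ω)
    (hpos : ∀ (s : Finset Field), Matrix.PosSemidef (Matrix.of fun i j : s => ω₂ i j))
    {C : ℝ} (hC : 0 ≤ C) (hb : ∀ f h, ‖ω₂ f h‖ ≤ C * (fieldNorm f * fieldNorm h)) :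
    IsState ω where
  normalized := isQuasiFree_iff.1 h []
  nonneg a := by
    obtain ⟨S, c, rfl⟩ := exists_sum_words a
    have h1 : ω (star (∑ l ∈ S, c l • word l) * ∑ l ∈ S, c l • word l) =
        ∑ l ∈ S, ∑ l' ∈ S, starRingEnd ℂ (c l) * c l' * wickList ω₂ (l.reverse ++ l') := by
      rw [star_sum, Finset.sum_mul_sum, map_sum]
      refine Finset.sum_congr rfl fun l _ => ?_
      rw [map_sum]
      refine Finset.sum_congr rfl fun l' _ => ?_
      rw [star_smul_boundary, star_word, smul_mul_smul_comm, ← word_append, map_smul,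
        isQuasiFree_iff.1 h, smul_eq_mul]
    rw [h1]
    exact wickList_nonneg hpos S c
  continuous n := by
    obtain ⟨K, -, hK⟩ := norm_wick_le hC (fun f => Real.sqrt_nonneg _) hb n
    refine ⟨K, fun f => ?_⟩
    rw [ofFn_field_prod, isQuasiFree_iff.1 h, ← wick_eq_wickList]
    exact hK f

/-- The quasi-free functionals depend continuously on the two-point function. -/
theorem tendsto_isQuasiFree {α : Type*} {k : Filter α} {ω₂ : α → Field → Field → ℂ}
    {ω : α → BoundaryAlgebra →ₗ[ℂ] ℂ} {η₂ : Field → Field → ℂ} {η : BoundaryAlgebra →ₗ[ℂ] ℂ}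
    (hω : ∀ᶠ t in k, IsQuasiFree (ω₂ t) (ω t)) (hη : IsQuasiFree η₂ η)
    (h : ∀ f g, Tendsto (fun t => ω₂ t f g) k (𝓝 (η₂ f g))) (a : BoundaryAlgebra) :
    Tendsto (fun t => ω t a) k (𝓝 (η a)) := by
  obtain ⟨S, c, rfl⟩ := exists_sum_words a
  simp only [map_sum, map_smul, smul_eq_mul]
  refine tendsto_finsetSum _ fun l _ => Tendsto.const_mul _ ?_
  rw [isQuasiFree_iff.1 hη]
  refine (tendsto_wick h l.length l.get).congr' ?_
  filter_upwards [hω] with t ht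
  exact (isQuasiFree_iff.1 ht l).symm

end QuasiFree

/-! ### The KMS condition for quasi-free functionals -/

section KMS

/-- Bounded continuous functions on the strip `0 ≤ Im z ≤ β` that are holomorphic in its
interior. -/
structure IsStripFunction (β : ℝ) (F : ℂ → ℂ) : Prop where
  continuousOn : ContinuousOn F {z : ℂ | 0 ≤ z.im ∧ z.im ≤ β}
  differentiableOn : DifferentiableOn ℂ F {z : ℂ | 0 < z.im ∧ z.im < β}
  bounded : ∃ C : ℝ, ∀ z : ℂ, 0 ≤ z.im → z.im ≤ β → ‖F z‖ ≤ C

variable {β : ℝ}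

theorem IsStripFunction.const (c : ℂ) : IsStripFunction β fun _ => c :=
  ⟨continuousOn_const, differentiableOn_const c, ‖c‖, fun _ _ _ => le_rfl⟩

theorem IsStripFunction.add {F G : ℂ → ℂ} (hF : IsStripFunction β F) (hG : IsStripFunction β G) :
    IsStripFunction β fun z => F z + G z := by
  obtain ⟨C, hC⟩ := hF.bounded
  obtain ⟨K, hK⟩ := hG.bounded
  exact ⟨hF.continuousOn.add hG.continuousOn, hF.differentiableOn.add hG.differentiableOn, C + K,
    fun z h0 h1 => (norm_add_le _ _).trans (add_le_add (hC z h0 h1) (hK z h0 h1))⟩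

theorem IsStripFunction.mul {F G : ℂ → ℂ} (hF : IsStripFunction β F) (hG : IsStripFunction β G) :
    IsStripFunction β fun z => F z * G z := by
  obtain ⟨C, hC⟩ := hF.bounded
  obtain ⟨K, hK⟩ := hG.bounded
  refine ⟨hF.continuousOn.mul hG.continuousOn, hF.differentiableOn.mul hG.differentiableOn,
    C * K, fun z h0 h1 => ?_⟩
  rw [norm_mul]
  exact mul_le_mul (hC z h0 h1) (hK z h0 h1) (norm_nonneg _)
    ((norm_nonneg _).trans (hC z h0 h1))

theorem IsStripFunction.sum {ι : Type*} (s : Finset ι) {F : ι → ℂ → ℂ}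
    (hF : ∀ i ∈ s, IsStripFunction β (F i)) : IsStripFunction β fun z => ∑ i ∈ s, F i z := by
  classical
  induction s using Finset.induction_on with
  | empty => simpa using IsStripFunction.const 0
  | insert a s ha ih =>
    simp only [Finset.sum_insert ha]
    exact (hF a (Finset.mem_insert_self _ _)).add
      (ih fun i hi => hF i (Finset.mem_insert_of_mem hi))

theorem IsStripFunction.wick {I : Type*} {A : ℂ → I → I → ℂ}
    (hA : ∀ i j, IsStripFunction β fun z => A z i j) :
    ∀ (n : ℕ) (f : Fin n → I), IsStripFunction β fun z => wick (A z) n f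
  | 0, _ => IsStripFunction.const 1
  | 1, _ => IsStripFunction.const 0
  | n + 2, f => IsStripFunction.sum _ fun j _ =>
    (hA _ _).mul (IsStripFunction.wick hA n fun i => f (j.succAbove i).succ)

/-- For a quasi-free functional the KMS condition holds if it holds for the two-point function. The
expectation value of a product of words extends to the strip as the sum over pairings with a kernel
in which only the entries between the two words depend on `z`; at the upper boundary the words can be
exchanged because the kernel is symmetric. -/
theorem IsQuasiFree.isKMS {ω₂ : Field → Field → ℂ} {ω : BoundaryAlgebra →ₗ[ℂ] ℂ}
    (h : IsQuasiFree ω₂ ω) (hinv : ∀ t f g, ω₂ (translate t f) (translate t g) = ω₂ f g)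
    (hkms : ∀ f g, ∃ G : ℂ → ℂ, IsStripFunction β G ∧ ∀ t : ℝ, G t = ω₂ f (translate t g) ∧
      G (t + β * Complex.I) = ω₂ (translate t g) f) : IsKMS β ω := by
  choose G hG hG1 using hkms
  have key : ∀ l l' : List Field, ∃ F : ℂ → ℂ, IsStripFunction β F ∧ ∀ t : ℝ,
      F t = ω (word l * translation t (word l')) ∧
      F (t + β * Complex.I) = ω (translation t (word l') * word l) := by
    intro l l'
    let I := Fin l.length ⊕ Fin l'.length
    -- inside each word the arguments are put in order, which makes the kernel symmetric and leaves the
    -- entries that matter unchanged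
    let A : ℂ → I → I → ℂ := fun z i j => match i, j with
      | .inl i, .inl j => ω₂ (l.get (min i j)) (l.get (max i j))
      | .inr i, .inr j => ω₂ (l'.get (min i j)) (l'.get (max i j))
      | .inl i, .inr j => G (l.get i) (l'.get j) z
      | .inr i, .inl j => G (l.get j) (l'.get i) z
    have hsymm : ∀ z i j, A z i j = A z j i := by
      rintro z (i | i) (j | j)
      · simp only [A, min_comm, max_comm]
      · rfl
      · rfl
      · simp only [A, min_comm, max_comm]
    have hA : ∀ i j, IsStripFunction β fun z => A z i j := by
      rintro (i | i) (j | j)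
      · exact IsStripFunction.const _
      · exact hG _ _
      · exact hG _ _
      · exact IsStripFunction.const _
    let L : List I := (List.finRange l.length).map Sum.inl
    let R : List I := (List.finRange l'.length).map Sum.inr
    refine ⟨fun z => wickList (A z) (L ++ R), IsStripFunction.wick hA _ _, fun t => ?_⟩
    let e : I → Field := Sum.elim l.get fun j => translate t (l'.get j)
    have heL : L.map e = l := by
      simp only [L, List.map_map]
      exact List.map_get_finRange l
    have heR : R.map e = l'.map (translate t) := by
      conv_rhs => rw [← List.map_get_finRange l']
      simp only [R, List.map_map]
      rfl
    have hL : ∀ z, L.Pairwise fun i j => A z (id i) (id j) = ω₂ (e i) (e j) := fun z => by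
      refine List.pairwise_map.2 ((List.pairwise_lt_finRange _).imp fun {i j} hij => ?_)
      simp only [A, e, id, min_eq_left hij.le, max_eq_right hij.le, Sum.elim_inl]
    have hR : ∀ z, R.Pairwise fun i j => A z (id i) (id j) = ω₂ (e i) (e j) := fun z => by
      refine List.pairwise_map.2 ((List.pairwise_lt_finRange _).imp fun {i j} hij => ?_)
      simp only [A, e, id, min_eq_left hij.le, max_eq_right hij.le, Sum.elim_inr, hinv]
    have hmemL : ∀ i ∈ L, ∃ k, i = Sum.inl k := fun i hi => by
      obtain ⟨k, -, rfl⟩ := List.mem_map.1 hi; exact ⟨k, rfl⟩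
    have hmemR : ∀ i ∈ R, ∃ k, i = Sum.inr k := fun i hi => by
      obtain ⟨k, -, rfl⟩ := List.mem_map.1 hi; exact ⟨k, rfl⟩
    constructor
    · rw [translation_word, ← word_append, isQuasiFree_iff.1 h, ← heL, ← heR, ← List.map_append,
        ← wickList_map_congr (A := A t) id e (L ++ R), List.map_id]
      refine List.pairwise_append.2 ⟨hL t, hR t, fun i hi j hj => ?_⟩
      obtain ⟨i, rfl⟩ := hmemL i hi
      obtain ⟨j, rfl⟩ := hmemR j hj
      exact (hG1 _ _ t).1
    · rw [translation_word, ← word_append, isQuasiFree_iff.1 h, ← heL, ← heR, ← List.map_append,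
        ← wickList_map_congr (A := A (t + β * Complex.I)) id e (R ++ L), List.map_id]
      · exact wickList_perm (hsymm _) List.perm_append_comm
      refine List.pairwise_append.2 ⟨hR _, hL _, fun i hi j hj => ?_⟩
      obtain ⟨i, rfl⟩ := hmemR i hi
      obtain ⟨j, rfl⟩ := hmemL j hj
      exact (hG1 _ _ t).2
  choose F hF hF1 using key
  intro a b
  obtain ⟨S, c, rfl⟩ := exists_sum_words a
  obtain ⟨S', c', rfl⟩ := exists_sum_words b
  have hH : IsStripFunction β fun z => ∑ l ∈ S, ∑ l' ∈ S', c l * c' l' * F l l' z :=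
    IsStripFunction.sum _ fun l _ => IsStripFunction.sum _ fun l' _ =>
      (IsStripFunction.const _).mul (hF l l')
  refine ⟨_, hH.continuousOn, hH.differentiableOn, hH.bounded, fun t => ⟨?_, ?_⟩⟩
  · rw [map_sum, Finset.sum_mul_sum, map_sum]
    refine Finset.sum_congr rfl fun l _ => ?_
    rw [map_sum]
    refine Finset.sum_congr rfl fun l' _ => ?_
    rw [(hF1 l l' t).1, map_smul, smul_mul_smul_comm, map_smul, smul_eq_mul]
  · rw [map_sum, Finset.sum_mul_sum, map_sum, Finset.sum_comm]
    refine Finset.sum_congr rfl fun l' _ => ?_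
    rw [map_sum]
    refine Finset.sum_congr rfl fun l _ => ?_
    rw [(hF1 l l' t).2, map_smul, smul_mul_smul_comm, map_smul, smul_eq_mul, mul_comm (c l)]

end KMS

/-! ### The Fourier transform of square integrable functions on the line -/

section Truncation

/-- Truncations of a function in `L²` to sets that exhaust the space converge in `L²`. -/
theorem tendsto_eLpNorm_indicator_sub {α F : Type*} [MeasurableSpace α] {μ : Measure α}
    [NormedAddCommGroup F] {φ : α → F} (hφ : MemLp φ 2 μ) {s : ℕ → Set α}
    (hs : ∀ n, MeasurableSet (s n)) (hx : ∀ x, ∀ᶠ n in atTop, x ∈ s n) :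
    Tendsto (fun n => eLpNorm ((s n).indicator φ - φ) 2 μ) atTop (𝓝 0) := by
  have h1 : Tendsto (fun n => ∫⁻ x, ‖((s n).indicator φ - φ) x‖ₑ ^ (2 : ℝ) ∂μ) atTop
      (𝓝 (∫⁻ _, 0 ∂μ)) := by
    refine tendsto_lintegral_of_dominated_convergence' (fun x => ‖φ x‖ₑ ^ (2 : ℝ)) ?_ ?_ ?_ ?_
    · intro n
      exact ((hφ.1.indicator (hs n)).sub hφ.1).enorm.pow_const _
    · intro n
      refine Eventually.of_forall fun x => ENNReal.rpow_le_rpow ?_ (by norm_num)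
      by_cases h : x ∈ s n <;> simp [h]
    · have := hφ.2
      rw [eLpNorm_lt_top_iff_lintegral_rpow_enorm_lt_top two_ne_zero ENNReal.ofNat_ne_top] at this
      exact (by simpa using this.ne)
    · refine Eventually.of_forall fun x => ?_
      refine (tendsto_congr' ?_).2 tendsto_const_nhds
      filter_upwards [hx x] with n hn
      simp [hn]
  rw [lintegral_zero] at h1
  have h2 := h1.ennrpow_const (1 / 2)
  rw [ENNReal.zero_rpow_of_pos (by norm_num)] at h2
  refine h2.congr fun n => ?_
  rw [eLpNorm_eq_lintegral_rpow_enorm_toReal two_ne_zero ENNReal.ofNat_ne_top]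
  simp

/-- The window `[-n, n]`. -/
def window (n : ℕ) : Set ℝ := Set.Icc (-(n : ℝ)) n

theorem measurableSet_window (n : ℕ) : MeasurableSet (window n) := measurableSet_Icc

theorem eventually_mem_window (x : ℝ) : ∀ᶠ n : ℕ in atTop, x ∈ window n := by
  obtain ⟨N, hN⟩ := exists_nat_ge |x|
  filter_upwards [eventually_ge_atTop N] with n hn
  have : |x| ≤ n := hN.trans (Nat.cast_le.2 hn)
  exact abs_le.1 this

theorem integrable_window {F : Type*} [NormedAddCommGroup F] {φ : ℝ → F} (h : MemLp φ 2) (n : ℕ) :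
    Integrable ((window n).indicator φ) := by
  rw [integrable_indicator_iff (measurableSet_window n)]
  have : IsFiniteMeasure (volume.restrict (window n)) := by
    unfold window; infer_instance
  exact (h.restrict (window n)).integrable (by norm_num)

theorem memLp_window {F : Type*} [NormedAddCommGroup F] {φ : ℝ → F} (h : MemLp φ 2) (n : ℕ) :
    MemLp ((window n).indicator φ) 2 :=
  h.indicator (measurableSet_window n)

theorem tendsto_eLpNorm_window {F : Type*} [NormedAddCommGroup F] {φ : ℝ → F} (h : MemLp φ 2) :
    Tendsto (fun n => eLpNorm ((window n).indicator φ - φ) 2 volume) atTop (𝓝 0) :=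
  tendsto_eLpNorm_indicator_sub h measurableSet_window eventually_mem_window

theorem integrable_inner_of_memLp {𝕜 α F : Type*} [RCLike 𝕜] [MeasurableSpace α] {μ : Measure α}
    [NormedAddCommGroup F] [InnerProductSpace 𝕜 F] {φ ψ : α → F} (h : MemLp φ 2 μ)
    (h' : MemLp ψ 2 μ) : Integrable (fun x => inner 𝕜 (φ x) (ψ x)) μ :=
  (MemLp.integrable_mul h.norm h'.norm).mono' (h.1.inner h'.1)
    (Eventually.of_forall fun _ => norm_inner_le_norm _ _)

end Truncation

section Line

open scoped FourierTransform SchwartzMap InnerProductSpace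

variable {F : Type*} [NormedAddCommGroup F] [InnerProductSpace ℂ F]

theorem continuous_fourier {g : ℝ → F} (h1 : Integrable g) : Continuous (𝓕 g) :=
  VectorFourier.fourierIntegral_continuous Real.continuous_fourierChar continuous_inner h1

theorem fourier_window (φ : ℝ → F) (n : ℕ) (w : ℝ) :
    𝓕 ((window n).indicator φ) w =
      ∫ u in (-(n : ℝ))..n, Complex.exp ((-2 * Real.pi * u * w : ℝ) * Complex.I) • φ u := by
  rw [Real.fourier_real_eq_integral_exp_smul, intervalIntegral.integral_of_le
    (neg_le_self (Nat.cast_nonneg n)), ← integral_Icc_eq_integral_Ioc,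
    ← integral_indicator measurableSet_Icc]
  refine integral_congr_ae (Eventually.of_forall fun u => ?_)
  by_cases hu : u ∈ Set.Icc (-(n : ℝ)) n <;> simp [window, hu]

/-- Square integrable functions with square integrable derivative vanish at infinity. -/
theorem tendsto_zero_of_memLp_deriv {φ φ' : ℝ → F} (hd : ∀ u, HasDerivAt φ (φ' u) u)
    (h : MemLp φ 2) (h' : MemLp φ' 2) : Tendsto φ atTop (𝓝 0) ∧ Tendsto φ atBot (𝓝 0) := by
  let _ : InnerProductSpace ℝ F := InnerProductSpace.rclikeToReal ℂ F
  have h1 : ∀ u, HasDerivAt (fun u => ⟪φ u, φ u⟫_ℝ) (⟪φ u, φ' u⟫_ℝ + ⟪φ' u, φ u⟫_ℝ) u :=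
    fun u => (hd u).inner ℝ (hd u)
  have h2 : Integrable fun u => ⟪φ u, φ u⟫_ℝ := integrable_inner_of_memLp h h
  have h3 : Integrable fun u => ⟪φ u, φ' u⟫_ℝ + ⟪φ' u, φ u⟫_ℝ :=
    (integrable_inner_of_memLp h h').add (integrable_inner_of_memLp h' h)
  have key : ∀ l : Filter ℝ, Tendsto (fun u => ⟪φ u, φ u⟫_ℝ) l (𝓝 0) → Tendsto φ l (𝓝 0) := by
    intro l hl
    rw [tendsto_zero_iff_norm_tendsto_zero]
    have := hl.sqrt
    rw [Real.sqrt_zero] at this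
    refine this.congr fun u => ?_
    rw [real_inner_self_eq_norm_sq, Real.sqrt_sq (norm_nonneg _)]
  exact ⟨key _ (tendsto_zero_of_hasDerivAt_of_integrableOn_Ioi (a := 0) (fun x _ => h1 x)
      h3.integrableOn h2.integrableOn),
    key _ (tendsto_zero_of_hasDerivAt_of_integrableOn_Iic (a := 0) (fun x _ => h1 x)
      h3.integrableOn h2.integrableOn)⟩

variable [CompleteSpace F]

open scoped ContDiff in
/-- For integrable and square integrable functions, the Fourier transform in the sense of `L²` is
given by the Fourier integral. -/
theorem fourier_toLp_ae_eq {φ : ℝ → F} (h1 : Integrable φ) (h2 : MemLp φ 2) :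
    ((𝓕 (h2.toLp φ) : Lp F 2 (volume : Measure ℝ)) : ℝ → F) =ᵐ[volume] 𝓕 φ := by
  have hc := continuous_fourier h1
  refine ae_eq_of_integral_contDiff_smul_eq ((Lp.memLp _).locallyIntegrable (by norm_num))
    hc.locallyIntegrable fun g hg hgc => ?_
  have hg₁ : HasCompactSupport (Complex.ofRealCLM ∘ g) := hgc.comp_left rfl
  have hg₂ : ContDiff ℝ ∞ (Complex.ofRealCLM ∘ g) := by fun_prop
  let s : 𝓢(ℝ, ℂ) := hg₁.toSchwartzMap hg₂
  have hs : ∀ x, s x = (g x : ℂ) := fun x => rfl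
  -- the `L²` transform is the transform of tempered distributions, so that it can be moved to the
  -- test function, and from there to the integrable function `φ`
  have e1 := congrArg (fun T => T s) (Lp.fourier_toTemperedDistribution_eq (h2.toLp φ))
  simp only [TemperedDistribution.fourier_apply, Lp.toTemperedDistribution_apply] at e1
  have e2 : ∫ x, (𝓕 s) x • (h2.toLp φ : ℝ → F) x = ∫ x, (𝓕 (s : ℝ → ℂ)) x • φ x := by
    refine integral_congr_ae ?_
    filter_upwards [h2.coeFn_toLp] with x hx
    rw [hx, SchwartzMap.fourier_coe]
  have e3 : ∫ x, (𝓕 (s : ℝ → ℂ)) x • φ x = ∫ x, s x • (𝓕 φ) x := by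
    have := VectorFourier.integral_fourierIntegral_smul_eq_flip (L := innerₗ ℝ)
      Real.continuous_fourierChar continuous_inner s.integrable (μ := volume) (ν := volume) h1
    rwa [flip_innerₗ] at this
  have e4 := e1.symm.trans (e2.trans e3)
  simpa only [hs, Complex.coe_smul] using e4

open Classical in
/-- The Fourier transform on the line in the sense of `L²`, with the value `0` on functions that are
not square integrable; the frequency is normalised as in `∫ e^{-2πiwu} φ(u) du`. -/
def lineFourier (φ : ℝ → F) : ℝ → F :=
  if h : MemLp φ 2 (volume : Measure ℝ) then
    ((𝓕 (h.toLp φ) : Lp F 2 (volume : Measure ℝ)) : ℝ → F)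
  else 0

theorem lineFourier_eq {φ : ℝ → F} (h : MemLp φ 2) :
    lineFourier φ = ((𝓕 (h.toLp φ) : Lp F 2 (volume : Measure ℝ)) : ℝ → F) := dif_pos h

theorem lineFourier_ae_eq {φ : ℝ → F} (h1 : Integrable φ) (h2 : MemLp φ 2) :
    lineFourier φ =ᵐ[volume] 𝓕 φ := by
  rw [lineFourier_eq h2]
  exact fourier_toLp_ae_eq h1 h2

theorem memLp_lineFourier {φ : ℝ → F} (h : MemLp φ 2) : MemLp (lineFourier φ) 2 := by
  rw [lineFourier_eq h]
  exact Lp.memLp _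

theorem lineFourier_add {φ ψ : ℝ → F} (h : MemLp φ 2) (h' : MemLp ψ 2) :
    lineFourier (φ + ψ) =ᵐ[volume] lineFourier φ + lineFourier ψ := by
  rw [lineFourier_eq h, lineFourier_eq h', lineFourier_eq (h.add h'), MemLp.toLp_add,
    FourierTransform.fourier_add]
  exact Lp.coeFn_add _ _

theorem lineFourier_smul {φ : ℝ → F} (c : ℂ) (h : MemLp φ 2) :
    lineFourier (c • φ) =ᵐ[volume] c • lineFourier φ := by
  rw [lineFourier_eq h, lineFourier_eq (h.const_smul c), MemLp.toLp_const_smul,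
    FourierTransform.fourier_smul]
  exact Lp.coeFn_smul _ _

theorem lineFourier_sub {φ ψ : ℝ → F} (h : MemLp φ 2) (h' : MemLp ψ 2) :
    lineFourier (φ - ψ) =ᵐ[volume] lineFourier φ - lineFourier ψ := by
  have h1 := lineFourier_add h (h'.const_smul (-1 : ℂ))
  have h2 := lineFourier_smul (-1) h'
  rw [show φ - ψ = φ + (-1 : ℂ) • ψ by rw [neg_one_smul, sub_eq_add_neg]]
  filter_upwards [h1, h2] with x e1 e2
  rw [e1, Pi.add_apply, e2, Pi.smul_apply, neg_one_smul, Pi.sub_apply, sub_eq_add_neg]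

/-- Plancherel's theorem. -/
theorem integral_inner_lineFourier {φ ψ : ℝ → F} (h : MemLp φ 2) (h' : MemLp ψ 2) :
    ∫ w, ⟪lineFourier φ w, lineFourier ψ w⟫_ℂ = ∫ u, ⟪φ u, ψ u⟫_ℂ := by
  have h1 := Lp.inner_fourier_eq (h.toLp φ) (h'.toLp ψ)
  rw [L2.inner_def, L2.inner_def] at h1
  rw [lineFourier_eq h, lineFourier_eq h', h1]
  refine integral_congr_ae ?_
  filter_upwards [h.coeFn_toLp, h'.coeFn_toLp] with x e1 e2
  rw [e1, e2]

theorem eLpNorm_lineFourier {φ : ℝ → F} (h : MemLp φ 2) :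
    eLpNorm (lineFourier φ) 2 volume = eLpNorm φ 2 volume := by
  have h1 := Lp.norm_fourier_eq (h.toLp φ)
  rw [Lp.norm_def, Lp.norm_toLp, ENNReal.toReal_eq_toReal_iff' (Lp.eLpNorm_ne_top _) h.2.ne] at h1
  rw [lineFourier_eq h, h1]

theorem eLpNorm_fourier_sub_lineFourier {g φ : ℝ → F} (h1 : Integrable g) (h2 : MemLp g 2)
    (h : MemLp φ 2) : eLpNorm (𝓕 g - lineFourier φ) 2 volume = eLpNorm (g - φ) 2 volume := by
  rw [← eLpNorm_lineFourier (h2.sub h)]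
  refine eLpNorm_congr_ae ?_
  filter_upwards [lineFourier_sub h2 h, lineFourier_ae_eq h1 h2] with x e1 e2
  rw [e1, Pi.sub_apply, Pi.sub_apply, e2]

/-- Fourier integrals of approximations in `L²` converge in measure, hence almost everywhere along a
subsequence. -/
theorem tendstoInMeasure_fourier {g : ℕ → ℝ → F} {φ : ℝ → F} (h1 : ∀ n, Integrable (g n))
    (h2 : ∀ n, MemLp (g n) 2) (h : MemLp φ 2)
    (hg : Tendsto (fun n => eLpNorm (g n - φ) 2 volume) atTop (𝓝 0)) :
    TendstoInMeasure volume (fun n => 𝓕 (g n)) atTop (lineFourier φ) := by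
  refine tendstoInMeasure_of_tendsto_eLpNorm two_ne_zero
    (fun n => (continuous_fourier (h1 n)).aestronglyMeasurable) (memLp_lineFourier h).1 ?_
  exact hg.congr fun n => (eLpNorm_fourier_sub_lineFourier (h1 n) (h2 n) h).symm

theorem tendstoInMeasure_window {φ : ℝ → F} (h : MemLp φ 2) :
    TendstoInMeasure volume (fun n => 𝓕 ((window n).indicator φ)) atTop (lineFourier φ) :=
  tendstoInMeasure_fourier (integrable_window h) (memLp_window h) h (tendsto_eLpNorm_window h)

/-- A translation becomes a modulation under the Fourier transform. -/
theorem lineFourier_translate {φ : ℝ → F} (h : MemLp φ 2) (t : ℝ) :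
    lineFourier (fun u => φ (u - t)) =ᵐ[volume]
      fun w => Complex.exp (-(2 * Real.pi * w * t) * Complex.I) • lineFourier φ w := by
  have hp := measurePreserving_sub_right (volume : Measure ℝ) t
  have ht : MemLp (fun u => φ (u - t)) 2 := h.comp_measurePreserving hp
  have h1 : TendstoInMeasure volume (fun n => 𝓕 (fun u => (window n).indicator φ (u - t))) atTop
      (lineFourier fun u => φ (u - t)) := by
    refine tendstoInMeasure_fourier (fun n => (integrable_window h n).comp_sub_right t)
      (fun n => (memLp_window h n).comp_measurePreserving hp) ht ?_
    refine (tendsto_eLpNorm_window h).congr fun n => ?_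
    rw [← eLpNorm_comp_measurePreserving ((memLp_window h n).1.sub h.1) hp]
    rfl
  obtain ⟨ns, hns, h2⟩ := h1.exists_seq_tendsto_ae
  obtain ⟨ms, hms, h3⟩ :=
    ((tendstoInMeasure_window h).comp hns.tendsto_atTop).exists_seq_tendsto_ae
  filter_upwards [h2, h3] with w e2 e3
  refine tendsto_nhds_unique (e2.comp hms.tendsto_atTop) ?_
  refine (e3.const_smul (Complex.exp (-(2 * Real.pi * w * t) * Complex.I))).congr fun n => ?_
  simp only [Function.comp_apply, Real.fourier_real_eq_integral_exp_smul]
  rw [← integral_sub_right_eq_self _ t, ← integral_smul]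
  refine integral_congr_ae (Eventually.of_forall fun u => ?_)
  simp only [smul_smul, ← Complex.exp_add]
  congr 2
  push_cast
  ring

/-- A derivative becomes a multiplication under the Fourier transform: integrate by parts over large
windows, where the boundary terms vanish in the limit. -/
theorem lineFourier_deriv {φ φ' : ℝ → F} (hd : ∀ u, HasDerivAt φ (φ' u) u)
    (hc : Continuous φ') (h : MemLp φ 2) (h' : MemLp φ' 2) :
    lineFourier φ' =ᵐ[volume] fun w => (2 * Real.pi * w * Complex.I) • lineFourier φ w := by
  -- a common subsequence along which both truncated transforms converge almost everywhere
  obtain ⟨ns, hns, h2⟩ := (tendstoInMeasure_window h').exists_seq_tendsto_ae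
  obtain ⟨ms, hms, h3⟩ :=
    ((tendstoInMeasure_window h).comp hns.tendsto_atTop).exists_seq_tendsto_ae
  obtain ⟨hT, hB⟩ := tendsto_zero_of_memLp_deriv hd h h'
  filter_upwards [h2, h3] with w e2 e3
  refine tendsto_nhds_unique (e2.comp hms.tendsto_atTop) ?_
  let e : ℝ → ℂ := fun u => Complex.exp ((-2 * Real.pi * u * w : ℝ) * Complex.I)
  have he : ∀ u, HasDerivAt e (-(2 * Real.pi * w * Complex.I) * e u) u := by
    intro u
    have h4 : HasDerivAt (fun u : ℝ => ((-2 * Real.pi * u * w : ℝ) : ℂ) * Complex.I)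
        (-(2 * Real.pi * w * Complex.I)) u := by
      have := (((hasDerivAt_id u).const_mul (-2 * Real.pi)).mul_const w).ofReal_comp.mul_const
        Complex.I
      refine this.congr_deriv ?_
      push_cast
      ring
    refine h4.cexp.congr_deriv ?_
    ring
  have hec : Continuous e := continuous_iff_continuousAt.2 fun u => (he u).continuousAt
  have hφc : Continuous φ := continuous_iff_continuousAt.2 fun u => (hd u).continuousAt
  have hnorm : ∀ u, ‖e u‖ = 1 := fun u => Complex.norm_exp_ofReal_mul_I _
  have hparts : ∀ n : ℕ, 𝓕 ((window n).indicator φ') w =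
      (e n • φ n - e (-(n : ℝ)) • φ (-(n : ℝ))) +
        (2 * Real.pi * w * Complex.I) • 𝓕 ((window n).indicator φ) w := by
    intro n
    rw [fourier_window, fourier_window]
    have h5 := intervalIntegral.integral_smul_deriv_eq_deriv_smul (a := -(n : ℝ)) (b := n)
      (u := e) (v := φ) (u' := fun u => -(2 * Real.pi * w * Complex.I) * e u) (v' := φ')
      (fun u _ => he u) (fun u _ => hd u) ((hec.const_mul _).intervalIntegrable _ _)
      (hc.intervalIntegrable _ _)
    rw [h5, sub_eq_add_neg _ (∫ _ in _.._, _), ← intervalIntegral.integral_neg,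
      ← intervalIntegral.integral_smul]
    congr 1
    refine intervalIntegral.integral_congr fun u _ => ?_
    simp only [neg_mul, neg_smul, neg_neg, smul_smul, e]
  have hb : ∀ x : ℕ → ℝ, Tendsto (fun n => φ (x n)) atTop (𝓝 0) →
      Tendsto (fun n => e (x n) • φ (x n)) atTop (𝓝 0) := by
    intro x hx
    rw [tendsto_zero_iff_norm_tendsto_zero] at hx ⊢
    simpa only [norm_smul, hnorm, one_mul] using hx
  have hbd : Tendsto (fun n : ℕ => e n • φ n - e (-(n : ℝ)) • φ (-(n : ℝ))) atTop (𝓝 0) := by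
    have := (hb _ (hT.comp tendsto_natCast_atTop_atTop)).sub
      (hb _ (hB.comp (tendsto_neg_atTop_atBot.comp tendsto_natCast_atTop_atTop)))
    simpa using this
  have := ((hbd.comp hns.tendsto_atTop).comp hms.tendsto_atTop).add
    (e3.const_smul (2 * Real.pi * w * Complex.I))
  rw [zero_add] at this
  refine this.congr fun n => ?_
  simp only [Function.comp_apply, hparts]

end Line

section Real

open scoped FourierTransform

/-- The Fourier transform of a function with real components is hermitian. -/
theorem lineFourier_neg_of_real {φ : ℝ → E3C} (h : MemLp φ 2)
    (hr : ∀ u i, starRingEnd ℂ (φ u i) = φ u i) :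
    ∀ᵐ w : ℝ, ∀ i, lineFourier φ (-w) i = starRingEnd ℂ (lineFourier φ w i) := by
  obtain ⟨ns, hns, h2⟩ := (tendstoInMeasure_window h).exists_seq_tendsto_ae
  have h3 := (Measure.measurePreserving_neg (volume : Measure ℝ)).quasiMeasurePreserving.ae h2
  filter_upwards [h2, h3] with w e2 e3 i
  have e4 := ((EuclideanSpace.proj (𝕜 := ℂ) i).continuous.tendsto _).comp e3
  have e5 := (Complex.continuous_conj.tendsto _).comp
    (((EuclideanSpace.proj (𝕜 := ℂ) i).continuous.tendsto _).comp e2)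
  refine tendsto_nhds_unique e4 (e5.congr fun n => ?_)
  have h6 := integrable_window h (ns n)
  have h7 : ∀ v : ℝ, (𝓕 ((window (ns n)).indicator φ) v) i =
      ∫ u, Complex.exp ((-2 * Real.pi * u * v : ℝ) * Complex.I) *
        (window (ns n)).indicator φ u i := by
    intro v
    rw [Real.fourier_real_eq_integral_exp_smul]
    have h8 : Integrable fun u => Complex.exp ((-2 * Real.pi * u * v : ℝ) * Complex.I) •
        (window (ns n)).indicator φ u := by
      refine (integrable_norm_iff ?_).1 ?_
      · have hc : Continuous fun u : ℝ => Complex.exp ((-2 * Real.pi * u * v : ℝ) * Complex.I) := by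
          fun_prop
        exact hc.aestronglyMeasurable.smul h6.1
      · simpa only [norm_smul, Complex.norm_exp_ofReal_mul_I, one_mul] using h6.norm
    exact ((EuclideanSpace.proj (𝕜 := ℂ) i).integral_comp_comm h8).symm
  change starRingEnd ℂ ((𝓕 ((window (ns n)).indicator φ) w) i) =
    (𝓕 ((window (ns n)).indicator φ) (-w)) i
  rw [h7, h7]
  rw [← integral_conj]
  refine integral_congr_ae (Eventually.of_forall fun u => ?_)
  simp only [map_mul, ← Complex.exp_conj, Complex.conj_ofReal, Complex.conj_I]
  congr 1
  · congr 1
    push_cast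
    ring
  · by_cases hu : u ∈ window (ns n) <;> simp [hu, hr]

end Real

/-! ### The vacuum kernel on the line -/

section VacuumKernel

open scoped FourierTransform InnerProductSpace

variable {F : Type*} [NormedAddCommGroup F] [InnerProductSpace ℂ F]

/-- The multiplier `k Θ(k) e^{-εk}` of the regularised vacuum two-point function. -/
def vacuumMultiplier (ε k : ℝ) : ℝ := max k 0 * Real.exp (-ε * k)

theorem vacuumMultiplier_nonneg (ε k : ℝ) : 0 ≤ vacuumMultiplier ε k :=
  mul_nonneg (le_max_right _ _) (Real.exp_pos _).le

theorem continuous_vacuumMultiplier (ε : ℝ) : Continuous (vacuumMultiplier ε) := by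
  unfold vacuumMultiplier
  fun_prop

theorem vacuumMultiplier_le {ε : ℝ} (hε : 0 < ε) (k : ℝ) : vacuumMultiplier ε k ≤ ε⁻¹ := by
  rcases le_total k 0 with hk | hk
  · rw [vacuumMultiplier, max_eq_right hk, zero_mul]
    exact (inv_pos.2 hε).le
  · rw [vacuumMultiplier, max_eq_left hk, neg_mul, Real.exp_neg, ← div_eq_mul_inv,
      div_le_iff₀ (Real.exp_pos _), ← div_eq_inv_mul, le_div_iff₀ hε]
    linarith [Real.add_one_le_exp (ε * k)]

theorem integrableOn_mul_exp_neg {ε : ℝ} (hε : 0 < ε) :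
    IntegrableOn (fun k : ℝ => k * Real.exp (-ε * k)) (Set.Ioi 0) := by
  have := integrableOn_rpow_mul_exp_neg_mul_rpow (s := 1) (p := 1) (b := ε) (by norm_num)
    one_pos hε
  simpa using this

theorem vacuumMultiplier_eq_indicator (ε : ℝ) :
    vacuumMultiplier ε = (Set.Ioi 0).indicator fun k => k * Real.exp (-ε * k) := by
  funext k
  rcases le_or_gt k 0 with hk | hk
  · rw [Set.indicator_of_notMem (by simpa using hk), vacuumMultiplier, max_eq_right hk, zero_mul]
  · rw [Set.indicator_of_mem (Set.mem_Ioi.2 hk), vacuumMultiplier, max_eq_left hk.le]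

theorem integrable_vacuumMultiplier {ε : ℝ} (hε : 0 < ε) : Integrable (vacuumMultiplier ε) := by
  rw [vacuumMultiplier_eq_indicator, integrable_indicator_iff measurableSet_Ioi]
  exact integrableOn_mul_exp_neg hε

theorem integral_mul_cexp_neg_Ioi {c : ℂ} (hc : 0 < c.re) :
    ∫ k in Set.Ioi (0 : ℝ), (k : ℂ) * Complex.exp (-c * k) = 1 / c ^ 2 := by
  have hc0 : c ≠ 0 := fun h => by simp [h] at hc
  have hnorm : ∀ k : ℝ, ‖Complex.exp (-c * k)‖ = Real.exp (-c.re * k) := fun k => by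
    rw [Complex.norm_exp]; simp
  -- an explicit antiderivative
  have hd : ∀ k : ℝ, HasDerivAt (fun k : ℝ => -((k : ℂ) / c + 1 / c ^ 2) * Complex.exp (-c * k))
      ((k : ℂ) * Complex.exp (-c * k)) k := by
    intro k
    have h1 : HasDerivAt (fun k : ℝ => (k : ℂ)) 1 k := (hasDerivAt_id k).ofReal_comp
    have h2 := (((h1.div_const c).add_const (1 / c ^ 2)).neg).mul ((h1.const_mul (-c)).cexp)
    refine h2.congr_deriv ?_
    simp only [Pi.neg_apply]
    field_simp
    ring
  have hint : IntegrableOn (fun k : ℝ => (k : ℂ) * Complex.exp (-c * k)) (Set.Ioi 0) := by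
    refine (integrableOn_mul_exp_neg hc).mono' ?_ ?_
    · exact (Continuous.aestronglyMeasurable (by fun_prop))
    · refine (ae_restrict_mem measurableSet_Ioi).mono fun k hk => ?_
      rw [norm_mul, hnorm, Complex.norm_real, Real.norm_of_nonneg (le_of_lt hk)]
  have hlim : Tendsto (fun k : ℝ => -((k : ℂ) / c + 1 / c ^ 2) * Complex.exp (-c * k)) atTop
      (𝓝 0) := by
    have hk : Tendsto (fun k : ℝ => c.re * k) atTop atTop := tendsto_id.const_mul_atTop hc
    have h1 := (Real.tendsto_pow_mul_exp_neg_atTop_nhds_zero 1).comp hk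
    have h0 := (Real.tendsto_pow_mul_exp_neg_atTop_nhds_zero 0).comp hk
    have h2 := (h1.const_mul ((c.re)⁻¹ * ‖c‖⁻¹)).add (h0.const_mul (‖c‖ ^ 2)⁻¹)
    rw [mul_zero, mul_zero, add_zero] at h2
    refine squeeze_zero_norm' ?_ h2
    filter_upwards [eventually_ge_atTop 0] with k hk
    rw [norm_mul, hnorm, norm_neg]
    refine (mul_le_mul_of_nonneg_right (norm_add_le _ _) (Real.exp_pos _).le).trans_eq ?_
    simp only [norm_div, Complex.norm_real, Real.norm_of_nonneg hk, norm_one, norm_pow,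
      Function.comp_apply, pow_one, pow_zero, one_mul, neg_mul]
    field_simp
  rw [integral_Ioi_of_hasDerivAt_of_tendsto' (fun k _ => hd k) hint hlim]
  simp

/-- The kernel `-1/(x - iε)²` is the Fourier transform of `k Θ(k) e^{-εk}`. -/
theorem integral_vacuumMultiplier {ε : ℝ} (hε : 0 < ε) (x : ℝ) :
    ∫ k, (vacuumMultiplier ε k : ℂ) * Complex.exp (-(x * k) * Complex.I) =
      -(1 / ((x : ℂ) - Complex.I * ε) ^ 2) := by
  have h2 : (fun k : ℝ => (vacuumMultiplier ε k : ℂ) * Complex.exp (-(x * k) * Complex.I)) =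
      (Set.Ioi (0 : ℝ)).indicator fun k : ℝ =>
        (k : ℂ) * Complex.exp (-(ε + x * Complex.I) * k) := by
    funext k
    rw [vacuumMultiplier_eq_indicator]
    by_cases hk : k ∈ Set.Ioi (0 : ℝ)
    · rw [Set.indicator_of_mem hk, Set.indicator_of_mem hk]
      push_cast
      rw [mul_assoc, ← Complex.exp_add]
      congr 2
      ring
    · rw [Set.indicator_of_notMem hk, Set.indicator_of_notMem hk, Complex.ofReal_zero, zero_mul]
  have h4 : (ε : ℂ) + x * Complex.I = Complex.I * (x - Complex.I * ε) := by
    linear_combination (ε : ℂ) * Complex.I_sq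
  rw [h2, integral_indicator measurableSet_Ioi, integral_mul_cexp_neg_Ioi (by simpa using hε), h4,
    mul_pow, Complex.I_sq, neg_one_mul, div_neg]

/-- The inner product of two integrals is a double integral. -/
theorem inner_integral_integral [CompleteSpace F] {φ ψ : ℝ → F} (h : Integrable φ)
    (h' : Integrable ψ) : ⟪∫ u, ψ u, ∫ u, φ u⟫_ℂ =
      ∫ x : ℝ × ℝ, ⟪ψ x.2, φ x.1⟫_ℂ ∂((volume : Measure ℝ).prod volume) := by
  have hi : Integrable (fun x : ℝ × ℝ => ⟪ψ x.2, φ x.1⟫_ℂ)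
      ((volume : Measure ℝ).prod volume) := by
    refine (h.norm.mul_prod h'.norm).mono' (h'.1.comp_snd.inner h.1.comp_fst)
      (Eventually.of_forall fun x => ?_)
    exact (norm_inner_le_norm _ _).trans_eq (mul_comm _ _)
  rw [integral_prod _ hi, ← integral_inner h]
  refine integral_congr_ae (Eventually.of_forall fun u => ?_)
  have := integral_inner h' (φ u) (𝕜 := ℂ)
  simp only
  rw [← inner_conj_symm, ← this, ← integral_conj]
  simp only [inner_conj_symm]

/-- The vacuum kernel in terms of Fourier integrals, for integrable functions. -/
theorem integral_vacuumKernel_of_integrable [CompleteSpace F] {ε : ℝ} (hε : 0 < ε) {φ ψ : ℝ → F}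
    (h : Integrable φ) (h' : Integrable ψ) :
    ∫ x : ℝ × ℝ, ⟪ψ x.2, φ x.1⟫_ℂ / ((x.1 : ℂ) - x.2 - Complex.I * ε) ^ 2
        ∂((volume : Measure ℝ).prod volume) =
      -∫ k, (vacuumMultiplier ε k : ℂ) *
        ⟪𝓕 ψ (k / (2 * Real.pi)), 𝓕 φ (k / (2 * Real.pi))⟫_ℂ := by
  let P : Measure (ℝ × ℝ) := (volume : Measure ℝ).prod volume
  have hi : Integrable (fun x : ℝ × ℝ => ⟪ψ x.2, φ x.1⟫_ℂ) P := by
    refine (h.norm.mul_prod h'.norm).mono' (h'.1.comp_snd.inner h.1.comp_fst)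
      (Eventually.of_forall fun x => ?_)
    exact (norm_inner_le_norm _ _).trans_eq (mul_comm _ _)
  let K : ℝ → ℝ × ℝ → ℂ := fun k x =>
    (vacuumMultiplier ε k : ℂ) * Complex.exp (-((x.1 - x.2 : ℝ) * k) * Complex.I) *
      ⟪ψ x.2, φ x.1⟫_ℂ
  have hK : Integrable (Function.uncurry K) ((volume : Measure ℝ).prod P) := by
    have h1 := ((integrable_vacuumMultiplier hε).ofReal (𝕜 := ℂ)).mul_prod hi
    refine (integrable_norm_iff ?_).1 (h1.norm.congr (Eventually.of_forall fun y => ?_))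
    · have hc : Continuous fun y : ℝ × (ℝ × ℝ) => (vacuumMultiplier ε y.1 : ℂ) *
          Complex.exp (-((y.2.1 - y.2.2 : ℝ) * y.1) * Complex.I) := by
        have := continuous_vacuumMultiplier ε
        fun_prop
      exact hc.aestronglyMeasurable.mul hi.1.comp_snd
    · have h3 : ‖Complex.exp (-((y.2.1 - y.2.2 : ℝ) * y.1) * Complex.I)‖ = 1 := by
        rw [← Complex.ofReal_mul, ← Complex.ofReal_neg]
        exact Complex.norm_exp_ofReal_mul_I _
      simp only [Function.uncurry, K, norm_mul, h3, mul_one]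
      rfl
  have h2 : ∀ k : ℝ, (vacuumMultiplier ε k : ℂ) *
      ⟪𝓕 ψ (k / (2 * Real.pi)), 𝓕 φ (k / (2 * Real.pi))⟫_ℂ = ∫ x, K k x ∂P := by
    intro k
    have hexp : ∀ u : ℝ, (-2 * Real.pi * u * (k / (2 * Real.pi)) : ℝ) = -(u * k) := fun u => by
      field_simp
    have hint : ∀ {g : ℝ → F}, Integrable g →
        Integrable fun u => Complex.exp ((-(u * k) : ℝ) * Complex.I) • g u := by
      intro g hg
      refine (integrable_norm_iff ?_).1 ?_
      · have hc : Continuous fun u : ℝ => Complex.exp ((-(u * k) : ℝ) * Complex.I) := by fun_prop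
        exact hc.aestronglyMeasurable.smul hg.1
      · simpa only [norm_smul, Complex.norm_exp_ofReal_mul_I, one_mul] using hg.norm
    rw [Real.fourier_real_eq_integral_exp_smul, Real.fourier_real_eq_integral_exp_smul]
    simp only [hexp]
    rw [inner_integral_integral (hint h) (hint h'), ← integral_const_mul]
    refine integral_congr_ae (Eventually.of_forall fun x => ?_)
    simp only [K, inner_smul_left, inner_smul_right, ← Complex.exp_conj]
    rw [← mul_assoc, ← mul_assoc, mul_assoc (vacuumMultiplier ε k : ℂ), ← Complex.exp_add]
    congr 3
    simp
    ring
  simp only [h2]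
  rw [integral_integral_swap hK, ← integral_neg]
  refine integral_congr_ae (Eventually.of_forall fun x => ?_)
  have h3 := integral_vacuumMultiplier hε (x.1 - x.2)
  simp only [K]
  rw [integral_mul_const, h3]
  push_cast
  ring

/-- The scalar product of `L²` is continuous. -/
theorem tendsto_integral_inner {α : Type*} [MeasurableSpace α] {μ : Measure α} {f g : ℕ → α → F}
    {f' g' : α → F} (hf : ∀ n, MemLp (f n) 2 μ) (hf' : MemLp f' 2 μ) (hg : ∀ n, MemLp (g n) 2 μ)
    (hg' : MemLp g' 2 μ) (h1 : Tendsto (fun n => eLpNorm (f n - f') 2 μ) atTop (𝓝 0))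
    (h2 : Tendsto (fun n => eLpNorm (g n - g') 2 μ) atTop (𝓝 0)) :
    Tendsto (fun n => ∫ x, ⟪f n x, g n x⟫_ℂ ∂μ) atTop (𝓝 (∫ x, ⟪f' x, g' x⟫_ℂ ∂μ)) := by
  have h3 := (Lp.tendsto_Lp_iff_tendsto_eLpNorm'' f hf f' hf').2 h1
  have h4 := (Lp.tendsto_Lp_iff_tendsto_eLpNorm'' g hg g' hg').2 h2
  have key : ∀ {a b : α → F} (ha : MemLp a 2 μ) (hb : MemLp b 2 μ),
      ⟪ha.toLp a, hb.toLp b⟫_ℂ = ∫ x, ⟪a x, b x⟫_ℂ ∂μ := fun ha hb => by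
    rw [L2.inner_def]
    refine integral_congr_ae ?_
    filter_upwards [ha.coeFn_toLp, hb.coeFn_toLp] with x e1 e2
    rw [e1, e2]
  have := h3.inner (𝕜 := ℂ) h4
  simpa only [key] using this

/-- The vacuum kernel in terms of the Fourier transform, for square integrable functions. -/
theorem integral_vacuumKernel [CompleteSpace F] {ε : ℝ} (hε : 0 < ε) {φ ψ : ℝ → F}
    (h : MemLp φ 2) (h' : MemLp ψ 2)
    (hi : Integrable (fun x : ℝ × ℝ => ⟪ψ x.2, φ x.1⟫_ℂ / ((x.1 : ℂ) - x.2 - Complex.I * ε) ^ 2)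
      ((volume : Measure ℝ).prod volume)) :
    ∫ x : ℝ × ℝ, ⟪ψ x.2, φ x.1⟫_ℂ / ((x.1 : ℂ) - x.2 - Complex.I * ε) ^ 2
        ∂((volume : Measure ℝ).prod volume) =
      -∫ k, (vacuumMultiplier ε k : ℂ) *
        ⟪lineFourier ψ (k / (2 * Real.pi)), lineFourier φ (k / (2 * Real.pi))⟫_ℂ := by
  -- both sides are limits of the corresponding expressions for the truncated functions
  have h1 : Tendsto (fun n => ∫ x : ℝ × ℝ, ⟪(window n).indicator ψ x.2,
        (window n).indicator φ x.1⟫_ℂ / ((x.1 : ℂ) - x.2 - Complex.I * ε) ^ 2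
        ∂((volume : Measure ℝ).prod volume)) atTop
      (𝓝 (∫ x : ℝ × ℝ, ⟪ψ x.2, φ x.1⟫_ℂ / ((x.1 : ℂ) - x.2 - Complex.I * ε) ^ 2
        ∂((volume : Measure ℝ).prod volume))) := by
    have hind : ∀ n (x : ℝ × ℝ), ⟪(window n).indicator ψ x.2, (window n).indicator φ x.1⟫_ℂ /
        ((x.1 : ℂ) - x.2 - Complex.I * ε) ^ 2 = (window n ×ˢ window n).indicator
          (fun x : ℝ × ℝ => ⟪ψ x.2, φ x.1⟫_ℂ / ((x.1 : ℂ) - x.2 - Complex.I * ε) ^ 2) x := by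
      intro n x
      by_cases hx1 : x.1 ∈ window n <;> by_cases hx2 : x.2 ∈ window n <;>
        simp [Set.indicator, hx1, hx2]
    simp only [hind]
    refine tendsto_integral_of_dominated_convergence _ (fun n => hi.1.indicator
      ((measurableSet_window n).prod (measurableSet_window n))) hi.norm
      (fun n => Eventually.of_forall fun x => norm_indicator_le_norm_self _ _)
      (Eventually.of_forall fun x => ?_)
    refine (tendsto_congr' ?_).2 tendsto_const_nhds
    filter_upwards [eventually_mem_window x.1, eventually_mem_window x.2] with n e1 e2
    exact Set.indicator_of_mem (Set.mk_mem_prod e1 e2) _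
  have hw : ∀ G : ℝ → ℂ, ∫ k, (vacuumMultiplier ε k : ℂ) * G (k / (2 * Real.pi)) =
      (2 * Real.pi) * ∫ w, (vacuumMultiplier ε (2 * Real.pi * w) : ℂ) * G w := by
    intro G
    have := Measure.integral_comp_div
      (fun w => (vacuumMultiplier ε (2 * Real.pi * w) : ℂ) * G w) (2 * Real.pi)
    rw [abs_of_pos (by positivity), Complex.real_smul] at this
    push_cast at this
    rw [← this]
    refine integral_congr_ae (Eventually.of_forall fun k => ?_)
    simp only
    congr 3
    field_simp
  have hfour : ∀ {g : ℝ → F}, MemLp g 2 → ∀ n, MemLp (𝓕 ((window n).indicator g)) 2 := by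
    intro g hg n
    exact (memLp_congr_ae (lineFourier_ae_eq (integrable_window hg n) (memLp_window hg n))).1
      (memLp_lineFourier (memLp_window hg n))
  have hconv : ∀ {g : ℝ → F}, MemLp g 2 →
      Tendsto (fun n => eLpNorm (𝓕 ((window n).indicator g) - lineFourier g) 2 volume) atTop
        (𝓝 0) := fun {g} hg => (tendsto_eLpNorm_window hg).congr fun n =>
    (eLpNorm_fourier_sub_lineFourier (integrable_window hg n) (memLp_window hg n) hg).symm
  let m : ℝ → ℂ := fun w => (vacuumMultiplier ε (2 * Real.pi * w) : ℂ)
  have hmc : Continuous m := by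
    have := continuous_vacuumMultiplier ε
    fun_prop
  have hmb : ∀ w, ‖m w‖ ≤ ε⁻¹ := fun w => by
    simp only [m, Complex.norm_real, Real.norm_eq_abs, abs_of_nonneg (vacuumMultiplier_nonneg _ _)]
    exact vacuumMultiplier_le hε _
  have hmem : ∀ {g : ℝ → F}, MemLp g 2 → MemLp (fun w => m w • g w) 2 := by
    intro g hg
    refine MemLp.of_le_mul hg (hmc.aestronglyMeasurable.smul hg.1)
      (c := ε⁻¹) (Eventually.of_forall fun w => ?_)
    rw [norm_smul]
    exact mul_le_mul_of_nonneg_right (hmb w) (norm_nonneg _)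
  have h2 := tendsto_integral_inner (hfour h') (memLp_lineFourier h')
    (fun n => hmem (hfour h n)) (hmem (memLp_lineFourier h)) (hconv h') (by
      have h3 := ENNReal.Tendsto.const_mul (a := ENNReal.ofReal ε⁻¹) (hconv h)
        (Or.inr ENNReal.ofReal_ne_top)
      rw [mul_zero] at h3
      refine tendsto_of_tendsto_of_tendsto_of_le_of_le tendsto_const_nhds h3
        (fun _ => zero_le) fun n => ?_
      refine eLpNorm_le_mul_eLpNorm_of_ae_le_mul (Eventually.of_forall fun w => ?_) 2
      simp only [Pi.sub_apply]
      rw [← smul_sub, norm_smul]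
      exact mul_le_mul_of_nonneg_right (hmb w) (norm_nonneg _))
  rw [hw (fun w => ⟪lineFourier ψ w, lineFourier φ w⟫_ℂ)]
  refine tendsto_nhds_unique h1 ?_
  have h5 := (h2.const_mul ((2 * Real.pi : ℝ) : ℂ)).neg
  simp only [inner_smul_right, Complex.ofReal_mul, Complex.ofReal_ofNat] at h5
  refine h5.congr fun n => ?_
  rw [integral_vacuumKernel_of_integrable hε (integrable_window h n) (integrable_window h' n),
    hw fun w => ⟪𝓕 ((window n).indicator ψ) w, 𝓕 ((window n).indicator φ) w⟫_ℂ]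

end VacuumKernel

/-! ### The Fourier transform along a family of lines -/

section Family

open scoped FourierTransform InnerProductSpace ENNReal

variable {X : Type*} [MeasurableSpace X] {σ : Measure X}
variable {F : Type*} [NormedAddCommGroup F]

/-- The measure on a family of lines parametrised by a measure space: Lebesgue measure along the
lines. -/
abbrev linesMeasure (σ : Measure X) : Measure (X × ℝ) := σ.prod (volume : Measure ℝ)

theorem ae_memLp_line [SFinite σ] {G : X × ℝ → F} (h : MemLp G 2 (linesMeasure σ)) :
    ∀ᵐ p ∂σ, MemLp (fun u => G (p, u)) 2 := by
  have h1 := ((memLp_two_iff_integrable_sq_norm h.1).1 h).prod_right_ae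
  filter_upwards [h1, h.1.prodMk_left] with p e1 e2
  exact (memLp_two_iff_integrable_sq_norm e2).2 e1

theorem eLpNorm_two_rpow_two {Y : Type*} [MeasurableSpace Y] (μ : Measure Y) (f : Y → F) :
    eLpNorm f 2 μ ^ (2 : ℝ) = ∫⁻ y, ‖f y‖ₑ ^ (2 : ℝ) ∂μ := by
  rw [eLpNorm_eq_lintegral_rpow_enorm_toReal two_ne_zero ENNReal.ofNat_ne_top, ← ENNReal.rpow_mul]
  norm_num

/-- A proportionality of `L²` norms on almost every line carries over to the whole family. -/
theorem eLpNorm_lines [SFinite σ] {A B : X × ℝ → F} (hA : AEStronglyMeasurable A (linesMeasure σ))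
    (hB : AEStronglyMeasurable B (linesMeasure σ)) {c : ℝ≥0∞} (hc : c ≠ ∞)
    (h : ∀ᵐ p ∂σ, eLpNorm (fun u => A (p, u)) 2 volume = c * eLpNorm (fun u => B (p, u)) 2 volume) :
    eLpNorm A 2 (linesMeasure σ) = c * eLpNorm B 2 (linesMeasure σ) := by
  have h2 : eLpNorm A 2 (linesMeasure σ) ^ (2 : ℝ) =
      (c * eLpNorm B 2 (linesMeasure σ)) ^ (2 : ℝ) := by
    rw [ENNReal.mul_rpow_of_nonneg _ _ (by norm_num), eLpNorm_two_rpow_two, eLpNorm_two_rpow_two,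
      lintegral_prod _ (hA.enorm.pow_const _), lintegral_prod _ (hB.enorm.pow_const _),
      ← lintegral_const_mul' _ _ (ENNReal.rpow_ne_top_of_nonneg (by norm_num) hc)]
    refine lintegral_congr_ae ?_
    filter_upwards [h] with p hp
    rw [← eLpNorm_two_rpow_two volume (fun u => A (p, u)),
      ← eLpNorm_two_rpow_two volume (fun u => B (p, u)), hp,
      ENNReal.mul_rpow_of_nonneg _ _ (by norm_num)]
  have := congrArg (fun x : ℝ≥0∞ => x ^ ((2 : ℝ)⁻¹)) h2
  simpa only [ENNReal.rpow_rpow_inv (two_ne_zero : (2 : ℝ) ≠ 0)] using this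

variable [InnerProductSpace ℂ F] [CompleteSpace F]

/-- The Fourier transforms along almost all lines of a square integrable function have a jointly
measurable representative: the limit in `L²` of the Fourier integrals over large windows. -/
theorem exists_joint_lineFourier [SFinite σ] {G : X × ℝ → F} (hm : StronglyMeasurable G)
    (h : MemLp G 2 (linesMeasure σ)) : ∃ g : X × ℝ → F, StronglyMeasurable g ∧
      ∀ᵐ p ∂σ, (fun w => g (p, w)) =ᵐ[volume] lineFourier fun u => G (p, u) := by
  let W : ℕ → Set (X × ℝ) := fun n => Set.univ ×ˢ window n
  have hW : ∀ n, MeasurableSet (W n) := fun n => MeasurableSet.univ.prod (measurableSet_window n)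
  -- the Fourier integrals over the windows are jointly measurable and Cauchy in `L²` by Plancherel
  let Φ : ℕ → X × ℝ → F := fun n x => 𝓕 ((window n).indicator fun u => G (x.1, u)) x.2
  have hind : ∀ n p u, (W n).indicator G (p, u) = (window n).indicator (fun u => G (p, u)) u := by
    intro n p u
    by_cases hu : u ∈ window n <;> simp [W, Set.indicator, hu]
  have hΦm : ∀ n, StronglyMeasurable (Φ n) := by
    intro n
    have h1 : StronglyMeasurable fun y : (X × ℝ) × ℝ =>
        Complex.exp ((-2 * Real.pi * y.2 * y.1.2 : ℝ) * Complex.I) •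
          (W n).indicator G (y.1.1, y.2) := by
      refine StronglyMeasurable.smul ?_ ?_
      · have : Measurable fun y : (X × ℝ) × ℝ =>
            Complex.exp ((-2 * Real.pi * y.2 * y.1.2 : ℝ) * Complex.I) := by fun_prop
        exact this.stronglyMeasurable
      · exact (hm.indicator (hW n)).comp_measurable (by fun_prop)
    have h2 := h1.integral_prod_right' (ν := (volume : Measure ℝ))
    convert h2 using 1
    funext x
    simp only [Φ, Real.fourier_real_eq_integral_exp_smul, hind]
  have hnorm : ∀ n m, eLpNorm (Φ n - Φ m) 2 (linesMeasure σ) =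
      eLpNorm ((W n).indicator G - (W m).indicator G) 2 (linesMeasure σ) := by
    intro n m
    rw [← one_mul (eLpNorm ((W n).indicator G - _) _ _)]
    refine eLpNorm_lines ((hΦm n).sub (hΦm m)).aestronglyMeasurable
      ((hm.indicator (hW n)).sub (hm.indicator (hW m))).aestronglyMeasurable ENNReal.one_ne_top ?_
    filter_upwards [ae_memLp_line h] with p hp
    rw [one_mul]
    simp only [Pi.sub_apply, hind]
    have h3 := eLpNorm_fourier_sub_lineFourier (integrable_window hp n) (memLp_window hp n)
      (memLp_window hp m)
    refine Eq.trans (eLpNorm_congr_ae ?_) h3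
    filter_upwards [lineFourier_ae_eq (integrable_window hp m) (memLp_window hp m)] with w hw
    rw [Pi.sub_apply, hw]
  have hGL : ∀ n, MemLp ((W n).indicator G) 2 (linesMeasure σ) := fun n => h.indicator (hW n)
  have hΦL : ∀ n, MemLp (Φ n) 2 (linesMeasure σ) := by
    intro n
    refine ⟨(hΦm n).aestronglyMeasurable, ?_⟩
    rw [eLpNorm_lines (B := (W n).indicator G) (c := 1) (hΦm n).aestronglyMeasurable (hGL n).1
      ENNReal.one_ne_top, one_mul]
    · exact (hGL n).2
    filter_upwards [ae_memLp_line h] with p hp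
    rw [one_mul]
    simp only [hind]
    rw [← eLpNorm_lineFourier (memLp_window hp n)]
    exact (eLpNorm_congr_ae (lineFourier_ae_eq (integrable_window hp n) (memLp_window hp n))).symm
  have hcauchy : CauchySeq fun n => (hΦL n).toLp (Φ n) := by
    have h1 : CauchySeq fun n => (hGL n).toLp ((W n).indicator G) :=
      ((Lp.tendsto_Lp_iff_tendsto_eLpNorm'' _ hGL G h).2 (tendsto_eLpNorm_indicator_sub h hW
        fun x => (eventually_mem_window x.2).mono fun n hn => ⟨trivial, hn⟩)).cauchySeq
    rw [EMetric.cauchySeq_iff] at h1 ⊢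
    simpa only [Lp.edist_toLp_toLp, hnorm] using h1
  obtain ⟨Ψ, hΨ⟩ := cauchySeq_tendsto_of_complete hcauchy
  refine ⟨Ψ, Lp.stronglyMeasurable Ψ, ?_⟩
  have h2 : Tendsto (fun n => eLpNorm (Φ n - (Ψ : X × ℝ → F)) 2 (linesMeasure σ)) atTop (𝓝 0) := by
    have := (Lp.tendsto_Lp_iff_tendsto_eLpNorm'' Φ hΦL Ψ (Lp.memLp Ψ)).1 (by rwa [Lp.toLp_coeFn])
    exact this
  obtain ⟨ns, hns, h3⟩ := (tendstoInMeasure_of_tendsto_eLpNorm two_ne_zero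
    (fun n => (hΦL n).1) (Lp.memLp Ψ).1 h2).exists_seq_tendsto_ae
  -- on almost every line both limits agree, along a common subsequence
  filter_upwards [ae_memLp_line h, Measure.ae_ae_of_ae_prod h3] with p hp e1
  obtain ⟨ms, hms, h4⟩ :=
    ((tendstoInMeasure_window hp).comp hns.tendsto_atTop).exists_seq_tendsto_ae
  filter_upwards [e1, h4] with w e2 e3
  exact tendsto_nhds_unique (e2.comp hms.tendsto_atTop) e3

/-- `a` represents, jointly measurably, the Fourier transforms of the functions `α p` on the lines,
in the convention `∫ e^{-iku} α p u du`. -/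
structure IsModes (σ : Measure X) (α : X → ℝ → F) (a : X × ℝ → F) : Prop where
  stronglyMeasurable : StronglyMeasurable a
  memLp : ∀ᵐ p ∂σ, MemLp (α p) 2
  ae_eq : ∀ᵐ p ∂σ, (fun k => a (p, k)) =ᵐ[volume] fun k => lineFourier (α p) (k / (2 * Real.pi))

theorem quasiMeasurePreserving_div_two_pi :
    Measure.QuasiMeasurePreserving (fun k : ℝ => k / (2 * Real.pi)) volume volume := by
  refine ⟨by fun_prop, ?_⟩
  simp only [div_eq_mul_inv]
  rw [Real.map_volume_mul_right (by positivity)]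
  exact Measure.smul_absolutelyContinuous

theorem exists_isModes [SFinite σ] {α : X → ℝ → F}
    (hm : StronglyMeasurable fun x : X × ℝ => α x.1 x.2)
    (h : MemLp (fun x : X × ℝ => α x.1 x.2) 2 (linesMeasure σ)) : ∃ a, IsModes σ α a := by
  obtain ⟨g, hg, h1⟩ := exists_joint_lineFourier hm h
  refine ⟨fun x => g (x.1, x.2 / (2 * Real.pi)), hg.comp_measurable (by fun_prop),
    ae_memLp_line h, ?_⟩
  filter_upwards [h1] with p hp
  exact quasiMeasurePreserving_div_two_pi.ae hp

namespace IsModes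

variable {α β : X → ℝ → F} {a b : X × ℝ → F}

theorem ae_eq_of {a' : X × ℝ → F} (h : IsModes σ α a) (h' : IsModes σ α a') :
    a =ᵐ[linesMeasure σ] a' := by
  refine (Measure.ae_prod_iff_ae_ae
    (h.stronglyMeasurable.measurableSet_eq_fun h'.stronglyMeasurable)).2 ?_
  filter_upwards [h.ae_eq, h'.ae_eq] with p e1 e2
  exact e1.trans e2.symm

theorem add (h : IsModes σ α a) (h' : IsModes σ β b) :
    IsModes σ (fun p => α p + β p) (a + b) := by
  refine ⟨h.stronglyMeasurable.add h'.stronglyMeasurable, ?_, ?_⟩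
  · filter_upwards [h.memLp, h'.memLp] with p e1 e2
    exact e1.add e2
  · filter_upwards [h.memLp, h'.memLp, h.ae_eq, h'.ae_eq] with p e1 e2 e3 e4
    filter_upwards [e3, e4, quasiMeasurePreserving_div_two_pi.ae (lineFourier_add e1 e2)]
      with k e5 e6 e7
    rw [Pi.add_apply, e5, e6, e7, Pi.add_apply]

theorem smul (c : ℂ) (h : IsModes σ α a) : IsModes σ (fun p => c • α p) (c • a) := by
  refine ⟨h.stronglyMeasurable.const_smul c, ?_, ?_⟩
  · filter_upwards [h.memLp] with p e1
    exact e1.const_smul c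
  · filter_upwards [h.memLp, h.ae_eq] with p e1 e3
    filter_upwards [e3, quasiMeasurePreserving_div_two_pi.ae (lineFourier_smul c e1)] with k e5 e7
    rw [Pi.smul_apply, e5, e7, Pi.smul_apply]

theorem translate (h : IsModes σ α a) (t : ℝ) :
    IsModes σ (fun p u => α p (u - t)) fun x => Complex.exp (-(x.2 * t) * Complex.I) • a x := by
  refine ⟨?_, ?_, ?_⟩
  · refine StronglyMeasurable.smul ?_ h.stronglyMeasurable
    have : Measurable fun x : X × ℝ => Complex.exp (-(x.2 * t) * Complex.I) := by fun_prop
    exact this.stronglyMeasurable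
  · filter_upwards [h.memLp] with p e1
    exact e1.comp_measurePreserving (measurePreserving_sub_right (volume : Measure ℝ) t)
  · filter_upwards [h.memLp, h.ae_eq] with p e1 e3
    filter_upwards [e3, quasiMeasurePreserving_div_two_pi.ae (lineFourier_translate e1 t)]
      with k e5 e7
    rw [e5, e7]
    congr 3
    push_cast
    field_simp

theorem deriv {α' : X → ℝ → F} (h : IsModes σ α a) (hd : ∀ p u, HasDerivAt (α p) (α' p u) u)
    (hc : ∀ p, Continuous (α' p)) (h' : ∀ᵐ p ∂σ, MemLp (α' p) 2) :
    IsModes σ α' fun x => (x.2 * Complex.I) • a x := by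
  refine ⟨?_, h', ?_⟩
  · refine StronglyMeasurable.smul ?_ h.stronglyMeasurable
    have : Measurable fun x : X × ℝ => (x.2 : ℂ) * Complex.I := by fun_prop
    exact this.stronglyMeasurable
  · filter_upwards [h.memLp, h', h.ae_eq] with p e1 e2 e3
    filter_upwards [e3,
      quasiMeasurePreserving_div_two_pi.ae (lineFourier_deriv (hd p) (hc p) e1 e2)] with k e5 e7
    rw [e5, e7]
    congr 1
    push_cast
    field_simp

theorem eLpNorm_eq [SFinite σ] (h : IsModes σ α a)
    (hm : AEStronglyMeasurable (fun x : X × ℝ => α x.1 x.2) (linesMeasure σ)) :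
    eLpNorm a 2 (linesMeasure σ) = ENNReal.ofReal (2 * Real.pi) ^ (2 : ℝ)⁻¹ *
      eLpNorm (fun x : X × ℝ => α x.1 x.2) 2 (linesMeasure σ) := by
  refine eLpNorm_lines h.stronglyMeasurable.aestronglyMeasurable hm
    (ENNReal.rpow_ne_top_of_nonneg (by norm_num) ENNReal.ofReal_ne_top) ?_
  filter_upwards [h.memLp, h.ae_eq] with p e1 e2
  rw [eLpNorm_congr_ae e2, ← eLpNorm_lineFourier e1]
  have hmap : Measure.map (fun k : ℝ => k / (2 * Real.pi)) volume =
      ENNReal.ofReal (2 * Real.pi) • volume := by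
    simp only [div_eq_mul_inv]
    rw [Real.map_volume_mul_right (by positivity), inv_inv, abs_of_pos (by positivity)]
  have h1 := eLpNorm_map_measure (p := 2) (f := fun k : ℝ => k / (2 * Real.pi)) (μ := volume)
    (g := lineFourier (α p)) (by
      rw [hmap]
      exact (memLp_lineFourier e1).1.smul_measure _) (by fun_prop)
  rw [hmap, eLpNorm_smul_measure_of_ne_top (by norm_num)] at h1
  rw [smul_eq_mul] at h1
  simpa [Function.comp_def] using h1.symm

theorem memLp_modes [SFinite σ] (h : IsModes σ α a)
    (hα : MemLp (fun x : X × ℝ => α x.1 x.2) 2 (linesMeasure σ)) :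
    MemLp a 2 (linesMeasure σ) := by
  refine ⟨h.stronglyMeasurable.aestronglyMeasurable, ?_⟩
  rw [h.eLpNorm_eq hα.1]
  exact ENNReal.mul_lt_top (ENNReal.rpow_lt_top_of_nonneg (by norm_num) ENNReal.ofReal_ne_top) hα.2

/-- Plancherel's theorem for families of lines. -/
theorem integral_inner [SFinite σ] (h : IsModes σ α a) (h' : IsModes σ β b)
    (hα : MemLp (fun x : X × ℝ => α x.1 x.2) 2 (linesMeasure σ))
    (hβ : MemLp (fun x : X × ℝ => β x.1 x.2) 2 (linesMeasure σ)) :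
    ∫ x, ⟪a x, b x⟫_ℂ ∂(linesMeasure σ) =
      (2 * Real.pi) * ∫ x : X × ℝ, ⟪α x.1 x.2, β x.1 x.2⟫_ℂ ∂(linesMeasure σ) := by
  rw [integral_prod _ (integrable_inner_of_memLp (h.memLp_modes hα) (h'.memLp_modes hβ)),
    integral_prod _ (integrable_inner_of_memLp hα hβ), ← integral_const_mul]
  refine integral_congr_ae ?_
  filter_upwards [h.memLp, h'.memLp, h.ae_eq, h'.ae_eq] with p e1 e2 e3 e4
  rw [← integral_inner_lineFourier e1 e2]
  have h1 := Measure.integral_comp_div (fun w => ⟪lineFourier (α p) w, lineFourier (β p) w⟫_ℂ)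
    (2 * Real.pi)
  rw [abs_of_pos (by positivity), Complex.real_smul] at h1
  push_cast at h1
  rw [← h1]
  refine integral_congr_ae ?_
  filter_upwards [e3, e4] with k e5 e6
  rw [e5, e6]

end IsModes

end Family

section Real

variable {X : Type*} [MeasurableSpace X] {σ : Measure X}

/-- The modes of a family of functions with real components are hermitian. -/
theorem IsModes.neg_of_real {α : X → ℝ → E3C} {a : X × ℝ → E3C} (h : IsModes σ α a)
    (hr : ∀ p u i, starRingEnd ℂ (α p u i) = α p u i) :
    ∀ᵐ p ∂σ, ∀ᵐ k : ℝ, ∀ i, a (p, -k) i = starRingEnd ℂ (a (p, k) i) := by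
  filter_upwards [h.memLp, h.ae_eq] with p e1 e2
  filter_upwards [e2, (Measure.measurePreserving_neg (volume : Measure ℝ)).quasiMeasurePreserving.ae
    e2, quasiMeasurePreserving_div_two_pi.ae (lineFourier_neg_of_real e1 (hr p))] with k e3 e4 e5 i
  rw [e3, e4, neg_div, e5]

end Real

/-! ### Fourier modes of fields on null infinity -/

section Modes

open scoped InnerProductSpace ENNReal ContDiff Manifold

instance : IsFiniteMeasure sphereMeasure := by
  unfold sphereMeasure
  infer_instance

/-- The inclusion of `ℝ³` into `ℂ³`. -/
def complexify : E3 →L[ℝ] E3C :=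
  LinearMap.toContinuousLinearMap
    { toFun := fun v => WithLp.toLp 2 fun i => ((v i : ℝ) : ℂ)
      map_add' := fun v w => by ext i; simp
      map_smul' := fun c v => by ext i; simp }

theorem complexify_apply (v : E3) (i : Fin 3) : complexify v i = ((v i : ℝ) : ℂ) := rfl

theorem inner_complexify (v w : E3) :
    ⟪complexify v, complexify w⟫_ℂ = ((inner ℝ v w : ℝ) : ℂ) := by
  simp [PiLp.inner_apply, complexify_apply]

theorem norm_complexify (v : E3) : ‖complexify v‖ = ‖v‖ := by
  have h := inner_complexify v v
  rw [real_inner_self_eq_norm_sq] at h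
  have h' := congrArg Complex.re h
  rw [Complex.ofReal_re, ← RCLike.re_eq_complex_re, inner_self_eq_norm_sq] at h'
  exact (sq_eq_sq₀ (norm_nonneg _) (norm_nonneg _)).1 h'

theorem fieldLine_apply (f : Field) (p : S2) (u : ℝ) :
    fieldLine f p u = complexify (f.1 (u, p)) := rfl

/-- The derivative of a field along the null generator through `p`, with complex components. -/
def derivLine (f : Field) (p : S2) : ℝ → E3C := fun u => complexify (partialU f.1 (u, p))

theorem contDiff_line (f : Field) (p : S2) : ContDiff ℝ ∞ fun u : ℝ => f.1 (u, p) := by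
  have h1 : ContMDiff 𝓘(ℝ, ℝ) ((𝓘(ℝ, ℝ)).prod (𝓡 2)) ∞ (fun u : ℝ => ((u, p) : Scri)) :=
    contMDiff_id.prodMk contMDiff_const
  exact (f.2.1.comp h1).contDiff

theorem continuous_field (f : Field) : Continuous f.1 := f.2.1.continuous

theorem hasDerivAt_fieldLine (f : Field) (p : S2) (u : ℝ) :
    HasDerivAt (fieldLine f p) (derivLine f p u) u :=
  complexify.hasFDerivAt.comp_hasDerivAt u (f.2.1.differentiable_line p u).hasDerivAt

theorem continuous_derivLine (f : Field) (p : S2) : Continuous (derivLine f p) :=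
  complexify.continuous.comp ((contDiff_line f p).continuous_deriv (by simp))

theorem measurePreserving_swap_scri :
    MeasurePreserving Prod.swap (linesMeasure sphereMeasure) scriMeasure :=
  Measure.measurePreserving_swap

theorem memLp_lines {g : Scri → E3} (h : MemLp g 2 scriMeasure) :
    MemLp (fun x : S2 × ℝ => complexify (g (x.2, x.1))) 2 (linesMeasure sphereMeasure) := by
  have h1 := h.comp_measurePreserving measurePreserving_swap_scri
  exact h1.of_le (complexify.continuous.comp_aestronglyMeasurable h1.1)
    (Eventually.of_forall fun x => (norm_complexify _).le)

theorem eLpNorm_complexify_lines {g : Scri → E3} (h : MemLp g 2 scriMeasure) :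
    eLpNorm (fun x : S2 × ℝ => complexify (g (x.2, x.1))) 2 (linesMeasure sphereMeasure) =
      eLpNorm g 2 scriMeasure := by
  rw [← eLpNorm_comp_measurePreserving h.1 measurePreserving_swap_scri]
  exact eLpNorm_congr_norm_ae (Eventually.of_forall fun x => norm_complexify _)

theorem integral_inner_lines (g g' : Scri → E3) :
    ∫ x : S2 × ℝ, ⟪complexify (g (x.2, x.1)), complexify (g' (x.2, x.1))⟫_ℂ
      ∂(linesMeasure sphereMeasure) = (pairing g' g : ℂ) := by
  simp only [inner_complexify]
  rw [integral_complex_ofReal, pairing, scriMeasure, ← integral_prod_swap]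
  simp only [real_inner_comm]
  rfl

theorem exists_fieldModes (f : Field) : ∃ a, IsModes sphereMeasure (fieldLine f) a := by
  refine exists_isModes (α := fieldLine f) ?_ (memLp_lines f.2.2.2.1)
  have : Continuous fun x : S2 × ℝ => complexify (f.1 (x.2, x.1)) :=
    complexify.continuous.comp ((continuous_field f).comp (by fun_prop))
  exact this.stronglyMeasurable

/-- A jointly measurable version of the Fourier transform of a field along the null generators. -/
def fieldModes (f : Field) : S2 × ℝ → E3C := (exists_fieldModes f).choose

theorem isModes_fieldModes (f : Field) : IsModes sphereMeasure (fieldLine f) (fieldModes f) :=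
  (exists_fieldModes f).choose_spec

theorem fourierU_eq (f : Field) (p : S2) (k : ℝ) :
    fourierU f p k = lineFourier (fieldLine f p) (k / (2 * Real.pi)) := by
  unfold fourierU lineFourier
  split_ifs <;> rfl

/-- The modes of `∂_u f` are those of `f` multiplied by `ik`. -/
theorem isModes_deriv (f : Field) :
    IsModes sphereMeasure (derivLine f) fun x => (x.2 * Complex.I) • fieldModes f x :=
  (isModes_fieldModes f).deriv (hasDerivAt_fieldLine f) (continuous_derivLine f)
    (ae_memLp_line (memLp_lines f.2.2.2.2))

theorem memLp_fieldModes (f : Field) : MemLp (fieldModes f) 2 (linesMeasure sphereMeasure) :=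
  (isModes_fieldModes f).memLp_modes (memLp_lines f.2.2.2.1)

theorem memLp_mul_fieldModes (f : Field) :
    MemLp (fun x => (x.2 * Complex.I) • fieldModes f x) 2 (linesMeasure sphereMeasure) :=
  (isModes_deriv f).memLp_modes (memLp_lines f.2.2.2.2)

theorem fieldModes_add (f h : Field) :
    fieldModes (f + h) =ᵐ[linesMeasure sphereMeasure] fieldModes f + fieldModes h := by
  refine (isModes_fieldModes (f + h)).ae_eq_of ?_
  have h1 := (isModes_fieldModes f).add (isModes_fieldModes h)
  convert h1 using 1
  funext p u
  exact map_add complexify _ _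

theorem fieldModes_smul (c : ℝ) (f : Field) :
    fieldModes (c • f) =ᵐ[linesMeasure sphereMeasure] (c : ℂ) • fieldModes f := by
  refine (isModes_fieldModes (c • f)).ae_eq_of ?_
  have h1 := (isModes_fieldModes f).smul (c : ℂ)
  convert h1 using 1
  funext p u
  rw [Pi.smul_apply, Complex.coe_smul]
  exact map_smul complexify _ _

theorem fieldModes_translate (t : ℝ) (f : Field) :
    fieldModes (translate t f) =ᵐ[linesMeasure sphereMeasure]
      fun x => Complex.exp (-(x.2 * t) * Complex.I) • fieldModes f x :=
  (isModes_fieldModes (translate t f)).ae_eq_of ((isModes_fieldModes f).translate t)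

theorem fieldModes_neg (f : Field) : ∀ᵐ p ∂sphereMeasure, ∀ᵐ k : ℝ,
    ∀ i, fieldModes f (p, -k) i = starRingEnd ℂ (fieldModes f (p, k) i) :=
  (isModes_fieldModes f).neg_of_real fun _ _ _ => Complex.conj_ofReal _

/-! ### Norms of modes -/

theorem integral_norm_mul_norm_le {α F : Type*} [MeasurableSpace α] {μ : Measure α}
    [NormedAddCommGroup F] {a b : α → F} (ha : MemLp a 2 μ) (hb : MemLp b 2 μ) :
    ∫ x, ‖a x‖ * ‖b x‖ ∂μ ≤ (eLpNorm a 2 μ).toReal * (eLpNorm b 2 μ).toReal := by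
  have h1 := real_inner_le_norm (hb.norm.toLp) (ha.norm.toLp)
  rw [L2.inner_def, Lp.norm_toLp, Lp.norm_toLp, eLpNorm_norm, eLpNorm_norm, mul_comm] at h1
  refine (integral_congr_ae ?_).trans_le h1
  filter_upwards [ha.norm.coeFn_toLp, hb.norm.coeFn_toLp] with x e1 e2
  rw [e1, e2]
  rfl

theorem pairing_self {g : Scri → E3} (h : MemLp g 2 scriMeasure) :
    pairing g g = (eLpNorm g 2 scriMeasure).toReal ^ 2 := by
  rw [← Lp.norm_toLp g h, ← real_inner_self_eq_norm_sq, L2.inner_def]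
  refine integral_congr_ae ?_
  filter_upwards [h.coeFn_toLp] with x e1
  rw [e1]

theorem eLpNorm_le_fieldNorm (f : Field) : (eLpNorm f.1 2 scriMeasure).toReal ≤ fieldNorm f ∧
    (eLpNorm (partialU f.1) 2 scriMeasure).toReal ≤ fieldNorm f := by
  rw [fieldNorm, pairing_self f.2.2.2.1, pairing_self f.2.2.2.2]
  exact ⟨Real.le_sqrt_of_sq_le (le_add_of_nonneg_right (sq_nonneg _)),
    Real.le_sqrt_of_sq_le (le_add_of_nonneg_left (sq_nonneg _))⟩

theorem norm_fieldModes_le (f : Field) :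
    (eLpNorm (fieldModes f) 2 (linesMeasure sphereMeasure)).toReal ≤
        Real.sqrt (2 * Real.pi) * fieldNorm f ∧
      (eLpNorm (fun x => (x.2 * Complex.I) • fieldModes f x) 2
        (linesMeasure sphereMeasure)).toReal ≤ Real.sqrt (2 * Real.pi) * fieldNorm f := by
  have hs : (ENNReal.ofReal (2 * Real.pi) ^ (2 : ℝ)⁻¹).toReal = Real.sqrt (2 * Real.pi) := by
    rw [← ENNReal.toReal_rpow, ENNReal.toReal_ofReal (by positivity), Real.sqrt_eq_rpow, one_div]
  rw [(isModes_fieldModes f).eLpNorm_eq (memLp_lines f.2.2.2.1).1,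
    (isModes_deriv f).eLpNorm_eq (memLp_lines f.2.2.2.2).1, ENNReal.toReal_mul,
    ENNReal.toReal_mul, hs]
  constructor
  · refine mul_le_mul_of_nonneg_left ?_ (Real.sqrt_nonneg _)
    exact (congrArg ENNReal.toReal (eLpNorm_complexify_lines f.2.2.2.1)).trans_le
      (eLpNorm_le_fieldNorm f).1
  · refine mul_le_mul_of_nonneg_left ?_ (Real.sqrt_nonneg _)
    exact (congrArg ENNReal.toReal (eLpNorm_complexify_lines f.2.2.2.2)).trans_le
      (eLpNorm_le_fieldNorm f).2

/-- The dominating function for the integrals that define the two-point functions. -/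
def modeBound (f h : Field) (x : S2 × ℝ) : ℝ :=
  (1 + |x.2|) * (‖fieldModes h x‖ * ‖fieldModes f x‖)

theorem modeBound_eq (f h : Field) (x : S2 × ℝ) : modeBound f h x =
    ‖fieldModes h x‖ * ‖fieldModes f x‖ +
      ‖fieldModes h x‖ * ‖(x.2 * Complex.I) • fieldModes f x‖ := by
  rw [modeBound, norm_smul, norm_mul, Complex.norm_I, mul_one, Complex.norm_real,
    Real.norm_eq_abs]
  ring

theorem integrable_modeBound (f h : Field) :
    Integrable (modeBound f h) (linesMeasure sphereMeasure) := by
  have h1 := MemLp.integrable_mul (memLp_fieldModes h).norm (memLp_fieldModes f).norm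
  have h2 := MemLp.integrable_mul (memLp_fieldModes h).norm (memLp_mul_fieldModes f).norm
  exact (h1.add h2).congr (Eventually.of_forall fun x => (modeBound_eq f h x).symm)

theorem integral_modeBound_le (f h : Field) :
    ∫ x, modeBound f h x ∂(linesMeasure sphereMeasure) ≤
      4 * Real.pi * (fieldNorm f * fieldNorm h) := by
  have h1 : Integrable (fun x => ‖fieldModes h x‖ * ‖fieldModes f x‖)
      (linesMeasure sphereMeasure) :=
    MemLp.integrable_mul (memLp_fieldModes h).norm (memLp_fieldModes f).norm
  have h2 : Integrable (fun x => ‖fieldModes h x‖ * ‖(x.2 * Complex.I) • fieldModes f x‖)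
      (linesMeasure sphereMeasure) :=
    MemLp.integrable_mul (memLp_fieldModes h).norm (memLp_mul_fieldModes f).norm
  simp only [modeBound_eq]
  rw [integral_add h1 h2]
  have h3 := integral_norm_mul_norm_le (memLp_fieldModes h) (memLp_fieldModes f)
  have h4 := integral_norm_mul_norm_le (memLp_fieldModes h) (memLp_mul_fieldModes f)
  have hs : Real.sqrt (2 * Real.pi) * Real.sqrt (2 * Real.pi) = 2 * Real.pi :=
    Real.mul_self_sqrt (by positivity)
  have hn : ∀ g : Field, 0 ≤ Real.sqrt (2 * Real.pi) * fieldNorm g := fun g =>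
    mul_nonneg (Real.sqrt_nonneg _) (Real.sqrt_nonneg _)
  have h5 := h3.trans (mul_le_mul (norm_fieldModes_le h).1 (norm_fieldModes_le f).1
    ENNReal.toReal_nonneg (hn h))
  have h6 := h4.trans (mul_le_mul (norm_fieldModes_le h).1 (norm_fieldModes_le f).2
    ENNReal.toReal_nonneg (hn h))
  refine (add_le_add h5 h6).trans_eq ?_
  linear_combination (2 * fieldNorm f * fieldNorm h) * hs

/-! ### Bilinear forms given by multipliers -/

/-- The bilinear form `∫ m(k) (f̂(k, p), ĥ(-k, p)) dk dS²` on fields; for real fields `ĥ(-k, p)` is the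
complex conjugate of `ĥ(k, p)`, which turns the pairing into the hermitian scalar product. -/
def modeForm (m : ℝ → ℂ) (f h : Field) : ℂ :=
  ∫ x, m x.2 * ⟪fieldModes h x, fieldModes f x⟫_ℂ ∂(linesMeasure sphereMeasure)

/-- Measurable multipliers of at most linear growth. -/
structure IsMultiplier (C : ℝ) (m : ℝ → ℂ) : Prop where
  measurable : Measurable m
  le : ∀ k, ‖m k‖ ≤ C * (1 + |k|)

variable {C : ℝ} {m : ℝ → ℂ}

theorem aestronglyMeasurable_modeForm (hm : Measurable m) (f h : Field) :
    AEStronglyMeasurable (fun x => m x.2 * ⟪fieldModes h x, fieldModes f x⟫_ℂ)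
      (linesMeasure sphereMeasure) :=
  (hm.comp measurable_snd).aestronglyMeasurable.mul
    ((memLp_fieldModes h).1.inner (memLp_fieldModes f).1)

theorem IsMultiplier.norm_le (hm : IsMultiplier C m) (f h : Field) (x : S2 × ℝ) :
    ‖m x.2 * ⟪fieldModes h x, fieldModes f x⟫_ℂ‖ ≤ C * modeBound f h x := by
  rw [norm_mul, modeBound, ← mul_assoc]
  exact mul_le_mul (hm.le _) (norm_inner_le_norm _ _) (norm_nonneg _)
    ((norm_nonneg _).trans (hm.le _))

theorem IsMultiplier.integrable (hm : IsMultiplier C m) (f h : Field) :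
    Integrable (fun x => m x.2 * ⟪fieldModes h x, fieldModes f x⟫_ℂ)
      (linesMeasure sphereMeasure) :=
  ((integrable_modeBound f h).const_mul C).mono' (aestronglyMeasurable_modeForm hm.measurable f h)
    (Eventually.of_forall (hm.norm_le f h))

theorem IsMultiplier.nonneg (hm : IsMultiplier C m) : 0 ≤ C := by
  have := (norm_nonneg _).trans (hm.le 0)
  simpa using this

theorem IsMultiplier.norm_modeForm_le (hm : IsMultiplier C m) (f h : Field) :
    ‖modeForm m f h‖ ≤ C * (4 * Real.pi) * (fieldNorm f * fieldNorm h) := by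
  refine (norm_integral_le_of_norm_le ((integrable_modeBound f h).const_mul C)
    (Eventually.of_forall (hm.norm_le f h))).trans ?_
  rw [integral_const_mul, mul_assoc C]
  exact mul_le_mul_of_nonneg_left (integral_modeBound_le f h) hm.nonneg

theorem IsMultiplier.modeForm_add_left (hm : IsMultiplier C m) (f f' h : Field) :
    modeForm m (f + f') h = modeForm m f h + modeForm m f' h := by
  rw [modeForm, modeForm, modeForm, ← integral_add (hm.integrable f h) (hm.integrable f' h)]
  refine integral_congr_ae ?_
  filter_upwards [fieldModes_add f f'] with x hx
  rw [hx, Pi.add_apply, inner_add_right, mul_add]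

theorem IsMultiplier.modeForm_add_right (hm : IsMultiplier C m) (f h h' : Field) :
    modeForm m f (h + h') = modeForm m f h + modeForm m f h' := by
  rw [modeForm, modeForm, modeForm, ← integral_add (hm.integrable f h) (hm.integrable f h')]
  refine integral_congr_ae ?_
  filter_upwards [fieldModes_add h h'] with x hx
  rw [hx, Pi.add_apply, inner_add_left, mul_add]

theorem modeForm_smul_left (m : ℝ → ℂ) (c : ℝ) (f h : Field) :
    modeForm m (c • f) h = c * modeForm m f h := by
  rw [modeForm, modeForm, ← integral_const_mul]
  refine integral_congr_ae ?_
  filter_upwards [fieldModes_smul c f] with x hx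
  rw [hx, Pi.smul_apply, inner_smul_right]
  ring

theorem modeForm_smul_right (m : ℝ → ℂ) (c : ℝ) (f h : Field) :
    modeForm m f (c • h) = c * modeForm m f h := by
  rw [modeForm, modeForm, ← integral_const_mul]
  refine integral_congr_ae ?_
  filter_upwards [fieldModes_smul c h] with x hx
  rw [hx, Pi.smul_apply, inner_smul_left, Complex.conj_ofReal]
  ring

theorem measurePreserving_reflect : MeasurePreserving (fun x : S2 × ℝ => (x.1, -x.2))
    (linesMeasure sphereMeasure) (linesMeasure sphereMeasure) :=
  (MeasurePreserving.id sphereMeasure).prod (Measure.measurePreserving_neg (volume : Measure ℝ))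

theorem ae_fieldModes_neg (f : Field) : ∀ᵐ x ∂(linesMeasure sphereMeasure),
    ∀ i, fieldModes f (x.1, -x.2) i = starRingEnd ℂ (fieldModes f x i) := by
  have hs := (isModes_fieldModes f).stronglyMeasurable.measurable
  refine (Measure.ae_prod_iff_ae_ae ?_).2 (fieldModes_neg f)
  have hi : ∀ i, Measurable fun x : S2 × ℝ => fieldModes f x i := fun i =>
    (EuclideanSpace.proj (𝕜 := ℂ) i).continuous.measurable.comp hs
  simp only [Set.ofPred_forall]
  refine MeasurableSet.iInter fun i => measurableSet_eq_fun ?_ ?_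
  · exact (hi i).comp (by fun_prop)
  · exact Complex.continuous_conj.measurable.comp (hi i)

/-- Reality of the fields: exchanging the arguments amounts to reflecting the multiplier. -/
theorem modeForm_swap (m : ℝ → ℂ) (f h : Field) :
    modeForm m h f = modeForm (fun k => m (-k)) f h := by
  have he : MeasurableEmbedding (fun x : S2 × ℝ => (x.1, -x.2)) :=
    (MeasurableEquiv.prodCongr (MeasurableEquiv.refl S2)
      (MeasurableEquiv.neg ℝ)).measurableEmbedding
  rw [modeForm, ← measurePreserving_reflect.integral_comp he]
  refine integral_congr_ae ?_
  filter_upwards [ae_fieldModes_neg f, ae_fieldModes_neg h] with x e1 e2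
  simp only [PiLp.inner_apply, e1, e2, RCLike.inner_apply, Complex.conj_conj]
  congr 1
  exact Finset.sum_congr rfl fun i _ => mul_comm _ _

theorem modeForm_translate_right (m : ℝ → ℂ) (t : ℝ) (f h : Field) :
    modeForm m f (translate t h) =
      modeForm (fun k => m k * Complex.exp (k * t * Complex.I)) f h := by
  refine integral_congr_ae ?_
  filter_upwards [fieldModes_translate t h] with x hx
  simp only [hx, inner_smul_left, ← Complex.exp_conj]
  rw [mul_assoc]
  congr 3
  simp

theorem modeForm_translate (m : ℝ → ℂ) (t : ℝ) (f h : Field) :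
    modeForm m (translate t f) (translate t h) = modeForm m f h := by
  refine integral_congr_ae ?_
  filter_upwards [fieldModes_translate t h, fieldModes_translate t f] with x hx hx'
  rw [hx, hx', inner_smul_left, inner_smul_right, ← mul_assoc (starRingEnd ℂ _),
    ← Complex.exp_conj, ← Complex.exp_add]
  simp

/-- The symplectic form in terms of the modes. -/
theorem modeForm_id (f h : Field) :
    modeForm (fun k => (k : ℂ)) f h = Real.pi * (Complex.I * (symplecticForm f h : ℂ)) := by
  have h1 := (isModes_deriv h).integral_inner (isModes_fieldModes f) (memLp_lines h.2.2.2.2)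
    (memLp_lines f.2.2.2.1)
  have h2 := (isModes_fieldModes h).integral_inner (isModes_deriv f) (memLp_lines h.2.2.2.1)
    (memLp_lines f.2.2.2.2)
  have e1 : ∫ x : S2 × ℝ, ⟪derivLine h x.1 x.2, fieldLine f x.1 x.2⟫_ℂ
      ∂(linesMeasure sphereMeasure) = (pairing f.1 (partialU h.1) : ℂ) :=
    integral_inner_lines (partialU h.1) f.1
  have e2 : ∫ x : S2 × ℝ, ⟪fieldLine h x.1 x.2, derivLine f x.1 x.2⟫_ℂ
      ∂(linesMeasure sphereMeasure) = (pairing (partialU f.1) h.1 : ℂ) :=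
    integral_inner_lines h.1 (partialU f.1)
  have e3 : ∫ x, ⟪(x.2 * Complex.I) • fieldModes h x, fieldModes f x⟫_ℂ
      ∂(linesMeasure sphereMeasure) = -Complex.I * modeForm (fun k => (k : ℂ)) f h := by
    rw [modeForm, ← integral_const_mul]
    refine integral_congr_ae (Eventually.of_forall fun x => ?_)
    simp only [inner_smul_left, map_mul, Complex.conj_ofReal, Complex.conj_I]
    ring
  have e4 : ∫ x, ⟪fieldModes h x, (x.2 * Complex.I) • fieldModes f x⟫_ℂ
      ∂(linesMeasure sphereMeasure) = Complex.I * modeForm (fun k => (k : ℂ)) f h := by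
    rw [modeForm, ← integral_const_mul]
    refine integral_congr_ae (Eventually.of_forall fun x => ?_)
    simp only [inner_smul_right]
    ring
  rw [e3, e1] at h1
  rw [e4, e2] at h2
  rw [symplecticForm, Complex.ofReal_sub]
  linear_combination (Complex.I / 2) * h1 - (Complex.I / 2) * h2 +
    (modeForm (fun k => (k : ℂ)) f h) * Complex.I_sq

theorem tendsto_modeForm {ι : Type*} {l : Filter ι} [l.IsCountablyGenerated] {m : ι → ℝ → ℂ}
    {m₀ : ℝ → ℂ} (hm : ∀ᶠ t in l, IsMultiplier C (m t))
    (hlim : ∀ k, Tendsto (fun t => m t k) l (𝓝 (m₀ k))) (f h : Field) :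
    Tendsto (fun t => modeForm (m t) f h) l (𝓝 (modeForm m₀ f h)) := by
  refine tendsto_integral_filter_of_dominated_convergence (fun x => C * modeBound f h x)
    ?_ ?_ ((integrable_modeBound f h).const_mul C) ?_
  · filter_upwards [hm] with t ht
    exact aestronglyMeasurable_modeForm ht.measurable f h
  · filter_upwards [hm] with t ht
    exact Eventually.of_forall (ht.norm_le f h)
  · exact Eventually.of_forall fun x => (hlim x.2).mul_const _

open scoped ComplexOrder in
/-- A nonnegative multiplier gives a positive semidefinite form: the quadratic form of the matrix is
the integral of `b(k) ‖∑ᵢ c̄ᵢ f̂ᵢ‖²`. -/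
theorem posSemidef_modeForm {b : ℝ → ℝ} (hb : ∀ k, 0 ≤ b k)
    (hm : IsMultiplier C fun k => (b k : ℂ)) (s : Finset Field) :
    Matrix.PosSemidef (Matrix.of fun i j : s => modeForm (fun k => (b k : ℂ)) i j) := by
  refine .of_dotProduct_mulVec_nonneg ?_ fun c => ?_
  · refine Matrix.IsHermitian.ext fun i j => ?_
    simp only [Matrix.of_apply, modeForm, ← starRingEnd_apply, ← integral_conj, map_mul,
      Complex.conj_ofReal, inner_conj_symm]
  · have h1 : ∀ i j : s, Integrable (fun x => starRingEnd ℂ (c i) * ((b x.2 : ℂ) *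
        ⟪fieldModes j x, fieldModes i x⟫_ℂ * c j)) (linesMeasure sphereMeasure) := fun i j =>
      ((hm.integrable i j).mul_const _).const_mul _
    have h2 : star c ⬝ᵥ (Matrix.of fun i j : s => modeForm (fun k => (b k : ℂ)) i j).mulVec c =
        ∫ x, ((b x.2 * ‖∑ i : s, starRingEnd ℂ (c i) • fieldModes i x‖ ^ 2 : ℝ) : ℂ)
          ∂(linesMeasure sphereMeasure) := by
      have h3 : ∀ x, ((b x.2 * ‖∑ i : s, starRingEnd ℂ (c i) • fieldModes i x‖ ^ 2 : ℝ) : ℂ) =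
          ∑ i : s, ∑ j : s, starRingEnd ℂ (c i) * ((b x.2 : ℂ) *
            ⟪fieldModes j x, fieldModes i x⟫_ℂ * c j) := by
        intro x
        have h4 := inner_self_eq_norm_sq_to_K (𝕜 := ℂ)
          (∑ i : s, starRingEnd ℂ (c i) • fieldModes i x)
        push_cast
        erw [← h4]
        simp only [sum_inner, inner_sum, inner_smul_left, inner_smul_right, Complex.conj_conj,
          Finset.mul_sum]
        exact Finset.sum_congr rfl fun i _ => Finset.sum_congr rfl fun j _ => by ring
      simp only [h3]
      rw [integral_finsetSum _ fun i _ => integrable_finsetSum _ fun j _ => h1 i j]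
      simp only [dotProduct, Matrix.mulVec, Finset.mul_sum, Matrix.of_apply, Pi.star_apply]
      refine Finset.sum_congr rfl fun i _ => ?_
      rw [integral_finsetSum _ fun j _ => h1 i j]
      refine Finset.sum_congr rfl fun j _ => ?_
      rw [integral_const_mul, integral_mul_const]
      rfl
    rw [h2, integral_complex_ofReal]
    exact Complex.zero_le_real.2 (integral_nonneg fun x => mul_nonneg (hb _) (sq_nonneg _))

end Modes

/-! ### The Bose factor -/

section Bose

variable {T : ℝ}

theorem boseFactor_zero_left (k : ℝ) : boseFactor 0 k = max k 0 := if_pos rfl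

theorem boseFactor_of_pos (hT : 0 < T) (k : ℝ) :
    boseFactor T k = k / (1 - Real.exp (-k / T)) := if_neg hT.ne'

/-- The defining relation; at `k = 0`, where the quotient is `0 / 0`, it holds as well. -/
theorem boseFactor_mul (hT : 0 < T) (k : ℝ) :
    boseFactor T k * (1 - Real.exp (-k / T)) = k := by
  rw [boseFactor_of_pos hT]
  rcases eq_or_ne k 0 with rfl | hk
  · simp
  · refine div_mul_cancel₀ k (sub_ne_zero.2 fun h => hk ?_)
    have := (Real.exp_eq_one_iff _).1 h.symm
    simpa [hT.ne'] using this

/-- Detailed balance. -/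
theorem boseFactor_neg (hT : 0 < T) (k : ℝ) :
    boseFactor T (-k) = boseFactor T k * Real.exp (-k / T) := by
  rcases eq_or_ne k 0 with rfl | hk
  · simp
  · have h1 : 1 - Real.exp (-k / T) ≠ 0 := fun h => hk (by
      rw [← boseFactor_mul hT k, h, mul_zero])
    have h2 : 1 - Real.exp (-(-k) / T) ≠ 0 := fun h => neg_ne_zero.2 hk (by
      rw [← boseFactor_mul hT (-k), h, mul_zero])
    have h3 : Real.exp (-k / T) * Real.exp (-(-k) / T) = 1 := by
      rw [← Real.exp_add, neg_neg, neg_div, neg_add_cancel, Real.exp_zero]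
    rw [boseFactor_of_pos hT, boseFactor_of_pos hT, div_mul_eq_mul_div, div_eq_div_iff h2 h1]
    linear_combination k * h3

theorem boseFactor_sub_neg (hT : 0 ≤ T) (k : ℝ) : boseFactor T k - boseFactor T (-k) = k := by
  rcases hT.eq_or_lt with rfl | hT
  · rw [boseFactor_zero_left, boseFactor_zero_left]
    exact max_zero_sub_max_neg_zero_eq_self k
  · rw [boseFactor_neg hT]
    linear_combination boseFactor_mul hT k

theorem boseFactor_nonneg (hT : 0 ≤ T) (k : ℝ) : 0 ≤ boseFactor T k := by
  rcases hT.eq_or_lt with rfl | hT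
  · rw [boseFactor_zero_left]
    exact le_max_right _ _
  · rw [boseFactor_of_pos hT]
    rcases le_total 0 k with hk | hk
    · refine div_nonneg hk (sub_nonneg.2 (Real.exp_le_one_iff.2 ?_))
      exact div_nonpos_of_nonpos_of_nonneg (neg_nonpos.2 hk) hT.le
    · refine div_nonneg_of_nonpos hk (sub_nonpos.2 (Real.one_le_exp ?_))
      exact div_nonneg (neg_nonneg.2 hk) hT.le

/-- The bound amounts to `1 + k / T ≤ e^{k/T}`. -/
theorem boseFactor_le_of_nonneg (hT : 0 ≤ T) {k : ℝ} (hk : 0 ≤ k) : boseFactor T k ≤ T + k := by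
  rcases hT.eq_or_lt with rfl | hT
  · rw [boseFactor_zero_left, max_eq_left hk, zero_add]
  · rcases hk.eq_or_lt with rfl | hk
    · rw [boseFactor_of_pos hT, zero_div]
      positivity
    · have h1 : Real.exp (-k / T) < 1 :=
        Real.exp_lt_one_iff.2 (div_neg_of_neg_of_pos (neg_lt_zero.2 hk) hT)
      rw [boseFactor_of_pos hT, div_le_iff₀ (sub_pos.2 h1)]
      have h2 := Real.add_one_le_exp (k / T)
      have h3 : Real.exp (-k / T) * Real.exp (k / T) = 1 := by
        rw [← Real.exp_add, neg_div, neg_add_cancel, Real.exp_zero]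
      have h4 : (T + k) * Real.exp (-k / T) ≤ T := by
        calc (T + k) * Real.exp (-k / T) = T * (Real.exp (-k / T) * (k / T + 1)) := by
              field_simp
              ring
          _ ≤ T * (Real.exp (-k / T) * Real.exp (k / T)) := by gcongr
          _ = T := by rw [h3, mul_one]
      linarith

theorem boseFactor_le (hT : 0 ≤ T) (k : ℝ) : boseFactor T k ≤ T + |k| := by
  rcases le_total 0 k with hk | hk
  · rw [abs_of_nonneg hk]
    exact boseFactor_le_of_nonneg hT hk
  · have h1 := boseFactor_le_of_nonneg hT (neg_nonneg.2 hk)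
    have h2 := boseFactor_sub_neg hT k
    have h3 := abs_nonneg k
    linarith

theorem measurable_boseFactor (T : ℝ) : Measurable (boseFactor T) := by
  unfold boseFactor
  split_ifs <;> fun_prop

theorem isMultiplier_boseFactor (hT : 0 ≤ T) :
    IsMultiplier (T + 1) fun k => (boseFactor T k : ℂ) := by
  refine ⟨Complex.measurable_ofReal.comp (measurable_boseFactor T), fun k => ?_⟩
  rw [Complex.norm_real, Real.norm_of_nonneg (boseFactor_nonneg hT k)]
  refine (boseFactor_le hT k).trans ?_
  nlinarith [mul_nonneg hT (abs_nonneg k)]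

/-- The Bose factor converges to its value at zero temperature. -/
theorem tendsto_boseFactor (k : ℝ) :
    Tendsto (fun T => boseFactor T k) (𝓝[>] 0) (𝓝 (max k 0)) := by
  have h0 : ∀ᶠ T : ℝ in 𝓝[>] 0, k / (1 - Real.exp (-k / T)) = boseFactor T k :=
    eventually_mem_nhdsWithin.mono fun T hT => (boseFactor_of_pos hT k).symm
  refine Tendsto.congr' h0 ?_
  simp only [div_eq_mul_inv (-k)]
  rcases lt_trichotomy k 0 with hk | rfl | hk
  · rw [max_eq_right hk.le]
    refine Tendsto.const_div_atBot ?_ k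
    refine tendsto_atBot_add_const_left _ 1 (tendsto_neg_atTop_atBot.comp ?_)
    exact Real.tendsto_exp_atTop.comp
      (tendsto_inv_nhdsGT_zero.const_mul_atTop (neg_pos.2 hk))
  · simp
  · rw [max_eq_left hk.le]
    have h1 : Tendsto (fun T : ℝ => Real.exp (-k * T⁻¹)) (𝓝[>] 0) (𝓝 0) :=
      Real.tendsto_exp_atBot.comp
        (tendsto_inv_nhdsGT_zero.const_mul_atTop_of_neg (neg_lt_zero.2 hk))
    have h2 : Tendsto (fun T : ℝ => k / (1 - Real.exp (-k * T⁻¹))) (𝓝[>] 0) (𝓝 (k / (1 - 0))) :=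
      tendsto_const_nhds.div (h1.const_sub 1) (by norm_num)
    simpa using h2

/-- The Bose factor continued into the strip: at distance `δ` from the boundary it decays. -/
theorem boseFactor_mul_exp_le (hT : 0 < T) {δ y : ℝ} (h1 : δ ≤ y) (h2 : y ≤ T⁻¹ - δ)
    (k : ℝ) : boseFactor T k * Real.exp (-(k * y)) ≤ (T + |k|) * Real.exp (-(δ * |k|)) := by
  rcases le_total 0 k with hk | hk
  · rw [abs_of_nonneg hk]
    refine mul_le_mul (boseFactor_le_of_nonneg hT.le hk) (Real.exp_le_exp.2 ?_)
      (Real.exp_nonneg _) (by positivity)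
    nlinarith
  · have h3 : boseFactor T k * Real.exp (-(k * y)) =
        boseFactor T (-k) * Real.exp (k * (T⁻¹ - y)) := by
      rw [boseFactor_neg hT, mul_assoc, ← Real.exp_add]
      congr 2
      rw [div_eq_mul_inv]
      ring
    rw [h3, abs_of_nonpos hk]
    refine mul_le_mul (boseFactor_le_of_nonneg hT.le (neg_nonneg.2 hk)) (Real.exp_le_exp.2 ?_)
      (Real.exp_nonneg _) (by linarith)
    nlinarith

end Bose

/-! ### Thermal two-point functions -/

section Thermal

open scoped InnerProductSpace

variable {T : ℝ}

/-- Along almost every null generator the thermal integrand is given by the modes. -/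
theorem modeIntegrand_ae_eq (T : ℝ) (f h : Field) : ∀ᵐ p ∂sphereMeasure,
    modeIntegrand T f h p =ᵐ[volume] fun k =>
      (boseFactor T k : ℂ) * ⟪fieldModes h (p, k), fieldModes f (p, k)⟫_ℂ := by
  filter_upwards [(isModes_fieldModes f).ae_eq, (isModes_fieldModes h).ae_eq, fieldModes_neg h]
    with p e1 e2 e3
  filter_upwards [e1, (Measure.measurePreserving_neg (volume : Measure ℝ)).quasiMeasurePreserving.ae
    e2, e3] with k e4 e5 e6
  rw [modeIntegrand, fourierU_eq, fourierU_eq, ← e4, ← e5]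
  simp only [e6, PiLp.inner_apply, RCLike.inner_apply]

theorem modesConverge (hT : 0 ≤ T) (f h : Field) : ModesConverge T f h := by
  have hi := (isMultiplier_boseFactor hT).integrable f h
  have he := modeIntegrand_ae_eq T f h
  refine ⟨?_, ?_, ?_⟩
  · filter_upwards [he, hi.prod_right_ae] with p e1 e2
    exact e2.congr e1.symm
  · refine hi.integral_prod_left.congr ?_
    filter_upwards [he] with p e1
    exact integral_congr_ae e1.symm
  · refine hi.norm.integral_prod_left.congr ?_
    filter_upwards [he] with p e1
    exact integral_congr_ae (e1.fun_comp norm).symm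

theorem thermalTwoPoint_eq (hT : 0 ≤ T) (f h : Field) :
    thermalTwoPoint T f h = 1 / Real.pi * modeForm (fun k => (boseFactor T k : ℂ)) f h := by
  rw [thermalTwoPoint, modeForm, linesMeasure,
    integral_prod _ ((isMultiplier_boseFactor hT).integrable f h)]
  congr 1
  refine integral_congr_ae ?_
  filter_upwards [modeIntegrand_ae_eq T f h] with p e1
  exact integral_congr_ae e1

/-- The thermal two-point function as a bilinear form. -/
def thermalForm (T : ℝ) (hT : 0 ≤ T) : Field →ₗ[ℝ] Field →ₗ[ℝ] ℂ :=
  LinearMap.mk₂ ℝ (thermalTwoPoint T)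
    (fun f f' h => by
      simp only [thermalTwoPoint_eq hT, (isMultiplier_boseFactor hT).modeForm_add_left, mul_add])
    (fun c f h => by
      simp only [thermalTwoPoint_eq hT, modeForm_smul_left, Complex.real_smul]
      ring)
    (fun f h h' => by
      simp only [thermalTwoPoint_eq hT, (isMultiplier_boseFactor hT).modeForm_add_right, mul_add])
    (fun c f h => by
      simp only [thermalTwoPoint_eq hT, modeForm_smul_right, Complex.real_smul]
      ring)

/-- The antisymmetric part of the two-point function comes from `b(k) - b(-k) = k`. -/
theorem thermalTwoPoint_sub_swap (hT : 0 ≤ T) (f h : Field) :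
    thermalTwoPoint T f h = thermalTwoPoint T h f + Complex.I * (symplecticForm f h : ℂ) := by
  have hm := isMultiplier_boseFactor hT
  have hm' : IsMultiplier (T + 1) fun k => (boseFactor T (-k) : ℂ) :=
    ⟨hm.measurable.comp measurable_neg, fun k => by simpa using hm.le (-k)⟩
  have h1 : modeForm (fun k => (boseFactor T k : ℂ)) f h =
      modeForm (fun k => (boseFactor T (-k) : ℂ)) f h + modeForm (fun k => (k : ℂ)) f h := by
    have hk : IsMultiplier 1 fun k : ℝ => (k : ℂ) :=
      ⟨Complex.measurable_ofReal, fun k => by simp⟩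
    rw [modeForm, modeForm, modeForm, ← integral_add (hm'.integrable f h) (hk.integrable f h)]
    refine integral_congr_ae (Eventually.of_forall fun x => ?_)
    dsimp only
    rw [← add_mul, ← Complex.ofReal_add, ← sub_eq_iff_eq_add'.1 (boseFactor_sub_neg hT x.2)]
  have hpi : (Real.pi : ℂ) ≠ 0 := Complex.ofReal_ne_zero.2 Real.pi_ne_zero
  rw [thermalTwoPoint_eq hT, thermalTwoPoint_eq hT, modeForm_swap _ f h, h1, modeForm_id]
  field_simp

theorem norm_thermalTwoPoint_le (hT : 0 ≤ T) (f h : Field) :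
    ‖thermalTwoPoint T f h‖ ≤ 4 * (T + 1) * (fieldNorm f * fieldNorm h) := by
  rw [thermalTwoPoint_eq hT, norm_mul, norm_div, norm_one, Complex.norm_real,
    Real.norm_of_nonneg Real.pi_nonneg]
  refine (mul_le_mul_of_nonneg_left ((isMultiplier_boseFactor hT).norm_modeForm_le f h)
    (by positivity)).trans_eq ?_
  field_simp

open scoped ComplexOrder in
theorem posSemidef_thermalTwoPoint (hT : 0 ≤ T) (s : Finset Field) :
    Matrix.PosSemidef (Matrix.of fun i j : s => thermalTwoPoint T i j) := by
  have h1 := (posSemidef_modeForm (boseFactor_nonneg hT) (isMultiplier_boseFactor hT) s).smul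
    (show (0 : ℝ) ≤ 1 / Real.pi by positivity)
  convert h1 using 1
  ext i j
  simp [thermalTwoPoint_eq hT]

/-- The quasi-free state at temperature `T`. -/
def thermalState (T : ℝ) (hT : 0 ≤ T) : BoundaryAlgebra →ₗ[ℂ] ℂ :=
  quasiFree (thermalForm T hT) (thermalTwoPoint_sub_swap hT)

theorem isQuasiFree_thermalState (hT : 0 ≤ T) :
    IsQuasiFree (thermalTwoPoint T) (thermalState T hT) :=
  isQuasiFree_iff.2 fun l => quasiFree_word _ _ l

theorem isQuasiFreeState_thermal_iff (hT : 0 ≤ T) (ω : BoundaryAlgebra →ₗ[ℂ] ℂ) :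
    IsQuasiFreeState (thermalTwoPoint T) ω ↔ ω = thermalState T hT := by
  constructor
  · exact fun h => isQuasiFree_unique h.2 (isQuasiFree_thermalState hT)
  · rintro rfl
    exact ⟨(isQuasiFree_thermalState hT).isState (posSemidef_thermalTwoPoint hT) (by positivity)
      (norm_thermalTwoPoint_le hT), isQuasiFree_thermalState hT⟩

theorem tendsto_thermalTwoPoint (f h : Field) :
    Tendsto (fun T => thermalTwoPoint T f h) (𝓝[>] 0) (𝓝 (thermalTwoPoint 0 f h)) := by
  have h1 : ∀ᶠ T : ℝ in 𝓝[>] 0, IsMultiplier 2 fun k => (boseFactor T k : ℂ) := by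
    filter_upwards [Ioo_mem_nhdsGT one_pos] with T hT
    have h2 := isMultiplier_boseFactor hT.1.le
    refine ⟨h2.measurable, fun k => (h2.le k).trans ?_⟩
    have := hT.2
    gcongr
    linarith
  rw [thermalTwoPoint_eq le_rfl]
  refine ((tendsto_modeForm h1 (fun k => ?_) f h).const_mul (1 / (Real.pi : ℂ))).congr' ?_
  · rw [boseFactor_zero_left]
    exact (Complex.continuous_ofReal.tendsto _).comp (tendsto_boseFactor k)
  · exact eventually_mem_nhdsWithin.mono fun T hT =>
      (thermalTwoPoint_eq (le_of_lt hT) f h).symm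

/-! ### The KMS condition for the thermal two-point functions -/

/-- The Bose factor times the Fourier character, continued to complex times. -/
def kmsMultiplier (T : ℝ) (z : ℂ) (k : ℝ) : ℂ := boseFactor T k * Complex.exp (k * z * Complex.I)

theorem norm_kmsMultiplier (hT : 0 < T) (z : ℂ) (k : ℝ) :
    ‖kmsMultiplier T z k‖ = boseFactor T k * Real.exp (-(k * z.im)) := by
  rw [kmsMultiplier, norm_mul, Complex.norm_real, Real.norm_of_nonneg (boseFactor_nonneg hT.le k),
    Complex.norm_exp]
  simp

theorem measurable_kmsMultiplier (T : ℝ) (z : ℂ) : Measurable (kmsMultiplier T z) := by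
  have := measurable_boseFactor T
  unfold kmsMultiplier
  fun_prop

theorem isMultiplier_kmsMultiplier (hT : 0 < T) {z : ℂ} (h0 : 0 ≤ z.im) (h1 : z.im ≤ T⁻¹) :
    IsMultiplier (T + 1) (kmsMultiplier T z) := by
  refine ⟨measurable_kmsMultiplier T z, fun k => ?_⟩
  rw [norm_kmsMultiplier hT]
  refine (boseFactor_mul_exp_le hT h0 (by rwa [sub_zero]) k).trans ?_
  rw [zero_mul, neg_zero, Real.exp_zero]
  nlinarith [mul_nonneg hT.le (abs_nonneg k)]

/-- The derivative of the integrand is dominated locally uniformly in the open strip. -/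
theorem norm_mul_kmsMultiplier_le (hT : 0 < T) {δ : ℝ} (hδ : 0 < δ) {z : ℂ} (h0 : δ ≤ z.im)
    (h1 : z.im ≤ T⁻¹ - δ) (k : ℝ) :
    ‖kmsMultiplier T z k * (k * Complex.I)‖ ≤ δ⁻¹ * (T + 1) * (1 + |k|) := by
  rw [norm_mul, norm_mul, Complex.norm_I, mul_one, Complex.norm_real, Real.norm_eq_abs,
    norm_kmsMultiplier hT]
  have h2 : |k| * Real.exp (-(δ * |k|)) ≤ δ⁻¹ := by
    rw [Real.exp_neg, ← div_eq_mul_inv, div_le_iff₀ (Real.exp_pos _), inv_mul_eq_div,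
      le_div_iff₀ hδ]
    linarith [Real.add_one_le_exp (δ * |k|)]
  calc boseFactor T k * Real.exp (-(k * z.im)) * |k|
      ≤ (T + |k|) * Real.exp (-(δ * |k|)) * |k| :=
        mul_le_mul_of_nonneg_right (boseFactor_mul_exp_le hT h0 h1 k) (abs_nonneg k)
    _ = (T + |k|) * (|k| * Real.exp (-(δ * |k|))) := by ring
    _ ≤ ((T + 1) * (1 + |k|)) * δ⁻¹ := by
        refine mul_le_mul ?_ h2 (by positivity) (by positivity)
        nlinarith [mul_nonneg hT.le (abs_nonneg k)]
    _ = δ⁻¹ * (T + 1) * (1 + |k|) := by ring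

theorem hasDerivAt_kmsMultiplier (T : ℝ) (z : ℂ) (k : ℝ) :
    HasDerivAt (fun z => kmsMultiplier T z k) (kmsMultiplier T z k * (k * Complex.I)) z := by
  have h1 : HasDerivAt (fun z : ℂ => (k : ℂ) * z * Complex.I) (k * Complex.I) z := by
    simpa using ((hasDerivAt_id z).const_mul (k : ℂ)).mul_const Complex.I
  exact (h1.cexp.const_mul (boseFactor T k : ℂ)).congr_deriv (mul_assoc _ _ _).symm

theorem isStripFunction_modeForm (hT : 0 < T) (f h : Field) :
    IsStripFunction T⁻¹ fun z => modeForm (kmsMultiplier T z) f h := by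
  refine ⟨fun z hz => ?_, fun z hz => ?_, _, fun z h0 h1 =>
    (isMultiplier_kmsMultiplier hT h0 h1).norm_modeForm_le f h⟩
  · refine tendsto_modeForm (C := T + 1) ?_ (fun k => ?_) f h
    · exact eventually_mem_nhdsWithin.mono fun w hw => isMultiplier_kmsMultiplier hT hw.1 hw.2
    · exact (hasDerivAt_kmsMultiplier T z k).continuousAt.continuousWithinAt
  · obtain ⟨δ, hδ, hd1, hd2⟩ : ∃ δ, 0 < δ ∧ 2 * δ ≤ z.im ∧ 2 * δ ≤ T⁻¹ - z.im :=
      ⟨min (z.im / 2) ((T⁻¹ - z.im) / 2), lt_min (half_pos hz.1) (half_pos (sub_pos.2 hz.2)),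
        by linarith [min_le_left (z.im / 2) ((T⁻¹ - z.im) / 2)],
        by linarith [min_le_right (z.im / 2) ((T⁻¹ - z.im) / 2)]⟩
    have hb : ∀ w ∈ Metric.ball z δ, δ ≤ w.im ∧ w.im ≤ T⁻¹ - δ := fun w hw => by
      have h1 := (Complex.abs_im_le_norm (w - z)).trans_lt (mem_ball_iff_norm.1 hw)
      rw [Complex.sub_im, abs_lt] at h1
      constructor <;> linarith
    have h2 := hasDerivAt_integral_of_dominated_loc_of_deriv_le (𝕜 := ℂ)
      (μ := linesMeasure sphereMeasure) (x₀ := z) (s := Metric.ball z δ)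
      (F := fun w x => kmsMultiplier T w x.2 * ⟪fieldModes h x, fieldModes f x⟫_ℂ)
      (F' := fun w x => kmsMultiplier T w x.2 * (x.2 * Complex.I) *
        ⟪fieldModes h x, fieldModes f x⟫_ℂ)
      (bound := fun x => δ⁻¹ * (T + 1) * modeBound f h x) (Metric.ball_mem_nhds z hδ)
      (Eventually.of_forall fun w =>
        aestronglyMeasurable_modeForm (measurable_kmsMultiplier T w) f h)
      ((isMultiplier_kmsMultiplier hT hz.1.le hz.2.le).integrable f h)
      (aestronglyMeasurable_modeForm (m := fun k => kmsMultiplier T z k * (k * Complex.I))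
        ((measurable_kmsMultiplier T z).mul (by fun_prop)) f h)
      (Eventually.of_forall fun x w hw => ?_) ((integrable_modeBound f h).const_mul _)
      (Eventually.of_forall fun x w hw => (hasDerivAt_kmsMultiplier T w x.2).mul_const _)
    · exact h2.2.differentiableAt.differentiableWithinAt
    · rw [norm_mul, modeBound, ← mul_assoc (δ⁻¹ * (T + 1))]
      exact mul_le_mul (norm_mul_kmsMultiplier_le hT hδ (hb w hw).1 (hb w hw).2 x.2)
        (norm_inner_le_norm _ _) (norm_nonneg _) (by positivity)

theorem isKMS_thermalState (hT : 0 < T) : IsKMS T⁻¹ (thermalState T hT.le) := by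
  refine (isQuasiFree_thermalState hT.le).isKMS (fun t f g => ?_) fun f g => ?_
  · rw [thermalTwoPoint_eq hT.le, thermalTwoPoint_eq hT.le, modeForm_translate]
  · refine ⟨fun z => 1 / Real.pi * modeForm (kmsMultiplier T z) f g,
      (IsStripFunction.const _).mul (isStripFunction_modeForm hT f g), fun t => ⟨?_, ?_⟩⟩
    · rw [thermalTwoPoint_eq hT.le, modeForm_translate_right]
      rfl
    · rw [thermalTwoPoint_eq hT.le, modeForm_swap _ f, modeForm_translate_right]
      refine congrArg (fun m => 1 / (Real.pi : ℂ) * modeForm m f g) (funext fun k => ?_)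
      -- the shift by `i / T` turns the Bose factor at `k` into the one at `-k`
      rw [kmsMultiplier, boseFactor_neg hT, Complex.ofReal_mul, Complex.ofReal_exp,
        mul_assoc (boseFactor T k : ℂ), ← Complex.exp_add]
      congr 2
      push_cast
      rw [div_eq_mul_inv]
      linear_combination (k * (T : ℂ)⁻¹) * Complex.I_sq

end Thermal

/-! ### The vacuum two-point function -/

section Vacuum

open scoped InnerProductSpace

/-- The coordinates `((u, p), u' - u)` separate the two factors of the majorant of the kernel. -/
theorem measurePreserving_shear : MeasurePreserving
    (fun x : (ℝ × ℝ) × S2 => ((x.1.1, x.2), -x.1.1 + x.1.2)) doubleMeasure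
    (scriMeasure.prod volume) := by
  have h1 : MeasurePreserving (fun z : ℝ × ℝ => (z.1, -z.1 + z.2))
      ((volume : Measure ℝ).prod volume) ((volume : Measure ℝ).prod volume) :=
    measurePreserving_prod_neg_add _ _
  have h2 := h1.prod (MeasurePreserving.id sphereMeasure)
  have h3 := measurePreserving_prodAssoc (volume : Measure ℝ) (volume : Measure ℝ) sphereMeasure
  have h4 := (MeasurePreserving.id (volume : Measure ℝ)).prod
    (Measure.measurePreserving_swap (μ := (volume : Measure ℝ)) (ν := sphereMeasure))
  have h5 := (measurePreserving_prodAssoc (volume : Measure ℝ) sphereMeasure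
    (volume : Measure ℝ)).symm
  exact h5.comp (h4.comp (h3.comp h2))

theorem measurePreserving_exchange : MeasurePreserving
    (fun x : (ℝ × ℝ) × S2 => ((x.1.2, x.1.1), x.2)) doubleMeasure doubleMeasure :=
  Measure.measurePreserving_swap.prod (MeasurePreserving.id sphereMeasure)

theorem integrable_inv_sq_add_sq {ε : ℝ} (hε : 0 < ε) :
    Integrable fun x : ℝ => (x ^ 2 + ε ^ 2)⁻¹ := by
  refine ((integrable_inv_one_add_sq.comp_div hε.ne').const_mul (ε ^ 2)⁻¹).congr
    (Eventually.of_forall fun x => ?_)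
  dsimp only
  rw [← mul_inv]
  congr 1
  field_simp
  ring

theorem integrable_sq_norm_mul_kernel {ε : ℝ} (hε : 0 < ε) (f : Field) :
    Integrable (fun x : (ℝ × ℝ) × S2 => ‖f.1 (x.1.1, x.2)‖ ^ 2 *
      ((x.1.1 - x.1.2) ^ 2 + ε ^ 2)⁻¹) doubleMeasure := by
  have h1 := (f.2.2.2.1.integrable_norm_pow two_ne_zero).mul_prod (integrable_inv_sq_add_sq hε)
  refine (measurePreserving_shear.integrable_comp_of_integrable h1).congr
    (Eventually.of_forall fun x => ?_)
  simp only [Function.comp_apply]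
  congr 3
  ring

theorem norm_sq_vacuumDenominator (ε u u' : ℝ) :
    ‖((u : ℂ) - u' - Complex.I * ε) ^ 2‖ = (u - u') ^ 2 + ε ^ 2 := by
  rw [norm_pow, ← Complex.normSq_eq_norm_sq, Complex.normSq_apply]
  simp
  ring

/-- Absolute convergence, by comparison of `‖f‖ ‖h‖` with `‖f‖² + ‖h‖²`: each of the two squares
depends on only one of `u`, `u'`, and the kernel is integrable in the difference. -/
theorem integrable_vacuumIntegrand {ε : ℝ} (hε : 0 < ε) (f h : Field) :
    Integrable (vacuumIntegrand ε f h) doubleMeasure := by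
  have h1 := integrable_sq_norm_mul_kernel hε f
  have h2 := measurePreserving_exchange.integrable_comp_of_integrable
    (integrable_sq_norm_mul_kernel hε h)
  have hd : ∀ x : (ℝ × ℝ) × S2,
      ((x.1.1 : ℂ) - (x.1.2 : ℂ) - Complex.I * (ε : ℂ)) ^ 2 ≠ 0 := fun x => by
    rw [← norm_ne_zero_iff, norm_sq_vacuumDenominator]
    positivity
  have hc : Continuous (vacuumIntegrand ε f h) := by
    have hf := continuous_field f
    have hh := continuous_field h
    refine Continuous.div (Complex.continuous_ofReal.comp (Continuous.inner ?_ ?_)) ?_ hd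
    · exact hf.comp (by fun_prop)
    · exact hh.comp (by fun_prop)
    · fun_prop
  refine (h1.add h2).mono' hc.aestronglyMeasurable (Eventually.of_forall fun x => ?_)
  have h3 := norm_inner_le_norm (𝕜 := ℝ) (f.1 (x.1.1, x.2)) (h.1 (x.1.2, x.2))
  have h4 : (x.1.2 - x.1.1) ^ 2 = (x.1.1 - x.1.2) ^ 2 := by ring
  rw [vacuumIntegrand, norm_div, norm_sq_vacuumDenominator, Complex.norm_real, Pi.add_apply,
    Function.comp_apply]
  dsimp only
  rw [h4, ← add_mul, div_eq_mul_inv]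
  refine mul_le_mul_of_nonneg_right (h3.trans ?_) (by positivity)
  nlinarith [sq_nonneg (‖f.1 (x.1.1, x.2)‖ - ‖h.1 (x.1.2, x.2)‖),
    sq_nonneg (‖f.1 (x.1.1, x.2)‖ + ‖h.1 (x.1.2, x.2)‖)]

theorem vacuumMultiplier_le_max {ε : ℝ} (hε : 0 ≤ ε) (k : ℝ) :
    vacuumMultiplier ε k ≤ max k 0 := by
  rcases le_total 0 k with hk | hk
  · rw [vacuumMultiplier, max_eq_left hk, neg_mul]
    exact mul_le_of_le_one_right hk (Real.exp_le_one_iff.2 (neg_nonpos.2 (mul_nonneg hε hk)))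
  · rw [vacuumMultiplier, max_eq_right hk, zero_mul]

theorem isMultiplier_vacuumMultiplier {ε : ℝ} (hε : 0 ≤ ε) :
    IsMultiplier 1 fun k => (vacuumMultiplier ε k : ℂ) := by
  refine ⟨Complex.measurable_ofReal.comp (continuous_vacuumMultiplier ε).measurable, fun k => ?_⟩
  rw [Complex.norm_real, Real.norm_of_nonneg (vacuumMultiplier_nonneg ε k), one_mul]
  refine (vacuumMultiplier_le_max hε k).trans (max_le ?_ (by positivity))
  linarith [le_abs_self k]

/-- The regularised vacuum two-point function has the form of the thermal ones, the Bose factor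
being replaced by `k Θ(k) e^{-εk}`. -/
theorem vacuumRegularised_eq {ε : ℝ} (hε : 0 < ε) (f h : Field) :
    vacuumRegularised ε f h =
      1 / Real.pi * modeForm (fun k => (vacuumMultiplier ε k : ℂ)) f h := by
  have hi := integrable_vacuumIntegrand hε f h
  have h1 : ∫ x, vacuumIntegrand ε f h x ∂doubleMeasure =
      -modeForm (fun k => (vacuumMultiplier ε k : ℂ)) f h := by
    rw [doubleMeasure, integral_prod_symm _ hi, modeForm, linesMeasure,
      integral_prod _ ((isMultiplier_vacuumMultiplier hε.le).integrable f h), ← integral_neg]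
    refine integral_congr_ae ?_
    filter_upwards [hi.prod_left_ae, (isModes_fieldModes f).memLp, (isModes_fieldModes h).memLp,
      (isModes_fieldModes f).ae_eq, (isModes_fieldModes h).ae_eq] with p e1 e2 e3 e4 e5
    have h2 : ∀ x : ℝ × ℝ, vacuumIntegrand ε f h (x, p) =
        ⟪fieldLine h p x.2, fieldLine f p x.1⟫_ℂ /
          ((x.1 : ℂ) - x.2 - Complex.I * ε) ^ 2 := fun x => by
      rw [vacuumIntegrand, fieldLine_apply, fieldLine_apply, inner_complexify, real_inner_comm]
    simp only [h2] at e1 ⊢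
    rw [integral_vacuumKernel hε e2 e3 e1]
    congr 1
    refine integral_congr_ae ?_
    filter_upwards [e4, e5] with k e6 e7
    rw [e6, e7]
  rw [vacuumRegularised, h1]
  ring

theorem tendsto_vacuumRegularised (f h : Field) :
    Tendsto (fun ε => vacuumRegularised ε f h) (𝓝[>] 0) (𝓝 (thermalTwoPoint 0 f h)) := by
  rw [thermalTwoPoint_eq le_rfl]
  have h1 : ∀ᶠ ε : ℝ in 𝓝[>] 0, IsMultiplier 1 fun k => (vacuumMultiplier ε k : ℂ) :=
    eventually_mem_nhdsWithin.mono fun ε hε => isMultiplier_vacuumMultiplier (le_of_lt hε)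
  refine ((tendsto_modeForm h1 (fun k => ?_) f h).const_mul (1 / (Real.pi : ℂ))).congr' ?_
  · have hc : Continuous fun ε : ℝ => (vacuumMultiplier ε k : ℂ) := by
      unfold vacuumMultiplier
      fun_prop
    have h2 := hc.tendsto 0
    rw [vacuumMultiplier, neg_zero, zero_mul, Real.exp_zero, mul_one,
      ← boseFactor_zero_left] at h2
    exact h2.mono_left nhdsWithin_le_nhds
  · exact eventually_mem_nhdsWithin.mono fun ε hε => (vacuumRegularised_eq hε f h).symm

theorem vacuumTwoPoint_eq : vacuumTwoPoint = thermalTwoPoint 0 := by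
  funext f h
  exact (tendsto_vacuumRegularised f h).limUnder_eq

end Vacuum

end NullInfinity

end

theorem mainTheorem7 :
    ∃ (ωvac : NullInfinity.BoundaryAlgebra →ₗ[ℂ] ℂ)
      (ωT : ℝ → NullInfinity.BoundaryAlgebra →ₗ[ℂ] ℂ),
      -- the vacuum two-point function is well defined and determines the vacuum state
      (∀ f h : NullInfinity.Field,
        (∀ ε : ℝ, 0 < ε → Integrable (NullInfinity.vacuumIntegrand ε f h)
          NullInfinity.doubleMeasure) ∧
        Tendsto (fun ε : ℝ => NullInfinity.vacuumRegularised ε f h) (𝓝[>] 0)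
          (𝓝 (NullInfinity.vacuumTwoPoint f h))) ∧
      (∀ ω : NullInfinity.BoundaryAlgebra →ₗ[ℂ] ℂ,
        NullInfinity.IsQuasiFreeState NullInfinity.vacuumTwoPoint ω ↔ ω = ωvac) ∧
      -- the thermal two-point functions are well defined and determine quasi-free states
      (∀ T : ℝ, 0 ≤ T →
        (∀ f h : NullInfinity.Field, NullInfinity.ModesConverge T f h) ∧
        (∀ ω : NullInfinity.BoundaryAlgebra →ₗ[ℂ] ℂ,
          NullInfinity.IsQuasiFreeState (NullInfinity.thermalTwoPoint T) ω ↔ ω = ωT T)) ∧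
      ωT 0 = ωvac ∧
      -- the KMS condition at temperature `T`
      (∀ T : ℝ, 0 < T → NullInfinity.IsKMS T⁻¹ (ωT T)) ∧
      -- weak convergence
      (∀ a : NullInfinity.BoundaryAlgebra,
        Tendsto (fun T : ℝ => ωT T a) (𝓝[>] 0) (𝓝 (ωvac a))) := by
  classical
  -- negative temperatures are irrelevant and receive the value `0`
  let ωT : ℝ → NullInfinity.BoundaryAlgebra →ₗ[ℂ] ℂ := fun T =>
    if hT : 0 ≤ T then NullInfinity.thermalState T hT else 0
  have hωT : ∀ {T : ℝ} (hT : 0 ≤ T), ωT T = NullInfinity.thermalState T hT := fun hT => dif_pos hT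
  refine ⟨NullInfinity.thermalState 0 le_rfl, ωT, fun f h =>
    ⟨fun ε hε => NullInfinity.integrable_vacuumIntegrand hε f h, ?_⟩, fun ω => ?_, fun T hT =>
    ⟨NullInfinity.modesConverge hT, fun ω => ?_⟩, hωT le_rfl, fun T hT => ?_, fun a => ?_⟩
  · rw [NullInfinity.vacuumTwoPoint_eq]
    exact NullInfinity.tendsto_vacuumRegularised f h
  · rw [NullInfinity.vacuumTwoPoint_eq]
    exact NullInfinity.isQuasiFreeState_thermal_iff le_rfl ω
  · rw [hωT hT]
    exact NullInfinity.isQuasiFreeState_thermal_iff hT ω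
  · rw [hωT hT.le]
    exact NullInfinity.isKMS_thermalState hT
  · refine NullInfinity.tendsto_isQuasiFree (eventually_mem_nhdsWithin.mono fun T hT => ?_)
      (NullInfinity.isQuasiFree_thermalState le_rfl) NullInfinity.tendsto_thermalTwoPoint a
    rw [hωT (le_of_lt hT)]
    exact NullInfinity.isQuasiFree_thermalState (le_of_lt hT)
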